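/- Let $T=\mathbb{G}_m^n$ be the $n$-dimensional split torus over $\mathbb{R}$, with character lattice $M=\mathbb{Z}^n$, cocharacter lattice $N=\mathbb{Z}^n$, $N_{\mathbb{R}}=N\otimes\mathbb{R}$ and $T(\mathbb{R})=(\mathbb{R}^*)^n$; for $v\in N$ let $\lambda_v\colon\mathbb{G}_m\to T$ be the corresponding cocharacter. For $A\subset N_{\mathbb{R}}$ let $A^*$ be the set of linear forms that are nonnegative on $A$, and for a pointed finitely generated rational cone $\sigma\subset N_{\mathbb{R}}$ let $U_\sigma=\operatorname{Spec}\mathbb{R}[M\cap\sigma^*]$, with unique closed $T$-orbit $O_\sigma$. A fan $\Sigma$ is a finite non-empty set of such cones that is closed under taking faces and in which any two cones intersect in a face of both; $|\Sigma|$ is the union of its cones, $\Sigma$ is complete if $|\Sigma|=N_{\mathbb{R}}$, and $X_\Sigma$ is the toric variety glued from the $U_\sigma$, $\sigma\in\Sigma$. For $\tau\in\Sigma$ let $Y_\tau$ be the Zariski closure of $O_\tau$ in $X_\Sigma$. A completion of a normal affine $\mathbb{R}$-variety $V$ is an open dense embedding $V\hookrightarrow X$ into a normal complete $\mathbb{R}$-variety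 $X$. It is compatible with a semi-algebraic set $S\subset V(\mathbb{R})$ if for every irreducible component $Z$ of $X\setminus V$ the set $Z(\mathbb{R})\cap\overline S$ is either empty or Zariski dense in $Z$, where $\overline S$ is the closure of $S$ in $X(\mathbb{R})$ for the Euclidean topology. For an open semi-algebraic set $S\subset T(\mathbb{R})$ and $v\in N$ let $S(v)$ be the set of all $\xi\in T(\mathbb{R})$ such that $\lambda_v(s)\xi\in S$ for all sufficiently small real $s>0$, and let $K_0(S)=\{v\in N\colon \operatorname{int}S(v)\neq\emptyset\}$. **Proposition.** Let $\Sigma$ be a complete fan in $N_{\mathbb{R}}$, let $\sigma\in\Sigma$, and let $S\subset T(\mathbb{R})$ be an open semi-algebraic set, regarded as a subset of $U_\sigma(\mathbb{R})\subset X_\Sigma(\mathbb{R})$. Suppose that the toric compatibility condition (TC) holds: for every one-dimensional cone $\tau\in\Sigma$ with $\tau\not\subset\sigma$, either $\overline S\cap Y_\tau(\mathbb{R})=\emptyset$, or $K_0(S)\cap\operatorname{relint}(\tau)\neq\emptyset$. Let $F_S$ be the subfan of $\Sigma$ consisting of all $\rho\in\Sigma$ such that every one-dimensional face $\tau$ of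 $\rho$ satisfies $\tau\subset\sigma$ or $K_0(S)\cap\operatorname{relint}(\tau)\neq\emptyset$. Then $X_\Sigma$ is an $S$-compatible completion of $U_\sigma$. Moreover, let $B_{U_\sigma}(S)$ be the ring of all regular functions on $U_\sigma$ that are bounded on $S$. Then restriction to $U_\sigma\subset X_{F_S}$ is injective on $\mathcal{O}(X_{F_S})$ and, inside $\mathbb{R}[U_\sigma]=\mathbb{R}[M\cap\sigma^*]$, $$B_{U_\sigma}(S)=\mathcal{O}(X_{F_S})=\mathbb{R}[H],\qquad H=M\cap|F_S|^*.$$ In particular, the $\mathbb{R}$-algebra $B_{U_\sigma}(S)$ is finitely generated. -/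

import Mathlib

open CategoryTheory AlgebraicGeometry Limits

namespace ToricCompletion

noncomputable section

/-!
The torus is `T = 𝔾ₘⁿ` over `ℝ`, so that its character lattice is `M = ℤⁿ`, its cocharacter
lattice is `N = ℤⁿ`, `N_ℝ = ℝⁿ` and `T(ℝ) = (ℝˣ)ⁿ`.
-/

/-! ### Cones -/

/-- The pairing between the character lattice `M = ℤⁿ` and `N_ℝ = ℝⁿ`. -/
def pairing {n : ℕ} (m : Fin n → ℤ) (x : Fin n → ℝ) : ℝ := ∑ i, (m i : ℝ) * x i

/-- The inclusion `N = ℤⁿ → N_ℝ = ℝⁿ`. -/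
def intCast {n : ℕ} (v : Fin n → ℤ) : Fin n → ℝ := fun i => (v i : ℝ)

/-- Finitely generated rational convex cones in `N_ℝ`. -/
def IsRationalCone {n : ℕ} (σ : PointedCone ℝ (Fin n → ℝ)) : Prop :=
  ∃ G : Finset (Fin n → ℤ), σ = PointedCone.hull ℝ (intCast '' (G : Set (Fin n → ℤ)))

/-- `τ` is a face of `σ`: it is the intersection of `σ` with the hyperplane `u = 0`, for some
linear form `u` that is nonnegative on `σ` (a supporting hyperplane, or `u = 0`). -/
def IsFace {n : ℕ} (τ σ : PointedCone ℝ (Fin n → ℝ)) : Prop :=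
  ∃ u : Fin n → ℝ, (∀ x ∈ σ, 0 ≤ u ⬝ᵥ x) ∧ ∀ x, x ∈ τ ↔ x ∈ σ ∧ u ⬝ᵥ x = 0

/-- The monoid `M ∩ A^*` of characters that are nonnegative on a subset `A` of `N_ℝ`. -/
def latticeDual {n : ℕ} (A : Set (Fin n → ℝ)) : AddSubmonoid (Fin n → ℤ) where
  carrier := {m | ∀ x ∈ A, 0 ≤ pairing m x}
  zero_mem' := fun x _ => by simp [pairing]
  add_mem' := fun {a b} ha hb x hx => by
    have := add_nonneg (ha x hx) (hb x hx)
    simpa [pairing, add_mul, Finset.sum_add_distrib] using this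

theorem latticeDual_anti {n : ℕ} {A B : Set (Fin n → ℝ)} (h : A ⊆ B) :
    latticeDual B ≤ latticeDual A := fun _ hm x hx => hm x (h hx)

theorem pairing_add_smul {n : ℕ} (w m : Fin n → ℤ) (k : ℕ) (x : Fin n → ℝ) :
    pairing (w + k • m) x = pairing w x + k * pairing m x := by
  simp [pairing, add_mul, Finset.sum_add_distrib, Finset.mul_sum, mul_assoc]

theorem pairing_neg {n : ℕ} (m : Fin n → ℤ) (x : Fin n → ℝ) :
    pairing (-m) x = - pairing m x := by
  simp [pairing]

theorem hull_nonneg {n : ℕ} {s : Set (Fin n → ℝ)} {w : Fin n → ℝ}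
    (h : ∀ x ∈ s, 0 ≤ w ⬝ᵥ x) {x : Fin n → ℝ} (hx : x ∈ PointedCone.hull ℝ s) : 0 ≤ w ⬝ᵥ x := by
  induction hx using Submodule.span_induction with
  | mem x hx => exact h x hx
  | zero => simp
  | add x y _ _ hx hy => rw [dotProduct_add]; exact add_nonneg hx hy
  | smul a x _ hx =>
    have : w ⬝ᵥ (a • x) = (a : ℝ) * (w ⬝ᵥ x) := by
      rw [show a • x = (a : ℝ) • x from rfl, dotProduct_smul, smul_eq_mul]
    rw [this]; exact mul_nonneg a.2 hx

theorem pairing_eq {n : ℕ} (m : Fin n → ℤ) (x : Fin n → ℝ) : pairing m x = intCast m ⬝ᵥ x := rfl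

theorem IsFace.le {n : ℕ} {τ σ : PointedCone ℝ (Fin n → ℝ)} (h : IsFace τ σ) : τ ≤ σ := by
  obtain ⟨u, -, hu⟩ := h
  exact fun x hx => ((hu x).1 hx).1

/-- Supporting functionals may be perturbed to rational, hence integral, ones. -/
theorem exists_integral_functional {n : ℕ} (G : Finset (Fin n → ℤ)) (u : Fin n → ℝ)
    (hu : ∀ g ∈ G, 0 ≤ u ⬝ᵥ intCast g) :
    ∃ m : Fin n → ℤ, ∀ g ∈ G, 0 ≤ pairing m (intCast g) ∧
      (pairing m (intCast g) = 0 ↔ u ⬝ᵥ intCast g = 0) := by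
  let W : Submodule ℚ ℝ := Submodule.span ℚ (Set.range u)
  have : FiniteDimensional ℚ W := FiniteDimensional.span_of_finite ℚ (Set.finite_range u)
  let b := Module.finBasis ℚ W
  let d := Module.finrank ℚ W
  let uu : Fin n → W := fun i => ⟨u i, Submodule.subset_span ⟨i, rfl⟩⟩
  -- coordinates of the pairing of `u` with `g`
  let Q : (Fin n → ℤ) → Fin d → ℚ := fun g j => ∑ i, b.repr (uu i) j * g i
  have hQ : ∀ g, u ⬝ᵥ intCast g = ∑ j, (b j : ℝ) * (Q g j : ℝ) := by
    intro g
    have h1 : ∀ i, u i = ∑ j, (b.repr (uu i) j : ℝ) * (b j : ℝ) := by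
      intro i
      have := congrArg (fun w : W => (w : ℝ)) (b.sum_repr (uu i))
      simp only [Submodule.coe_sum, Submodule.coe_smul, Rat.smul_def] at this
      exact this.symm
    simp only [dotProduct, intCast, Q]
    calc ∑ i, u i * (g i : ℝ) = ∑ i, ∑ j, (b.repr (uu i) j : ℝ) * (b j : ℝ) * g i := by
          refine Finset.sum_congr rfl fun i _ => ?_
          rw [← Finset.sum_mul, ← h1 i]
      _ = _ := by
          rw [Finset.sum_comm]
          refine Finset.sum_congr rfl fun j _ => ?_
          push_cast
          rw [Finset.mul_sum]
          exact Finset.sum_congr rfl fun i _ => by ring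
  have hQ0 : ∀ g, u ⬝ᵥ intCast g = 0 → Q g = 0 := by
    intro g hg
    rw [hQ] at hg
    have h2 : ∑ j, Q g j • b j = 0 := by
      apply Subtype.ext
      simp only [Submodule.coe_sum, Submodule.coe_smul, Rat.smul_def, Submodule.coe_zero]
      rw [← hg]
      exact Finset.sum_congr rfl fun j _ => mul_comm _ _
    exact funext fun j => (Fintype.linearIndependent_iff.1 b.linearIndependent) _ h2 j
  -- choose a rational point near `b`
  let O : Set (Fin d → ℝ) :=
    ⋂ g ∈ G, {c | 0 < u ⬝ᵥ intCast g → 0 < ∑ j, c j * (Q g j : ℝ)}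
  have hO : IsOpen O := by
    refine isOpen_biInter_finset fun g _ => ?_
    by_cases h : 0 < u ⬝ᵥ intCast g
    · simp only [h, forall_const]
      exact isOpen_lt continuous_const (by fun_prop)
    · simp [h]
  have hbO : (fun j => (b j : ℝ)) ∈ O := by
    simp only [O, Set.mem_iInter]
    intro g _ hg
    rwa [← hQ]
  have hd : DenseRange (fun (c : Fin d → ℚ) (j : Fin d) => (c j : ℝ)) :=
    DenseRange.piMap (fun _ => Rat.denseRange_cast)
  obtain ⟨c, hc⟩ := hd.exists_mem_open hO ⟨_, hbO⟩
  let q : Fin n → ℚ := fun i => ∑ j, c j * b.repr (uu i) j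
  obtain ⟨D, hD, hDq⟩ : ∃ D : ℕ, 0 < D ∧ ∀ i, ∃ z : ℤ, (z : ℚ) = D * q i := by
    refine ⟨∏ i, (q i).den, Finset.prod_pos fun i _ => (q i).den_pos, fun i => ?_⟩
    refine ⟨(∏ k ∈ Finset.univ.erase i, ((q k).den : ℤ)) * (q i).num, ?_⟩
    rw [← Finset.mul_prod_erase Finset.univ (fun k => (q k).den) (Finset.mem_univ i)]
    push_cast
    have := Rat.den_mul_eq_num (q i)
    linear_combination (-(∏ k ∈ Finset.univ.erase i, ((q k).den : ℚ))) * this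
  choose m hm using hDq
  have key : ∀ g, pairing m (intCast g) = D * ∑ j, (c j : ℝ) * (Q g j : ℝ) := by
    intro g
    have : ∀ i, (m i : ℝ) = D * (q i : ℝ) := fun i => by exact_mod_cast congrArg (fun x : ℚ => (x : ℝ)) (hm i)
    simp only [pairing, this, intCast, q, Q]
    push_cast
    simp only [Finset.mul_sum, Finset.sum_mul]
    rw [Finset.sum_comm]
    exact Finset.sum_congr rfl fun j _ => Finset.sum_congr rfl fun i _ => by ring
  have hDr : (0 : ℝ) < D := by exact_mod_cast hD
  refine ⟨m, fun g hg => ?_⟩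
  rcases (hu g hg).eq_or_lt with h | h
  · have h0 : pairing m (intCast g) = 0 := by simp [key, hQ0 g h.symm]
    exact ⟨h0.ge, by simp [h0, ← h]⟩
  · have h3 : 0 < pairing m (intCast g) := by
      rw [key]
      refine mul_pos hDr ?_
      have := Set.mem_iInter₂.1 hc g hg
      exact this h
    exact ⟨h3.le, by simp [h3.ne', h.ne']⟩

theorem nonpos_of_generators {n : ℕ} {G : Finset (Fin n → ℤ)} {u p : Fin n → ℝ}
    (hu : ∀ g ∈ G, 0 ≤ u ⬝ᵥ intCast g) (hp : ∀ g ∈ G, u ⬝ᵥ intCast g = 0 → p ⬝ᵥ intCast g = 0)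
    {x : Fin n → ℝ} (hx : x ∈ PointedCone.hull ℝ (intCast '' (G : Set (Fin n → ℤ))))
    (hux : u ⬝ᵥ x = 0) : p ⬝ᵥ x ≤ 0 := by
  obtain ⟨c, hc⟩ : ∃ c : ℝ, ∀ g ∈ G, p ⬝ᵥ intCast g ≤ c * (u ⬝ᵥ intCast g) := by
    obtain ⟨c, hc⟩ := (G.image fun g => (p ⬝ᵥ intCast g) / (u ⬝ᵥ intCast g)).bddAbove
    refine ⟨c, fun g hg => ?_⟩
    rcases (hu g hg).eq_or_lt with h0 | h0
    · rw [hp g hg h0.symm, ← h0, mul_zero]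
    · exact (div_le_iff₀ h0).1 (hc (by simpa using ⟨g, hg, rfl⟩))
  have h2 : 0 ≤ (c • u - p) ⬝ᵥ x := by
    refine hull_nonneg ?_ hx
    rintro _ ⟨g, hg, rfl⟩
    have := hc g hg
    rw [sub_dotProduct, smul_dotProduct, smul_eq_mul]
    linarith
  rw [sub_dotProduct, smul_dotProduct, hux, smul_zero] at h2
  linarith

/-- A face of a rational cone is cut out by a lattice functional. -/
theorem IsFace.exists_int {n : ℕ} {τ σ : PointedCone ℝ (Fin n → ℝ)} (h : IsFace τ σ)
    (hσ : IsRationalCone σ) :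
    ∃ m ∈ latticeDual (σ : Set (Fin n → ℝ)), ∀ x, x ∈ τ ↔ x ∈ σ ∧ pairing m x = 0 := by
  obtain ⟨u, hu, hτ⟩ := h
  obtain ⟨G, rfl⟩ := hσ
  have hG : ∀ g ∈ G, 0 ≤ u ⬝ᵥ intCast g :=
    fun g hg => hu _ (PointedCone.subset_hull ⟨g, hg, rfl⟩)
  obtain ⟨m, hm⟩ := exists_integral_functional G u hG
  have hmx : ∀ x ∈ PointedCone.hull ℝ (intCast '' (G : Set (Fin n → ℤ))), 0 ≤ pairing m x := by
    refine fun x hx => hull_nonneg (w := intCast m) ?_ hx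
    rintro _ ⟨g, hg, rfl⟩
    exact (hm g hg).1
  refine ⟨m, hmx, fun x => (hτ x).trans (and_congr_right fun hx => ⟨fun h => ?_, fun h => ?_⟩)⟩
  · exact le_antisymm (nonpos_of_generators hG (fun g hg => (hm g hg).2.2) hx h) (hmx x hx)
  · exact le_antisymm (nonpos_of_generators (fun g hg => (hm g hg).1)
      (fun g hg => (hm g hg).2.1) hx h) (hu x hx)

/-- If a lattice functional cuts out a face, it becomes invertible on the dual monoid of the face,
and this dual monoid is generated by that of the cone and the inverse. -/
theorem latticeDual_face {n : ℕ} {τ σ : PointedCone ℝ (Fin n → ℝ)} (hσ : IsRationalCone σ)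
    {m : Fin n → ℤ} (hm : m ∈ latticeDual (σ : Set (Fin n → ℝ)))
    (hτ : ∀ x, x ∈ τ ↔ x ∈ σ ∧ pairing m x = 0) :
    -m ∈ latticeDual (τ : Set (Fin n → ℝ)) ∧
      ∀ w ∈ latticeDual (τ : Set (Fin n → ℝ)), ∃ k : ℕ,
        w + k • m ∈ latticeDual (σ : Set (Fin n → ℝ)) := by
  obtain ⟨G, hG⟩ := hσ
  have hGσ : ∀ g ∈ G, intCast g ∈ σ := fun g hg => by
    rw [hG]; exact PointedCone.subset_hull ⟨g, hg, rfl⟩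
  refine ⟨fun x hx => by rw [pairing_neg, ((hτ x).1 hx).2, neg_zero], fun w hw => ?_⟩
  obtain ⟨c, hc⟩ := (G.image fun g => - pairing w (intCast g) / pairing m (intCast g)).bddAbove
  obtain ⟨k, hk⟩ := exists_nat_ge c
  refine ⟨k, fun x hx => ?_⟩
  rw [SetLike.mem_coe, hG] at hx
  refine hull_nonneg (w := intCast (w + k • m)) ?_ hx
  rintro _ ⟨g, hg, rfl⟩
  rw [← pairing_eq, pairing_add_smul]
  rcases (hm _ (hGσ g hg)).eq_or_lt with h0 | h0
  · have : intCast g ∈ τ := (hτ _).2 ⟨hGσ g hg, h0.symm⟩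
    rw [← h0, mul_zero, add_zero]
    exact hw _ this
  · have h1 : - pairing w (intCast g) / pairing m (intCast g) ≤ k :=
      (hc (by simpa using ⟨g, hg, rfl⟩)).trans hk
    rw [div_le_iff₀ h0] at h1
    linarith

/-- The monoid algebra `ℝ[M ∩ A^*]`; for a cone `A = σ` this is `ℝ[H_σ] = ℝ[U_σ]`. -/
abbrev CoordRing {n : ℕ} (A : Set (Fin n → ℝ)) : Type := AddMonoidAlgebra ℝ (latticeDual A)

/-- The inclusion `ℝ[M ∩ B^*] ⊆ ℝ[M ∩ A^*]` for `A ⊆ B`. -/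
def CoordRing.incl {n : ℕ} {A B : Set (Fin n → ℝ)} (h : A ⊆ B) : CoordRing B →ₐ[ℝ] CoordRing A :=
  AddMonoidAlgebra.mapDomainAlgHom ℝ ℝ (AddSubmonoid.inclusion (latticeDual_anti h))

theorem CoordRing.incl_injective {n : ℕ} {A B : Set (Fin n → ℝ)} (h : A ⊆ B) :
    Function.Injective (CoordRing.incl h) :=
  AddMonoidAlgebra.mapDomain_injective (AddSubmonoid.inclusion_injective (latticeDual_anti h))

theorem CoordRing.isLocalization {n : ℕ} {A B : Set (Fin n → ℝ)} (h : A ⊆ B)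
    (m : Fin n → ℤ) (hm : m ∈ latticeDual B) (hm' : -m ∈ latticeDual A)
    (hw : ∀ w ∈ latticeDual A, ∃ k : ℕ, w + k • m ∈ latticeDual B) :
    @IsLocalization.Away _ _ (AddMonoidAlgebra.single ⟨m, hm⟩ 1 : CoordRing B) (CoordRing A) _
      (CoordRing.incl h).toRingHom.toAlgebra := by
  let _ := (CoordRing.incl h).toRingHom.toAlgebra
  have hal : ∀ x, algebraMap (CoordRing B) (CoordRing A) x = CoordRing.incl h x := fun _ => rfl
  have hs : ∀ (a : latticeDual B) (r : ℝ), CoordRing.incl h (AddMonoidAlgebra.single a r) =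
      AddMonoidAlgebra.single (AddSubmonoid.inclusion (latticeDual_anti h) a) r := by
    intro a r
    simp [CoordRing.incl]
  refine ⟨?_, ?_, ?_⟩
  · rintro ⟨_, k, rfl⟩
    rw [hal, map_pow]
    refine IsUnit.pow _ ?_
    rw [hs]
    refine IsUnit.of_mul_eq_one (AddMonoidAlgebra.single ⟨-m, hm'⟩ 1) ?_
    rw [AddMonoidAlgebra.single_mul_single, AddMonoidAlgebra.one_def]
    congr 1
    · ext i; simp
    · simp
  · intro z
    suffices H : ∃ (k : ℕ) (y : CoordRing B),
        z * CoordRing.incl h (AddMonoidAlgebra.single ⟨m, hm⟩ 1 ^ k) = CoordRing.incl h y by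
      obtain ⟨k, y, e⟩ := H
      exact ⟨⟨y, ⟨_, k, rfl⟩⟩, e⟩
    induction z using AddMonoidAlgebra.induction_linear with
    | zero => exact ⟨0, 0, by simp⟩
    | add f g hf hg =>
      obtain ⟨k, y, e⟩ := hf
      obtain ⟨l, y', e'⟩ := hg
      refine ⟨k + l, y * AddMonoidAlgebra.single ⟨m, hm⟩ 1 ^ l +
        y' * AddMonoidAlgebra.single ⟨m, hm⟩ 1 ^ k, ?_⟩
      rw [map_add, map_mul, map_mul, ← e, ← e', pow_add, map_mul]
      ring
    | single a r =>
      obtain ⟨k, hk⟩ := hw a.1 a.2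
      refine ⟨k, AddMonoidAlgebra.single ⟨_, hk⟩ r, ?_⟩
      rw [map_pow, hs, hs, AddMonoidAlgebra.single_pow, AddMonoidAlgebra.single_mul_single]
      congr 1
      simp
  · intro x y e
    rw [hal, hal] at e
    exact ⟨1, by rw [CoordRing.incl_injective h e]⟩


/-! ### Real varieties -/

/-- `Spec ℝ`. -/
abbrev SpecR : Scheme.{0} := Spec (CommRingCat.of ℝ)

/-- `X` is a normal (irreducible) variety over `ℝ`: an integral separated scheme of finite type
whose local rings are integrally closed. -/
structure IsNormalVariety {X : Scheme.{0}} (f : X ⟶ SpecR) : Prop where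
  integral : IsIntegral X
  separated : IsSeparated f
  finiteType : LocallyOfFiniteType f
  quasiCompact : QuasiCompact f
  normal : ∀ x : X, IsIntegrallyClosed (X.presheaf.stalk x)

/-- The set `X(ℝ)` of real points of `X`. -/
def RealPoint {X : Scheme.{0}} (f : X ⟶ SpecR) : Type := {p : SpecR ⟶ X // p ≫ f = 𝟙 SpecR}

/-- The point of the underlying space of `X` given by a real point. -/
def RealPoint.pt {X : Scheme.{0}} {f : X ⟶ SpecR} (p : RealPoint f) : X :=
  p.1 (IsLocalRing.closedPoint ℝ)

/-- The map `X(ℝ) → Y(ℝ)` induced by a morphism `X ⟶ Y` over `ℝ`. -/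
def RealPoint.map {X Y : Scheme.{0}} {f : X ⟶ SpecR} {g : Y ⟶ SpecR} (φ : X ⟶ Y)
    (hφ : φ ≫ g = f) (p : RealPoint f) : RealPoint g :=
  ⟨p.1 ≫ φ, by rw [Category.assoc, hφ, p.2]⟩

/-- The value at a real point `p ∈ U(ℝ)` of a regular function `h` on an open subscheme `U`. -/
def RealPoint.value {X : Scheme.{0}} {f : X ⟶ SpecR} (p : RealPoint f) (U : X.Opens)
    (hU : ⊤ ≤ p.1 ⁻¹ᵁ U) (h : Γ(X, U)) : ℝ :=
  (Scheme.ΓSpecIso (CommRingCat.of ℝ)).hom (p.1.appLE U ⊤ hU h)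

/-- The Euclidean topology on `X(ℝ)`: the coarsest topology for which `U(ℝ)` is open and every
regular function `h : U(ℝ) → ℝ` is continuous, for every open subscheme `U` of `X`. -/
instance {X : Scheme.{0}} (f : X ⟶ SpecR) : TopologicalSpace (RealPoint f) :=
  TopologicalSpace.generateFrom
    {O | ∃ (U : X.Opens) (h : Γ(X, U)) (W : Set ℝ), IsOpen W ∧
      O = {p | ∃ hU : ⊤ ≤ p.1 ⁻¹ᵁ U, p.value U hU h ∈ W}}

/-- The ring `𝒪(X)` of global regular functions of `X`. -/
def RegularFunctions {X : Scheme.{0}} (_f : X ⟶ SpecR) : Type := Γ(X, ⊤)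

instance {X : Scheme.{0}} (f : X ⟶ SpecR) : CommRing (RegularFunctions f) :=
  inferInstanceAs (CommRing Γ(X, ⊤))

instance {X : Scheme.{0}} (f : X ⟶ SpecR) : Algebra ℝ (RegularFunctions f) :=
  RingHom.toAlgebra
    (f.appTop.hom.comp (Scheme.ΓSpecIso (CommRingCat.of ℝ)).inv.hom : ℝ →+* Γ(X, ⊤))

/-- Pullback of regular functions along a morphism over `ℝ`. -/
def RegularFunctions.pullback {X Y : Scheme.{0}} {f : X ⟶ SpecR} {g : Y ⟶ SpecR} (φ : X ⟶ Y)
    (hφ : φ ≫ g = f) : RegularFunctions g →ₐ[ℝ] RegularFunctions f where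
  toRingHom := φ.appTop.hom
  commutes' r := by
    subst hφ
    change φ.appTop.hom (g.appTop.hom _) = (φ ≫ g).appTop.hom _
    rw [Scheme.Hom.comp_appTop]
    rfl

/-- The value of a global regular function at a real point. -/
def RegularFunctions.eval {X : Scheme.{0}} {f : X ⟶ SpecR} (h : RegularFunctions f)
    (p : RealPoint f) : ℝ := p.value ⊤ le_top h

theorem RegularFunctions.eval_add {X : Scheme.{0}} {f : X ⟶ SpecR} (a b : RegularFunctions f)
    (p : RealPoint f) : (a + b).eval p = a.eval p + b.eval p := by
  change (Scheme.ΓSpecIso (CommRingCat.of ℝ)).hom.hom ((p.1.appLE ⊤ ⊤ le_top).hom (a + b)) = _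
  erw [map_add, map_add]
  rfl

theorem RegularFunctions.eval_mul {X : Scheme.{0}} {f : X ⟶ SpecR} (a b : RegularFunctions f)
    (p : RealPoint f) : (a * b).eval p = a.eval p * b.eval p := by
  change (Scheme.ΓSpecIso (CommRingCat.of ℝ)).hom.hom ((p.1.appLE ⊤ ⊤ le_top).hom (a * b)) = _
  erw [map_mul, map_mul]
  rfl

theorem RegularFunctions.eval_algebraMap {X : Scheme.{0}} {f : X ⟶ SpecR} (r : ℝ)
    (p : RealPoint f) : (algebraMap ℝ (RegularFunctions f) r).eval p = r := by
  obtain ⟨p, hp⟩ := p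
  have h : (Scheme.ΓSpecIso (CommRingCat.of ℝ)).inv ≫ f.appTop ≫ p.appTop ≫
      (Scheme.ΓSpecIso (CommRingCat.of ℝ)).hom = 𝟙 _ := by
    rw [← Category.assoc f.appTop, ← Scheme.Hom.comp_appTop, hp]
    simp
  have h2 := congrArg (fun φ : CommRingCat.of ℝ ⟶ CommRingCat.of ℝ => φ.hom r) h
  change (Scheme.ΓSpecIso (CommRingCat.of ℝ)).hom.hom ((p.appLE ⊤ ⊤ le_top).hom _) = _
  have e : p.appLE ⊤ ⊤ le_top = p.appTop := p.appLE_eq_app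
  rw [e]
  exact h2

/-- `B_X(S)`: the ring of regular functions on `X` that are bounded on `S ⊆ X(ℝ)`. -/
def boundedFunctions {X : Scheme.{0}} (f : X ⟶ SpecR) (S : Set (RealPoint f)) :
    Subalgebra ℝ (RegularFunctions f) where
  carrier := {h | ∃ c : ℝ, ∀ p ∈ S, |h.eval p| ≤ c}
  add_mem' := by
    rintro a b ⟨c, hc⟩ ⟨d, hd⟩
    refine ⟨c + d, fun p hp => ?_⟩
    rw [RegularFunctions.eval_add]
    exact (abs_add_le _ _).trans (add_le_add (hc p hp) (hd p hp))
  mul_mem' := by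
    rintro a b ⟨c, hc⟩ ⟨d, hd⟩
    refine ⟨c * d, fun p hp => ?_⟩
    rw [RegularFunctions.eval_mul, abs_mul]
    exact mul_le_mul (hc p hp) (hd p hp) (abs_nonneg _) ((abs_nonneg _).trans (hc p hp))
  algebraMap_mem' := fun r => ⟨|r|, fun p _ => by rw [RegularFunctions.eval_algebraMap]⟩

/-- `j : V ⟶ X` is a completion of the normal affine variety `V` (an open dense embedding into a
normal complete variety) that is compatible with `S ⊆ V(ℝ)`: for every irreducible component `Z` of
`X ∖ V`, the intersection of `Z(ℝ)` with the Euclidean closure of `S` in `X(ℝ)` is empty or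
Zariski dense in `Z`. -/
structure IsCompatibleCompletion {V X : Scheme.{0}} (v : V ⟶ SpecR) (f : X ⟶ SpecR)
    (j : V ⟶ X) (S : Set (RealPoint v)) : Prop where
  affine : IsAffine V
  normal_source : IsNormalVariety v
  comm : j ≫ f = v
  isOpenImmersion : IsOpenImmersion j
  isDominant : IsDominant j
  normal_target : IsNormalVariety f
  proper : IsProper f
  compatible : ∀ Z : Set X, Maximal (fun Z => IsIrreducible Z ∧ Z ⊆ (Set.range j)ᶜ) Z →
    {p ∈ closure (RealPoint.map j comm '' S) | p.pt ∈ Z} = ∅ ∨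
    Z ⊆ closure (RealPoint.pt '' {p ∈ closure (RealPoint.map j comm '' S) | p.pt ∈ Z})

/-! ### Affine toric varieties -/

/-- The affine toric variety `U_A = Spec ℝ[M ∩ A^*]`, for a cone `A`. -/
abbrev affineToric {n : ℕ} (A : Set (Fin n → ℝ)) : Scheme.{0} := Spec (CommRingCat.of (CoordRing A))

/-- The structure morphism of `U_A` over `ℝ`. -/
abbrev affineToricStr {n : ℕ} (A : Set (Fin n → ℝ)) : affineToric A ⟶ SpecR :=
  Spec.map (CommRingCat.ofHom (algebraMap ℝ (CoordRing A)))

/-- The morphism `U_A ⟶ U_B` for `A ⊆ B`. -/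
abbrev affineToricMap {n : ℕ} {A B : Set (Fin n → ℝ)} (h : A ⊆ B) : affineToric A ⟶ affineToric B :=
  Spec.map (CommRingCat.ofHom (CoordRing.incl h).toRingHom)

theorem affineToricMap_str {n : ℕ} {A B : Set (Fin n → ℝ)} (h : A ⊆ B) :
    affineToricMap h ≫ affineToricStr B = affineToricStr A := by
  rw [← Spec.map_comp, ← CommRingCat.ofHom_comp]
  congr 2
  exact (CoordRing.incl h).comp_algebraMap

theorem affineToricMap_refl {n : ℕ} (A : Set (Fin n → ℝ)) : affineToricMap (le_refl A) = 𝟙 (affineToric A) := by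
  have h : CoordRing.incl (le_refl A) = AlgHom.id ℝ (CoordRing A) :=
    AddMonoidAlgebra.mapDomainAlgHom_id
  rw [affineToricMap, h]
  exact Spec.map_id _

theorem affineToricMap_trans {n : ℕ} {A B C : Set (Fin n → ℝ)} (h : A ⊆ B) (h' : B ⊆ C) :
    affineToricMap (h.trans h') = affineToricMap h ≫ affineToricMap h' := by
  have e : CoordRing.incl (h.trans h') = (CoordRing.incl h).comp (CoordRing.incl h') :=
    AddMonoidAlgebra.mapDomainAlgHom_comp (AddSubmonoid.inclusion (latticeDual_anti h'))
      (AddSubmonoid.inclusion (latticeDual_anti h))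
  rw [← Spec.map_comp, affineToricMap, e]
  rfl

theorem affineToricMap_isOpenImmersion {n : ℕ} {τ σ : PointedCone ℝ (Fin n → ℝ)} (h : IsFace τ σ)
    (hσ : IsRationalCone σ) (hle : (τ : Set (Fin n → ℝ)) ⊆ σ) :
    IsOpenImmersion (affineToricMap hle) := by
  obtain ⟨m, hm, hτ⟩ := h.exists_int hσ
  obtain ⟨hm', hw⟩ := latticeDual_face hσ hm hτ
  let _ := (CoordRing.incl hle).toRingHom.toAlgebra
  have := CoordRing.isLocalization hle m hm hm' hw
  exact IsOpenImmersion.of_isLocalization (AddMonoidAlgebra.single ⟨m, hm⟩ 1)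

theorem affineToricMap_range {n : ℕ} {τ σ : PointedCone ℝ (Fin n → ℝ)} (hσ : IsRationalCone σ)
    {m : Fin n → ℤ} (hm : m ∈ latticeDual (σ : Set (Fin n → ℝ)))
    (hτ : ∀ x, x ∈ τ ↔ x ∈ σ ∧ pairing m x = 0) (hle : (τ : Set (Fin n → ℝ)) ⊆ σ)
    (x : PrimeSpectrum (CoordRing (σ : Set (Fin n → ℝ)))) :
    (∃ y, affineToricMap hle y = x) ↔ x ∈ PrimeSpectrum.basicOpen
        (AddMonoidAlgebra.single ⟨m, hm⟩ 1 : CoordRing (σ : Set (Fin n → ℝ))) := by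
  obtain ⟨hm', hw⟩ := latticeDual_face hσ hm hτ
  let _ := (CoordRing.incl hle).toRingHom.toAlgebra
  have := CoordRing.isLocalization hle m hm hm' hw
  exact Set.ext_iff.1 (PrimeSpectrum.localization_away_comap_range
    (CoordRing (τ : Set (Fin n → ℝ))) (AddMonoidAlgebra.single ⟨m, hm⟩ 1)) x

/-- The intersection of the charts of two faces is the chart of their intersection. -/
theorem affineToricMap_range_inter {n : ℕ} {τ₁ τ₂ σ : PointedCone ℝ (Fin n → ℝ)} (h₁ : IsFace τ₁ σ)
    (h₂ : IsFace τ₂ σ) (hσ : IsRationalCone σ) (hle₁ : (τ₁ : Set (Fin n → ℝ)) ⊆ σ)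
    (hle₂ : (τ₂ : Set (Fin n → ℝ)) ⊆ σ)
    (hle : ((τ₁ ⊓ τ₂ : PointedCone ℝ (Fin n → ℝ)) : Set (Fin n → ℝ)) ⊆ σ)
    (x : PrimeSpectrum (CoordRing (σ : Set (Fin n → ℝ)))) (hx₁ : ∃ y, affineToricMap hle₁ y = x)
    (hx₂ : ∃ y, affineToricMap hle₂ y = x) : ∃ y, affineToricMap hle y = x := by
  obtain ⟨m₁, hm₁, hτ₁⟩ := h₁.exists_int hσ
  obtain ⟨m₂, hm₂, hτ₂⟩ := h₂.exists_int hσ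
  have hτ : ∀ x, x ∈ τ₁ ⊓ τ₂ ↔ x ∈ σ ∧ pairing (m₁ + m₂) x = 0 := by
    intro x
    have e : pairing (m₁ + m₂) x = pairing m₁ x + pairing m₂ x := by
      simpa using pairing_add_smul m₁ m₂ 1 x
    rw [Submodule.mem_inf, hτ₁, hτ₂, e]
    constructor
    · rintro ⟨⟨a, b⟩, -, c⟩
      exact ⟨a, by rw [b, c, add_zero]⟩
    · rintro ⟨a, b⟩
      have := hm₁ x a
      have := hm₂ x a
      exact ⟨⟨a, by linarith⟩, a, by linarith⟩
  rw [affineToricMap_range hσ hm₁ hτ₁] at hx₁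
  rw [affineToricMap_range hσ hm₂ hτ₂] at hx₂
  rw [affineToricMap_range hσ (add_mem hm₁ hm₂) hτ]
  have e : (AddMonoidAlgebra.single ⟨m₁ + m₂, add_mem hm₁ hm₂⟩ 1 :
      CoordRing (σ : Set (Fin n → ℝ))) =
      AddMonoidAlgebra.single ⟨m₁, hm₁⟩ 1 * AddMonoidAlgebra.single ⟨m₂, hm₂⟩ 1 := by
    rw [AddMonoidAlgebra.single_mul_single, one_mul]
    rfl
  rw [e, PrimeSpectrum.basicOpen_mul]
  exact ⟨hx₁, hx₂⟩

/-- The value `ξ^m` of the character `m ∈ M` at `ξ ∈ T(ℝ)`. -/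
def torusChar {n : ℕ} (ξ : Fin n → ℝˣ) (m : Fin n → ℤ) : ℝˣ := ∏ i, ξ i ^ m i

/-- Evaluation of elements of `ℝ[M ∩ A^*]` at `ξ ∈ T(ℝ)`. -/
def torusEval {n : ℕ} (A : Set (Fin n → ℝ)) (ξ : Fin n → ℝˣ) : CoordRing A →ₐ[ℝ] ℝ :=
  AddMonoidAlgebra.lift ℝ ℝ (latticeDual A)
    { toFun := fun m => (torusChar ξ (Multiplicative.toAdd m : latticeDual A) : ℝ)
      map_one' := by simp [torusChar]
      map_mul' := fun a b => by
        simp [torusChar, zpow_add, Finset.prod_mul_distrib] }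

/-- The embedding `T(ℝ) ⊆ U_A(ℝ)`. -/
def torusPoint {n : ℕ} (A : Set (Fin n → ℝ)) (ξ : Fin n → ℝˣ) : RealPoint (affineToricStr A) :=
  ⟨Spec.map (CommRingCat.ofHom (torusEval A ξ).toRingHom), by
    rw [← Spec.map_comp, ← CommRingCat.ofHom_comp]
    have h : (torusEval A ξ).toRingHom.comp (algebraMap ℝ (CoordRing A)) = RingHom.id ℝ :=
      (torusEval A ξ).comp_algebraMap
    rw [h]
    exact Spec.map_id _⟩

/-- The identification `ℝ[M ∩ A^*] = ℝ[U_A]`. -/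
def coordEquiv {n : ℕ} (A : Set (Fin n → ℝ)) :
    CoordRing A ≃ₐ[ℝ] RegularFunctions (affineToricStr A) :=
  AlgEquiv.ofRingEquiv
    (f := (Scheme.ΓSpecIso (CommRingCat.of (CoordRing A))).symm.commRingCatIsoToRingEquiv)
    (fun r => by
      have h := Scheme.ΓSpecIso_inv_naturality (CommRingCat.ofHom (algebraMap ℝ (CoordRing A)))
      exact congrArg (fun φ => φ.hom r) h)

/-! ### Toric varieties -/

/-- Fans: finite nonempty sets of pointed rational cones in `N_ℝ`, closed under taking faces, such
that the intersection of any two elements is a face of both. -/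
structure Fan (n : ℕ) where
  cones : Set (PointedCone ℝ (Fin n → ℝ))
  finite : cones.Finite
  nonempty : cones.Nonempty
  rational : ∀ σ ∈ cones, IsRationalCone σ
  salient : ∀ σ ∈ cones, ∀ x ∈ σ, -x ∈ σ → x = 0
  face_mem : ∀ σ ∈ cones, ∀ τ, IsFace τ σ → τ ∈ cones
  inter_face : ∀ σ ∈ cones, ∀ τ ∈ cones, IsFace (σ ⊓ τ) σ ∧ IsFace (σ ⊓ τ) τ

namespace Fan

variable {n : ℕ} (F : Fan n)

/-- The support `|F|`. -/
def support : Set (Fin n → ℝ) := {x | ∃ σ ∈ F.cones, x ∈ σ}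

/-- A fan is complete if its support is `N_ℝ`. -/
def IsComplete : Prop := F.support = Set.univ

/-- The diagram of affine toric varieties `U_σ`, `σ ∈ F`, and open inclusions `U_τ ⊆ U_σ`. -/
def diagram : F.cones ⥤ Scheme.{0} where
  obj σ := affineToric (σ.1 : Set (Fin n → ℝ))
  map f := affineToricMap (SetLike.coe_subset_coe.2 (leOfHom f))
  map_id _ := affineToricMap_refl _
  map_comp _ _ := affineToricMap_trans _ _

theorem isFace_of_le {σ τ : PointedCone ℝ (Fin n → ℝ)} (hσ : σ ∈ F.cones) (hτ : τ ∈ F.cones)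
    (h : τ ≤ σ) : IsFace τ σ := by
  have := (F.inter_face σ hσ τ hτ).1
  rwa [inf_eq_right.2 h] at this

instance {σ τ : F.cones} (f : τ ⟶ σ) : IsOpenImmersion (F.diagram.map f) :=
  affineToricMap_isOpenImmersion (F.isFace_of_le σ.2 τ.2 (leOfHom f)) (F.rational _ σ.2) _

instance : (F.diagram ⋙ Scheme.forget).IsLocallyDirected := by
  refine ⟨fun {i j k} fi fj xi xj e => ?_⟩
  have hi := F.isFace_of_le k.2 i.2 (leOfHom fi)
  have hj := F.isFace_of_le k.2 j.2 (leOfHom fj)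
  let l : F.cones := ⟨i.1 ⊓ j.1, F.face_mem _ i.2 _ (F.inter_face _ i.2 _ j.2).1⟩
  let li : l ⟶ i := homOfLE (show i.1 ⊓ j.1 ≤ i.1 from inf_le_left)
  let lj : l ⟶ j := homOfLE (show i.1 ⊓ j.1 ≤ j.1 from inf_le_right)
  have e' : F.diagram.map fi xi = F.diagram.map fj xj := e
  obtain ⟨x, hx⟩ := affineToricMap_range_inter hi hj (F.rational _ k.2) (leOfHom fi) (leOfHom fj)
    (leOfHom (li ≫ fi)) (F.diagram.map fi xi) ⟨xi, rfl⟩ ⟨xj, e'.symm⟩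
  let x' : F.diagram.obj l := x
  have hx' : F.diagram.map (li ≫ fi) x' = F.diagram.map fi xi := hx
  have h₁ : F.diagram.map li x' = xi := by
    refine (F.diagram.map fi).isOpenEmbedding.injective ?_
    rw [← hx', F.diagram.map_comp, Scheme.Hom.comp_apply]
  have h₂ : F.diagram.map lj x' = xj := by
    refine (F.diagram.map fj).isOpenEmbedding.injective ?_
    rw [← e', ← hx', show li ≫ fi = lj ≫ fj from Subsingleton.elim _ _, F.diagram.map_comp,
      Scheme.Hom.comp_apply]
  exact ⟨l, li, lj, x', h₁, h₂⟩

/-- The toric variety `X_F`, obtained by gluing the affine toric varieties `U_σ`, `σ ∈ F`, along the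
`U_τ` for common faces `τ`. -/
def toricVariety : Scheme.{0} := colimit F.diagram

/-- The open embedding `U_σ ⟶ X_F`. -/
def ι (σ : F.cones) : affineToric (σ.1 : Set (Fin n → ℝ)) ⟶ F.toricVariety := colimit.ι F.diagram σ

theorem diagram_map_str {σ τ : F.cones} (f : σ ⟶ τ) :
    F.diagram.map f ≫ affineToricStr (τ.1 : Set (Fin n → ℝ)) = affineToricStr (σ.1 : Set (Fin n → ℝ)) := by
  have h : (σ.1 : Set (Fin n → ℝ)) ⊆ (τ.1 : Set (Fin n → ℝ)) := leOfHom f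
  have e : F.diagram.map f = affineToricMap h := rfl
  rw [e]
  exact affineToricMap_str h

/-- The structure morphisms `U_σ ⟶ Spec ℝ`. -/
def strCocone : Cocone F.diagram where
  pt := SpecR
  ι :=
    { app := fun σ => affineToricStr (σ.1 : Set (Fin n → ℝ))
      naturality := fun σ _ f =>
        (F.diagram_map_str f).trans (Category.comp_id (affineToricStr (σ.1 : Set (Fin n → ℝ)))).symm }

/-- The structure morphism of `X_F` over `ℝ`. -/
def str : F.toricVariety ⟶ SpecR := colimit.desc F.diagram F.strCocone

theorem ι_str (σ : F.cones) : F.ι σ ≫ F.str = affineToricStr (σ.1 : Set (Fin n → ℝ)) :=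
  colimit.ι_desc _ _

theorem subset_support (σ : F.cones) : ((σ.1 : PointedCone ℝ (Fin n → ℝ)) : Set _) ⊆ F.support :=
  fun _ hx => ⟨σ.1, σ.2, hx⟩

end Fan

/-- The torus orbit `O_σ ⊆ U_σ`: the unique closed orbit of `U_σ`, i.e. the zero locus of all
characters in `H_σ ∖ (-H_σ)`. -/
def orbit {n : ℕ} (σ : PointedCone ℝ (Fin n → ℝ)) : Set (affineToric (σ : Set (Fin n → ℝ))) :=
  {x : PrimeSpectrum (CoordRing (σ : Set (Fin n → ℝ))) |
    ∀ m : latticeDual (σ : Set (Fin n → ℝ)), -(m : Fin n → ℤ) ∉ latticeDual (σ : Set (Fin n → ℝ)) →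
      (AddMonoidAlgebra.single m 1 : CoordRing (σ : Set (Fin n → ℝ))) ∈ x.asIdeal}

/-- `Y_τ`, the Zariski closure of `O_τ` in `X_F`. -/
def Fan.orbitClosure {n : ℕ} (F : Fan n) (τ : F.cones) : Set F.toricVariety :=
  closure (F.ι τ '' orbit τ.1)

/-! ### Semi-algebraic subsets of the torus and the compatibility condition -/

/-- Semi-algebraic subsets of `T(ℝ) = (ℝˣ)ⁿ`: the Boolean algebra generated by the sets
`{ξ | p(ξ) > 0}` with `p` a polynomial. -/
inductive IsSemialgebraic {n : ℕ} : Set (Fin n → ℝˣ) → Prop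
  | pos (p : MvPolynomial (Fin n) ℝ) :
      IsSemialgebraic {ξ | 0 < MvPolynomial.eval (fun i => (ξ i : ℝ)) p}
  | compl {A : Set (Fin n → ℝˣ)} : IsSemialgebraic A → IsSemialgebraic Aᶜ
  | inter {A B : Set (Fin n → ℝˣ)} : IsSemialgebraic A → IsSemialgebraic B →
      IsSemialgebraic (A ∩ B)

/-- The cocharacter `λ_v`. -/
def cochar {n : ℕ} (v : Fin n → ℤ) (s : ℝˣ) : Fin n → ℝˣ := fun i => s ^ v i

/-- `S(v) = {ξ ∈ T(ℝ) | λ_v(s) ξ ∈ S for all sufficiently small s > 0}`. -/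
def limitSet {n : ℕ} (S : Set (Fin n → ℝˣ)) (v : Fin n → ℤ) : Set (Fin n → ℝˣ) :=
  {ξ | ∃ ε : ℝ, 0 < ε ∧ ∀ s : ℝˣ, 0 < (s : ℝ) → (s : ℝ) < ε → cochar v s * ξ ∈ S}

/-- `K₀(S)`, the set of all `v ∈ N` for which `S(v)` has nonempty interior. -/
def K₀ {n : ℕ} (S : Set (Fin n → ℝˣ)) : Set (Fin n → ℤ) :=
  {v | (interior (limitSet S v)).Nonempty}

/-- `K₀(S)` meets the relative interior of the cone `τ`. -/
def MeetsRelint {n : ℕ} (S : Set (Fin n → ℝˣ)) (τ : PointedCone ℝ (Fin n → ℝ)) : Prop :=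
  ∃ v ∈ K₀ S, intCast v ∈ intrinsicInterior ℝ (τ : Set (Fin n → ℝ))

/-- The dimension of a cone. -/
def coneDim {n : ℕ} (τ : PointedCone ℝ (Fin n → ℝ)) : ℕ :=
  Module.finrank ℝ (Submodule.span ℝ (τ : Set (Fin n → ℝ)))

namespace Fan

variable {n : ℕ} (F : Fan n)

/-- `S ⊆ T(ℝ)` as a subset of `X_F(ℝ)`, through the embeddings `T ⊆ U_σ ⊆ X_F`. -/
def torusSubset (σ : F.cones) (S : Set (Fin n → ℝˣ)) : Set (RealPoint F.str) :=
  RealPoint.map (F.ι σ) (F.ι_str σ) '' (torusPoint (σ.1 : Set (Fin n → ℝ)) '' S)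

/-- The toric compatibility condition: for any one-dimensional `τ ∈ F` with `τ ⊄ σ`, the set
`Y_τ(ℝ)` does not meet the Euclidean closure of `S` in `X_F(ℝ)`, or `K₀(S)` meets the relative
interior of `τ`. -/
def ToricCompatible (σ : F.cones) (S : Set (Fin n → ℝˣ)) : Prop :=
  ∀ τ : F.cones, coneDim τ.1 = 1 → ¬ τ.1 ≤ σ.1 →
    {p ∈ closure (F.torusSubset σ S) | p.pt ∈ F.orbitClosure τ} = ∅ ∨ MeetsRelint S τ.1

/-- The subfan `F_S`. -/
def subfan (σ : F.cones) (S : Set (Fin n → ℝˣ)) : Fan n where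
  cones := {ρ ∈ F.cones | ∀ τ, IsFace τ ρ → coneDim τ = 1 → τ ≤ σ.1 ∨ MeetsRelint S τ}
  finite := F.finite.subset fun _ h => h.1
  nonempty := ⟨σ.1, σ.2, fun _ h _ => Or.inl h.le⟩
  rational := fun ρ h => F.rational ρ h.1
  salient := fun ρ h => F.salient ρ h.1
  face_mem := fun ρ hρ τ hτ =>
    ⟨F.face_mem ρ hρ.1 τ hτ, fun τ' hτ' => hρ.2 τ'
      (F.isFace_of_le hρ.1 (F.face_mem τ (F.face_mem ρ hρ.1 τ hτ) τ' hτ') (hτ'.le.trans hτ.le))⟩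
  inter_face := fun ρ hρ τ hτ => F.inter_face ρ hρ.1 τ hτ.1

theorem mem_subfan (σ : F.cones) (S : Set (Fin n → ℝˣ)) : σ.1 ∈ (F.subfan σ S).cones :=
  ⟨σ.2, fun _ h _ => Or.inl h.le⟩

/-- `σ` as an element of the subfan `F_S`. -/
def subfanCone (σ : F.cones) (S : Set (Fin n → ℝˣ)) : (F.subfan σ S).cones :=
  ⟨σ.1, F.mem_subfan σ S⟩

end Fan

end

end ToricCompletion

open ToricCompletion

/-!
The proof has two halves, geometry of `X_Σ` and growth of regular functions on `S`; both rest on the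
convex geometry of fans.

**Completion.** `X_Σ` is proper by the valuative criterion: a point with values in the fraction
field of a valuation ring makes the set of characters with integral values a total submonoid, and in
a complete fan some cone has its dual monoid inside it (`Fan.exists_cone_of_total`). It is separated
because of the separation lemma for cones (`exists_separating_character`), and normal because `ℝ[M ∩
A^*]` is integrally closed. The complement of `U_σ` is the union of the divisors `Y_τ` for rays `τ ⊄
σ`, since a point that lies on none of these divisors lies in the chart of a face all of whose rays
are in `σ` (`Fan.exists_face_or_mem_orbitClosure`). If some `v ∈ K₀(S)` generates `τ`, then the
limits of `λ_v(s) ξ` for `s → 0`, with `ξ` in the interior of `S(v)`, are real points of `Y_τ` in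
the closure of `S`, and they are Zariski dense in `Y_τ`, because a Laurent polynomial that vanishes
on a nonempty open subset of `T(ℝ)` is zero (`Fan.orbitClosure_subset_closure`). This gives
compatibility.

**Bounded functions.** Global functions on `X_{F_S}` are the Laurent polynomials whose monomials are
nonnegative on every cone of `F_S` (`Fan.range_pullback`). If `f` is bounded on `S` and `v ∈ K₀(S)`
generates a ray, then `s ↦ f(λ_v(s) ξ)` is bounded near `0` and hence a polynomial in `s`, for all
`ξ` in an open set; so every monomial of `f` is nonnegative on `v`. As cones are generated by their
rays, `f` is in `ℝ[M ∩ |F_S|^*]` (`Fan.mem_latticeDual_of_bounded`). Conversely, a character in `M ∩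
|F_S|^*` is bounded on `S` by a compactness argument: along an ultrafilter on `S`, the points
converge in some chart of the complete variety `X_Σ`, and the compatibility condition keeps the
limit inside `X_{F_S}`, where the character is regular (`Fan.bounded_torusChar`). Finite generation
is Gordan's lemma.
-/

namespace ToricCompletion

open Filter Topology
open scoped LaurentPolynomial

/-! ### Rational cones and fans -/

/-- **Farkas' lemma** for finitely generated cones over a linearly ordered field. The proof is by
induction on the number of generators: a functional that is negative on a new generator `g` is
replaced by one that vanishes on `g`, by projecting along `g` onto its kernel. -/
theorem exists_functional_neg_of_notMem_hull {𝕜 V ι : Type*} [Field 𝕜] [LinearOrder 𝕜]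
    [IsStrictOrderedRing 𝕜] [AddCommGroup V] [Module 𝕜 V] (s : Finset ι) :
    ∀ (v : ι → V) (x : V), x ∉ PointedCone.hull 𝕜 (v '' (s : Set ι)) →
      ∃ f : V →ₗ[𝕜] 𝕜, (∀ i ∈ s, 0 ≤ f (v i)) ∧ f x < 0 := by
  classical
  induction s using Finset.induction_on with
  | empty =>
    intro v x hx
    have hx0 : x ≠ 0 := by
      rintro rfl
      exact hx (zero_mem _)
    obtain ⟨f, hf⟩ : ∃ f : Module.Dual 𝕜 V, f x ≠ 0 := by
      by_contra! h
      exact hx0 ((Module.forall_dual_apply_eq_zero_iff 𝕜 x).1 h)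
    rcases lt_or_gt_of_ne hf with h | h
    · exact ⟨f, by simp, h⟩
    · exact ⟨-f, by simp, by simpa using h⟩
  | insert a s ha ih =>
    intro v x hx
    have hmono : PointedCone.hull 𝕜 (v '' (s : Set ι)) ≤
        PointedCone.hull 𝕜 (v '' ((insert a s : Finset ι) : Set ι)) :=
      Submodule.span_mono (Set.image_mono (by simp))
    have hva : v a ∈ PointedCone.hull 𝕜 (v '' ((insert a s : Finset ι) : Set ι)) :=
      Submodule.subset_span ⟨a, by simp, rfl⟩
    obtain ⟨f, hf, hfx⟩ := ih v x fun h => hx (hmono h)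
    by_cases hfa : 0 ≤ f (v a)
    · exact ⟨f, by simpa [hfa] using hf, hfx⟩
    push Not at hfa
    let π : V →ₗ[𝕜] V := LinearMap.id - ((f (v a))⁻¹ • f).smulRight (v a)
    have hπ : ∀ y, π y = y - ((f (v a))⁻¹ * f y) • v a := fun y => by simp [π]
    have key : ∀ y ∈ PointedCone.hull 𝕜 ((fun i => π (v i)) '' (s : Set ι)),
        y ∈ PointedCone.hull 𝕜 (v '' ((insert a s : Finset ι) : Set ι)) := by
      intro y hy
      refine Submodule.span_le.2 ?_ hy
      rintro _ ⟨i, hi, rfl⟩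
      have h1 : 0 ≤ -((f (v a))⁻¹ * f (v i)) := by
        rw [← neg_mul]
        exact mul_nonneg (by simpa using hfa.le) (hf i hi)
      simp only [hπ, sub_eq_add_neg, ← neg_smul]
      exact add_mem (Submodule.subset_span ⟨i, by simpa using Or.inr hi, rfl⟩)
        (PointedCone.smul_mem _ h1 hva)
    have hπx : π x ∉ PointedCone.hull 𝕜 ((fun i => π (v i)) '' (s : Set ι)) := by
      intro h
      apply hx
      have h1 : 0 ≤ (f (v a))⁻¹ * f x :=
        mul_nonneg_of_nonpos_of_nonpos (by simpa using hfa.le) hfx.le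
      have h2 := add_mem (key _ h) (PointedCone.smul_mem _ h1 hva)
      rwa [hπ, sub_add_cancel] at h2
    obtain ⟨h, hh, hhx⟩ := ih _ _ hπx
    refine ⟨h.comp π, ?_, hhx⟩
    intro i hi
    rcases Finset.mem_insert.1 hi with rfl | hi
    · simp [hπ, hfa.ne]
    · exact hh i hi

theorem linearMap_eq_dotProduct {𝕜 : Type*} [Field 𝕜] {n : ℕ} (f : (Fin n → 𝕜) →ₗ[𝕜] 𝕜)
    (x : Fin n → 𝕜) : f x = (fun i => f (Pi.single i 1)) ⬝ᵥ x := by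
  rw [LinearMap.pi_apply_eq_sum_univ f x]
  simp only [dotProduct, smul_eq_mul]
  refine Finset.sum_congr rfl fun i _ => ?_
  rw [mul_comm]
  congr 2
  ext j
  simp [Pi.single_apply, eq_comm]

theorem exists_dotProduct_neg_of_notMem_hull {𝕜 : Type*} [Field 𝕜] [LinearOrder 𝕜]
    [IsStrictOrderedRing 𝕜] {n : ℕ} (G : Finset (Fin n → 𝕜)) (x : Fin n → 𝕜)
    (hx : x ∉ PointedCone.hull 𝕜 (G : Set (Fin n → 𝕜))) :
    ∃ u : Fin n → 𝕜, (∀ g ∈ G, 0 ≤ u ⬝ᵥ g) ∧ u ⬝ᵥ x < 0 := by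
  obtain ⟨f, hf, hfx⟩ := exists_functional_neg_of_notMem_hull G id x (by simpa using hx)
  refine ⟨fun i => f (Pi.single i 1), fun g hg => ?_, ?_⟩
  · rw [← linearMap_eq_dotProduct]; exact hf g hg
  · rwa [← linearMap_eq_dotProduct]

/-- A functional in the relative interior of the dual of a finitely generated cone: it vanishes
only on the generators that are invertible in the cone. -/
theorem exists_dotProduct_eq_zero_iff {𝕜 : Type*} [Field 𝕜] [LinearOrder 𝕜]
    [IsStrictOrderedRing 𝕜] {n : ℕ} (G : Finset (Fin n → 𝕜)) :
    ∃ u : Fin n → 𝕜, ∀ g ∈ G, 0 ≤ u ⬝ᵥ g ∧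
      (u ⬝ᵥ g = 0 → -g ∈ PointedCone.hull 𝕜 (G : Set (Fin n → 𝕜))) := by
  have h : ∀ g : Fin n → 𝕜, ∃ u : Fin n → 𝕜, (∀ g' ∈ G, 0 ≤ u ⬝ᵥ g') ∧
      (u ⬝ᵥ g ≤ 0 → -g ∈ PointedCone.hull 𝕜 (G : Set (Fin n → 𝕜))) := by
    intro g
    by_cases hg : -g ∈ PointedCone.hull 𝕜 (G : Set (Fin n → 𝕜))
    · exact ⟨0, by simp, fun _ => hg⟩
    · obtain ⟨u, hu, hug⟩ := exists_dotProduct_neg_of_notMem_hull G (-g) hg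
      rw [dotProduct_neg] at hug
      exact ⟨u, hu, fun h => by linarith⟩
  choose u hu hu' using h
  refine ⟨∑ g ∈ G, u g, fun g hg => ?_⟩
  rw [sum_dotProduct]
  refine ⟨Finset.sum_nonneg fun g' _ => hu g' g hg, fun h => ?_⟩
  exact hu' g ((Finset.sum_eq_zero_iff_of_nonneg fun g' _ => hu g' g hg).1 h g hg).le

/-- The face of a cone cut out by `u` is generated by the generators on which `u` vanishes. -/
theorem mem_of_dotProduct_eq_zero {n : ℕ} {s : Set (Fin n → ℝ)} {u : Fin n → ℝ}
    {K : PointedCone ℝ (Fin n → ℝ)} (h : ∀ g ∈ s, 0 ≤ u ⬝ᵥ g)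
    (h0 : ∀ g ∈ s, u ⬝ᵥ g = 0 → g ∈ K) {x : Fin n → ℝ}
    (hx : x ∈ PointedCone.hull ℝ s) (hux : u ⬝ᵥ x = 0) : x ∈ K := by
  suffices H : 0 ≤ u ⬝ᵥ x ∧ (u ⬝ᵥ x = 0 → x ∈ K) from H.2 hux
  clear hux
  induction hx using Submodule.span_induction with
  | mem x hx => exact ⟨h x hx, h0 x hx⟩
  | zero => exact ⟨by simp, fun _ => zero_mem _⟩
  | add x y _ _ hx hy =>
    rw [dotProduct_add]
    refine ⟨add_nonneg hx.1 hy.1, fun e => ?_⟩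
    obtain ⟨e1, e2⟩ := (add_eq_zero_iff_of_nonneg hx.1 hy.1).1 e
    exact add_mem (hx.2 e1) (hy.2 e2)
  | smul a x _ hx =>
    have e : u ⬝ᵥ (a • x) = (a : ℝ) * (u ⬝ᵥ x) := by
      rw [show a • x = (a : ℝ) • x from rfl, dotProduct_smul, smul_eq_mul]
    rw [e]
    refine ⟨mul_nonneg a.2 hx.1, fun e => ?_⟩
    rcases mul_eq_zero.1 e with e | e
    · have : a = 0 := Subtype.ext e
      rw [this, zero_smul]
      exact zero_mem _
    · exact Submodule.smul_mem _ _ (hx.2 e)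

theorem IsRationalCone.exists_finset {n : ℕ} {ρ : PointedCone ℝ (Fin n → ℝ)}
    (h : IsRationalCone ρ) :
    ∃ G : Finset (Fin n → ℝ), ρ = PointedCone.hull ℝ (G : Set (Fin n → ℝ)) := by
  classical
  obtain ⟨G, rfl⟩ := h
  exact ⟨G.image intCast, by simp⟩

/-- Rational cones are closed, tested along a segment: if `x + ε y` lies in the cone for arbitrarily
small `ε > 0`, then so does `x`. -/
theorem IsRationalCone.mem_of_frequently {n : ℕ} {ρ : PointedCone ℝ (Fin n → ℝ)}
    (h : IsRationalCone ρ) {x y : Fin n → ℝ} (hxy : ∃ᶠ ε in 𝓝[>] (0 : ℝ), x + ε • y ∈ ρ) :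
    x ∈ ρ := by
  obtain ⟨G, rfl⟩ := h.exists_finset
  by_contra hx
  obtain ⟨u, hu, hux⟩ := exists_dotProduct_neg_of_notMem_hull G x hx
  have ht : Tendsto (fun ε : ℝ => u ⬝ᵥ x + ε * (u ⬝ᵥ y)) (𝓝[>] 0) (𝓝 (u ⬝ᵥ x)) := by
    have : Continuous (fun ε : ℝ => u ⬝ᵥ x + ε * (u ⬝ᵥ y)) := by fun_prop
    have := this.tendsto 0
    simp only [zero_mul, add_zero] at this
    exact this.mono_left nhdsWithin_le_nhds
  obtain ⟨ε, h1, h2⟩ := (hxy.and_eventually (ht.eventually_lt_const hux)).exists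
  have h3 := hull_nonneg (w := u) hu h1
  rw [dotProduct_add, dotProduct_smul, smul_eq_mul] at h3
  linarith

theorem coneDim_hull_singleton {n : ℕ} {g : Fin n → ℝ} (hg : g ≠ 0) :
    coneDim (PointedCone.hull ℝ {g}) = 1 := by
  have : Submodule.span ℝ ((PointedCone.hull ℝ {g} : PointedCone ℝ (Fin n → ℝ)) :
      Set (Fin n → ℝ)) = Submodule.span ℝ {g} :=
    le_antisymm (Submodule.span_le.2 (PointedCone.hull_le_span ℝ {g}))
      (Submodule.span_mono PointedCone.subset_hull)
  rw [coneDim, this, finrank_span_singleton hg]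

/-- A pointed rational cone is generated by its one-dimensional faces, namely by the rays of a
minimal set of generators. -/
theorem IsRationalCone.le_of_rays {n : ℕ} {ρ K : PointedCone ℝ (Fin n → ℝ)}
    (h : IsRationalCone ρ) (hs : ∀ x ∈ ρ, -x ∈ ρ → x = 0)
    (hK : ∀ τ, IsFace τ ρ → coneDim τ = 1 → τ ≤ K) : ρ ≤ K := by
  classical
  obtain ⟨G₀, hG₀⟩ := h.exists_finset
  obtain ⟨G, hG⟩ := exists_minimal_of_wellFoundedLT
    (fun G : Finset (Fin n → ℝ) => ρ = PointedCone.hull ℝ (G : Set (Fin n → ℝ))) ⟨G₀, hG₀⟩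
  have hGρ : ρ = PointedCone.hull ℝ (G : Set (Fin n → ℝ)) := hG.1
  have hmem : ∀ g ∈ G, g ∈ ρ := fun g hg => by rw [hGρ]; exact PointedCone.subset_hull hg
  rw [hGρ]
  refine Submodule.span_le.2 fun g hg => ?_
  -- By minimality of `G`, the other generators generate a strictly smaller cone.
  set E := G.erase g with hE
  have hins : insert g E = G := Finset.insert_erase hg
  have hgE : g ∉ PointedCone.hull ℝ (E : Set (Fin n → ℝ)) := by
    intro hgE
    have h1 : ρ = PointedCone.hull ℝ (E : Set (Fin n → ℝ)) := by
      rw [hGρ, ← hins]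
      refine le_antisymm (Submodule.span_le.2 ?_) (Submodule.span_mono (by simp))
      intro y hy
      rcases Finset.mem_insert.1 (Finset.mem_coe.1 hy) with rfl | hy
      · exact hgE
      · exact PointedCone.subset_hull hy
    have := hG.2 h1 (Finset.erase_subset _ _)
    exact Finset.notMem_erase g G (this hg)
  have hg0 : g ≠ 0 := fun h0 => hgE (h0 ▸ zero_mem _)
  -- Adding `-g` to the generators forces `u` to vanish on `g`; it is positive on all generators
  -- that are not multiples of `g`, so that it cuts out the ray of `g`.
  obtain ⟨u, hu⟩ := exists_dotProduct_eq_zero_iff (insert (-g) G)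
  have hug : u ⬝ᵥ g = 0 := by
    have h1 := (hu g (by simp [Finset.mem_coe.1 hg])).1
    have h2 := (hu (-g) (by simp)).1
    rw [dotProduct_neg] at h2
    linarith
  have hzero : ∀ h' ∈ G, u ⬝ᵥ h' = 0 → h' ∈ PointedCone.hull ℝ {g} := by
    intro h' hh' hu0
    by_cases hgh : h' = g
    · rw [hgh]; exact PointedCone.subset_hull rfl
    have hh'E : h' ∈ E := Finset.mem_erase.2 ⟨hgh, hh'⟩
    have h1 := (hu h' (by simp [hh'])).2 hu0
    rw [Finset.coe_insert, Submodule.mem_span_insert] at h1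
    obtain ⟨a, z, hz, e⟩ := h1
    rw [← hins, Finset.coe_insert, Submodule.mem_span_insert] at hz
    obtain ⟨b, w, hw, rfl⟩ := hz
    have e' : -h' = ((b : ℝ) - a) • g + w := by
      rw [e, sub_smul]
      change (a : ℝ) • (-g) + ((b : ℝ) • g + w) = _
      rw [smul_neg]
      abel
    have hwρ : w ∈ ρ := by
      rw [hGρ]
      exact Submodule.span_mono (Finset.coe_subset.2 (Finset.erase_subset _ _)) hw
    rcases le_or_gt (a : ℝ) b with hab | hab
    · have : h' = 0 := by
        refine hs h' (hmem _ hh') ?_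
        rw [e']
        exact add_mem (PointedCone.smul_mem _ (sub_nonneg.2 hab) (hmem _ hg)) hwρ
      rw [this]
      exact zero_mem _
    · exfalso
      apply hgE
      have h2 : g = ((a : ℝ) - b)⁻¹ • (h' + w) := by
        have h3 : h' + w = ((a : ℝ) - b) • g := by
          rw [← neg_inj, neg_add, e', ← neg_smul]
          rw [neg_sub]
          abel
        rw [h3, smul_smul, inv_mul_cancel₀ (sub_pos.2 hab).ne', one_smul]
      rw [h2]
      exact PointedCone.smul_mem _ (inv_nonneg.2 (sub_pos.2 hab).le)
        (add_mem (PointedCone.subset_hull hh'E) hw)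
  have hGu : ∀ h' ∈ G, 0 ≤ u ⬝ᵥ h' := fun h' hh' => (hu h' (by simp [hh'])).1
  refine hK (PointedCone.hull ℝ {g}) ⟨u, ?_, fun x => ⟨fun hx => ⟨?_, ?_⟩, ?_⟩⟩
    (coneDim_hull_singleton hg0) (PointedCone.subset_hull rfl)
  · rw [hGρ]
    exact fun x hx => hull_nonneg hGu hx
  · exact Submodule.span_le.2 (by simpa using hmem g hg) hx
  · obtain ⟨c, rfl⟩ := Submodule.mem_span_singleton.1 hx
    rw [show c • g = (c : ℝ) • g from rfl, dotProduct_smul, hug, smul_zero]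
  · rintro ⟨hx, hux⟩
    rw [hGρ] at hx
    exact mem_of_dotProduct_eq_zero hGu hzero hx hux

/-- A pointed one-dimensional cone is a ray. -/
theorem exists_ray_generator {n : ℕ} {τ : PointedCone ℝ (Fin n → ℝ)}
    (hs : ∀ x ∈ τ, -x ∈ τ → x = 0) (hd : coneDim τ = 1) :
    ∃ w ∈ τ, w ≠ 0 ∧ ∀ x ∈ τ, ∃ c : ℝ, 0 ≤ c ∧ x = c • w := by
  obtain ⟨w, hw, hw0⟩ : ∃ w ∈ τ, w ≠ 0 := by
    by_contra! h
    have : Submodule.span ℝ (τ : Set (Fin n → ℝ)) = ⊥ := by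
      rw [Submodule.span_eq_bot]
      exact h
    rw [coneDim, this] at hd
    simp at hd
  refine ⟨w, hw, hw0, fun x hx => ?_⟩
  have hw' : (⟨w, Submodule.subset_span hw⟩ : Submodule.span ℝ (τ : Set (Fin n → ℝ))) ≠ 0 :=
    fun h => hw0 (congrArg Subtype.val h)
  obtain ⟨c, hc⟩ := (finrank_eq_one_iff_of_nonzero' _ hw').1 hd ⟨x, Submodule.subset_span hx⟩
  have hc' : c • w = x := congrArg Subtype.val hc
  refine ⟨c, ?_, hc'.symm⟩
  by_contra! hneg
  refine hw0 (hs w hw ?_)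
  have : -w = (-c)⁻¹ • x := by
    rw [← hc', smul_smul, inv_neg, neg_mul, inv_mul_cancel₀ hneg.ne, neg_smul, one_smul]
  rw [this]
  exact PointedCone.smul_mem _ (by simpa using hneg.le) hx

/-- A lattice point in the relative interior of a ray is nonzero, so that it generates the ray. -/
theorem MeetsRelint.exists_generator {n : ℕ} {S : Set (Fin n → ℝˣ)}
    {τ : PointedCone ℝ (Fin n → ℝ)} (h : MeetsRelint S τ) (hs : ∀ x ∈ τ, -x ∈ τ → x = 0)
    (hd : coneDim τ = 1) :
    ∃ v ∈ K₀ S, intCast v ∈ τ ∧ ∀ x ∈ τ, ∃ c : ℝ, 0 ≤ c ∧ x = c • intCast v := by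
  obtain ⟨v, hv, hvτ⟩ := h
  obtain ⟨w, hw, hw0, hτ⟩ := exists_ray_generator hs hd
  have hv' : intCast v ∈ τ := intrinsicInterior_subset hvτ
  obtain ⟨c, hc, hcv⟩ := hτ _ hv'
  rcases hc.eq_or_lt with rfl | hc
  -- If the origin were in the relative interior, the ray would contain negative multiples of `w`.
  · exfalso
    rw [zero_smul] at hcv
    obtain ⟨y, hy, hyv⟩ := mem_intrinsicInterior.1 hvτ
    have hmem : ∀ t : ℝ, t • w ∈ affineSpan ℝ (τ : Set (Fin n → ℝ)) := by
      intro t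
      have := AffineMap.lineMap_mem t (subset_affineSpan ℝ (τ : Set (Fin n → ℝ)) τ.zero_mem)
        (subset_affineSpan ℝ (τ : Set (Fin n → ℝ)) hw)
      simpa [AffineMap.lineMap_apply] using this
    let φ : ℝ → affineSpan ℝ (τ : Set (Fin n → ℝ)) := fun t => ⟨t • w, hmem t⟩
    have hφ : Continuous φ := by
      refine Continuous.subtype_mk ?_ _
      fun_prop
    have hφ0 : φ 0 = y := Subtype.ext (by simp [φ, hyv, hcv])
    have h1 : ∀ᶠ t in 𝓝 (0 : ℝ), φ t ∈ interior ((↑) ⁻¹' (τ : Set (Fin n → ℝ)) :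
        Set (affineSpan ℝ (τ : Set (Fin n → ℝ)))) :=
      hφ.continuousAt.eventually (by rw [hφ0]; exact isOpen_interior.mem_nhds hy)
    obtain ⟨t, ht, ht0⟩ := ((h1.filter_mono nhdsWithin_le_nhds).and
      (self_mem_nhdsWithin : Set.Iio (0 : ℝ) ∈ 𝓝[<] 0)).exists
    have h2 : φ t ∈ ((↑) ⁻¹' (τ : Set (Fin n → ℝ)) :
        Set (affineSpan ℝ (τ : Set (Fin n → ℝ)))) := interior_subset ht
    replace h2 : t • w ∈ τ := h2
    refine hw0 (hs w hw ?_)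
    have : -w = (-t)⁻¹ • (t • w) := by
      rw [smul_smul, inv_neg, neg_mul, inv_mul_cancel₀ (ne_of_lt ht0), neg_smul, one_smul]
    rw [this]
    exact PointedCone.smul_mem _ (inv_nonneg.2 (neg_nonneg.2 (le_of_lt ht0))) h2
  · refine ⟨v, hv, hv', fun x hx => ?_⟩
    obtain ⟨d, hd0, rfl⟩ := hτ x hx
    refine ⟨d / c, by positivity, ?_⟩
    rw [hcv, smul_smul, div_mul_cancel₀ _ hc.ne']

/-- **Separation lemma** for cones: if `ρ₁ ∩ ρ₂` is a face of `ρ₁`, some character is nonnegative on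
`ρ₁`, nonpositive on `ρ₂`, and cuts this face out of `ρ₁`. It is found in the relative interior of
the dual of the cone `ρ₁ - ρ₂`. -/
theorem exists_separating_character {n : ℕ} {ρ₁ ρ₂ : PointedCone ℝ (Fin n → ℝ)}
    (h₁ : IsRationalCone ρ₁) (h₂ : IsRationalCone ρ₂) (hf₁ : IsFace (ρ₁ ⊓ ρ₂) ρ₁) :
    ∃ m : Fin n → ℤ, m ∈ latticeDual (ρ₁ : Set (Fin n → ℝ)) ∧
      -m ∈ latticeDual (ρ₂ : Set (Fin n → ℝ)) ∧
      ∀ x, x ∈ ρ₁ ⊓ ρ₂ ↔ x ∈ ρ₁ ∧ pairing m x = 0 := by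
  classical
  obtain ⟨u₁, hu₁, hu₁'⟩ := hf₁
  obtain ⟨G₁, hG₁⟩ := h₁
  obtain ⟨G₂, hG₂⟩ := h₂
  have hmem₁ : ∀ g ∈ G₁, intCast g ∈ ρ₁ := fun g hg => by
    rw [hG₁]; exact PointedCone.subset_hull ⟨g, hg, rfl⟩
  have hmem₂ : ∀ g ∈ G₂, intCast g ∈ ρ₂ := fun g hg => by
    rw [hG₂]; exact PointedCone.subset_hull ⟨g, hg, rfl⟩
  have hneg : ∀ g : Fin n → ℤ, intCast (-g) = -intCast g := fun g => by ext; simp [intCast]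
  let G : Finset (Fin n → ℤ) := G₁ ∪ G₂.image (fun g => -g)
  have hγ : ∀ x ∈ PointedCone.hull ℝ ((G.image intCast : Finset (Fin n → ℝ)) : Set (Fin n → ℝ)),
      ∃ a ∈ ρ₁, ∃ b ∈ ρ₂, x = a - b := by
    intro x hx
    induction hx using Submodule.span_induction with
    | mem x hx =>
      obtain ⟨g, hg, rfl⟩ := Finset.mem_image.1 (Finset.mem_coe.1 hx)
      rcases Finset.mem_union.1 hg with hg | hg
      · exact ⟨_, hmem₁ g hg, 0, zero_mem _, by simp⟩
      · obtain ⟨g', hg', rfl⟩ := Finset.mem_image.1 hg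
        exact ⟨0, zero_mem _, _, hmem₂ g' hg', by simp [hneg]⟩
    | zero => exact ⟨0, zero_mem _, 0, zero_mem _, by simp⟩
    | add x y _ _ hx hy =>
      obtain ⟨a, ha, b, hb, rfl⟩ := hx
      obtain ⟨a', ha', b', hb', rfl⟩ := hy
      exact ⟨_, add_mem ha ha', _, add_mem hb hb', by abel⟩
    | smul c x _ hx =>
      obtain ⟨a, ha, b, hb, rfl⟩ := hx
      exact ⟨_, Submodule.smul_mem _ c ha, _, Submodule.smul_mem _ c hb, smul_sub _ _ _⟩
  obtain ⟨u, hu⟩ := exists_dotProduct_eq_zero_iff (G.image intCast)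
  obtain ⟨m, hm⟩ := exists_integral_functional G u
    fun g hg => (hu _ (Finset.mem_image_of_mem _ hg)).1
  have hm₁ : ∀ g ∈ G₁, 0 ≤ intCast m ⬝ᵥ intCast g ∧
      (intCast m ⬝ᵥ intCast g = 0 → intCast g ∈ ρ₁ ⊓ ρ₂) := by
    intro g hg
    have hgG : g ∈ G := Finset.mem_union_left _ hg
    refine ⟨(hm g hgG).1, fun h0 => ?_⟩
    obtain ⟨a, ha, b, hb, e⟩ := hγ _ ((hu _ (Finset.mem_image_of_mem _ hgG)).2
      ((hm g hgG).2.1 h0))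
    have e' : intCast g + a = b := by rw [← sub_eq_zero, ← neg_eq_zero, neg_sub', neg_add, e]; abel
    have hb1 : b ∈ ρ₁ ⊓ ρ₂ := ⟨e' ▸ add_mem (hmem₁ g hg) ha, hb⟩
    have h3 := ((hu₁' b).1 hb1).2
    rw [← e', dotProduct_add] at h3
    have h4 := hu₁ _ (hmem₁ g hg)
    have h5 := hu₁ _ ha
    exact (hu₁' _).2 ⟨hmem₁ g hg, by linarith⟩
  have hm₂ : ∀ g ∈ G₂, 0 ≤ intCast (-m) ⬝ᵥ intCast g := by
    intro g hg
    have e0 : intCast (-m) ⬝ᵥ intCast g = pairing m (intCast (-g)) := by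
      rw [hneg, hneg, pairing_eq, neg_dotProduct, dotProduct_neg]
    rw [e0]
    exact (hm _ (Finset.mem_union_right _ (Finset.mem_image_of_mem _ hg))).1
  have hd₁ : m ∈ latticeDual (ρ₁ : Set (Fin n → ℝ)) := by
    intro x hx
    rw [SetLike.mem_coe, hG₁] at hx
    refine hull_nonneg (w := intCast m) ?_ hx
    rintro _ ⟨g, hg, rfl⟩
    exact (hm₁ g hg).1
  have hd₂ : -m ∈ latticeDual (ρ₂ : Set (Fin n → ℝ)) := by
    intro x hx
    rw [SetLike.mem_coe, hG₂] at hx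
    refine hull_nonneg (w := intCast (-m)) ?_ hx
    rintro _ ⟨g, hg, rfl⟩
    exact hm₂ g hg
  have hz : ∀ x ∈ ρ₁ ⊓ ρ₂, pairing m x = 0 := by
    intro x hx
    have h3 := hd₁ x hx.1
    have h4 := hd₂ x hx.2
    rw [pairing_neg] at h4
    linarith
  refine ⟨m, hd₁, hd₂, fun x => ⟨fun hx => ⟨hx.1, hz x hx⟩, ?_⟩⟩
  rintro ⟨hx, hx0⟩
  rw [hG₁] at hx
  refine mem_of_dotProduct_eq_zero (u := intCast m) ?_ ?_ hx hx0
  · rintro _ ⟨g, hg, rfl⟩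
    exact (hm₁ g hg).1
  · rintro _ ⟨g, hg, rfl⟩
    exact (hm₁ g hg).2

theorem exists_cone_of_pairing_eq_zero {n : ℕ} (ρ : PointedCone ℝ (Fin n → ℝ)) (m : Fin n → ℤ) :
    ∃ ρ' : PointedCone ℝ (Fin n → ℝ), ∀ x, x ∈ ρ' ↔ x ∈ ρ ∧ pairing m x = 0 := by
  let L : (Fin n → ℝ) →ₗ[ℝ] ℝ := dotProductBilin ℝ ℝ (intCast m)
  refine ⟨ρ ⊓ PointedCone.ofSubmodule (LinearMap.ker L), fun x => ?_⟩
  rw [Submodule.mem_inf, PointedCone.mem_ofSubmodule_iff, LinearMap.mem_ker]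
  rfl

namespace Fan

variable {n : ℕ} (F : Fan n)

/-- If the functionals in a submonoid `Q` of the dual of `ρ` separately avoid vanishing on the bad
rays of `ρ`, then one of them, the sum of finitely many, cuts out a face without bad rays. -/
theorem exists_face_of_rays {ρ : PointedCone ℝ (Fin n → ℝ)} (hρ : ρ ∈ F.cones)
    (Q : AddSubmonoid (Fin n → ℤ)) (hQ : Q ≤ latticeDual (ρ : Set (Fin n → ℝ)))
    (bad : PointedCone ℝ (Fin n → ℝ) → Prop)
    (h : ∀ τ ∈ F.cones, τ ≤ ρ → coneDim τ = 1 → bad τ →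
      ∃ m ∈ Q, -m ∉ latticeDual (τ : Set (Fin n → ℝ))) :
    ∃ m ∈ Q, ∃ ρ' ∈ F.cones, (∀ x, x ∈ ρ' ↔ x ∈ ρ ∧ pairing m x = 0) ∧
      ∀ τ ∈ F.cones, τ ≤ ρ' → coneDim τ = 1 → ¬ bad τ := by
  classical
  choose! μ hμQ hμ using h
  let T := F.finite.toFinset.filter fun τ => τ ≤ ρ ∧ coneDim τ = 1 ∧ bad τ
  have hT : ∀ τ ∈ T, τ ∈ F.cones ∧ τ ≤ ρ ∧ coneDim τ = 1 ∧ bad τ := fun τ hτ => by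
    simpa [T] using hτ
  have hμT : ∀ τ ∈ T, μ τ ∈ Q := fun τ hτ => hμQ τ (hT τ hτ).1 (hT τ hτ).2.1 (hT τ hτ).2.2.1
    (hT τ hτ).2.2.2
  have hsum : ∑ τ ∈ T, μ τ ∈ Q := sum_mem hμT
  obtain ⟨ρ', hρ'⟩ := exists_cone_of_pairing_eq_zero ρ (∑ τ ∈ T, μ τ)
  have hface : IsFace ρ' ρ := ⟨intCast (∑ τ ∈ T, μ τ), fun x hx => hQ hsum x hx, hρ'⟩
  refine ⟨_, hsum, ρ', F.face_mem ρ hρ ρ' hface, hρ', fun τ hτ hle hd hbad => ?_⟩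
  have hτρ : τ ≤ ρ := hle.trans hface.le
  have hτT : τ ∈ T := by simp [T, hτ, hτρ, hd, hbad]
  refine hμ τ hτ hτρ hd hbad fun x hx => ?_
  have h0 := ((hρ' x).1 (hle hx)).2
  have e : pairing (∑ τ ∈ T, μ τ) x = ∑ τ ∈ T, pairing (μ τ) x := by
    simp only [pairing, Finset.sum_apply, Int.cast_sum, Finset.sum_mul]
    exact Finset.sum_comm
  rw [e, Finset.sum_eq_zero_iff_of_nonneg fun τ' hτ' => hQ (hμT τ' hτ') x (hτρ hx)] at h0
  rw [pairing_neg, h0 τ hτT, neg_zero]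

theorem le_of_rays {ρ K : PointedCone ℝ (Fin n → ℝ)} (hρ : ρ ∈ F.cones)
    (hK : ∀ τ ∈ F.cones, τ ≤ ρ → coneDim τ = 1 → τ ≤ K) : ρ ≤ K :=
  (F.rational ρ hρ).le_of_rays (F.salient ρ hρ) fun τ hτ hd =>
    hK τ (F.face_mem ρ hρ τ hτ) hτ.le hd

/-- The origin is a face of every pointed cone. -/
theorem bot_mem : (⊥ : PointedCone ℝ (Fin n → ℝ)) ∈ F.cones := by
  obtain ⟨ρ, hρ⟩ := F.nonempty
  obtain ⟨G, hG⟩ := (F.rational ρ hρ).exists_finset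
  obtain ⟨u, hu⟩ := exists_dotProduct_eq_zero_iff G
  have hmem : ∀ g ∈ G, g ∈ ρ := fun g hg => by rw [hG]; exact PointedCone.subset_hull hg
  refine F.face_mem ρ hρ _ ⟨u, fun x hx => ?_, fun x => ⟨fun hx => ?_, fun hx => ?_⟩⟩
  · rw [hG] at hx
    exact hull_nonneg (fun g hg => (hu g hg).1) hx
  · rw [Submodule.mem_bot] at hx
    rw [hx]
    exact ⟨zero_mem _, dotProduct_zero _⟩
  · have h1 := hx.1
    rw [hG] at h1
    refine mem_of_dotProduct_eq_zero (fun g hg => (hu g hg).1) (fun g hg h0 => ?_) h1 hx.2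
    have := F.salient ρ hρ g (hmem g hg) (by rw [hG]; exact (hu g hg).2 h0)
    simp [this]

/-- Completeness of a fan and of its stars, in terms of total preorders on characters. If `P` is a
submonoid of characters that contains `m` or `-m` for every `m` vanishing on `ρ₀`, then some cone
`ρ' ≥ ρ₀` has all its characters that vanish on `ρ₀` in `P`.

Otherwise each `ρ' ≥ ρ₀` has such a character `μ ρ'` outside `P`. Then `-μ ρ'` is in `P`, the cone
generated by all `μ ρ'` is pointed, and some `u` is positive on all of them. Moving from the
relative interior of `ρ₀` in the direction `-u` one stays, for a short while, in some `ρ' ≥ ρ₀`, on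
which `μ ρ'` is nonnegative: a contradiction. -/
theorem exists_cone_of_total (hF : F.IsComplete) {ρ₀ : PointedCone ℝ (Fin n → ℝ)}
    (hρ₀ : ρ₀ ∈ F.cones) (P : AddSubmonoid (Fin n → ℤ))
    (hP : ∀ m ∈ latticeDual (ρ₀ : Set (Fin n → ℝ)), -m ∈ latticeDual (ρ₀ : Set (Fin n → ℝ)) →
      m ∈ P ∨ -m ∈ P) :
    ∃ ρ' ∈ F.cones, ρ₀ ≤ ρ' ∧ ∀ m ∈ latticeDual (ρ' : Set (Fin n → ℝ)),
      -m ∈ latticeDual (ρ₀ : Set (Fin n → ℝ)) → m ∈ P := by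
  classical
  by_contra! hcon
  choose! μ hμ hμ₀ hμP using hcon
  let I := F.finite.toFinset.filter fun ρ' => ρ₀ ≤ ρ'
  have hI : ∀ ρ', ρ' ∈ I ↔ ρ' ∈ F.cones ∧ ρ₀ ≤ ρ' := fun ρ' => by simp [I]
  let q : (Fin n → ℤ) → (Fin n → ℚ) := fun m i => m i
  have hnegP : ∀ ρ' ∈ I, -μ ρ' ∈ P := fun ρ' hρ' => by
    obtain ⟨h1, h2⟩ := (hI ρ').1 hρ'
    refine (hP _ (latticeDual_anti h2 (hμ ρ' h1 h2)) (hμ₀ ρ' h1 h2)).resolve_left (hμP ρ' h1 h2)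
  let G : Finset (Fin n → ℚ) := I.image fun ρ' => q (μ ρ')
  -- Up to a positive integer factor, the cone generated by the `μ ρ'` lies in `-P`.
  have hhull : ∀ x ∈ PointedCone.hull ℚ (G : Set (Fin n → ℚ)),
      ∃ N : ℕ, 0 < N ∧ ∃ p ∈ P, N • x = q (-p) := by
    intro x hx
    induction hx using Submodule.span_induction with
    | mem x hx =>
      obtain ⟨ρ', hρ', rfl⟩ := Finset.mem_image.1 (Finset.mem_coe.1 hx)
      exact ⟨1, one_pos, _, hnegP ρ' hρ', by simp⟩
    | zero => exact ⟨1, one_pos, 0, zero_mem _, by ext; simp [q]⟩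
    | add x y _ _ hx hy =>
      obtain ⟨N, hN, p, hp, e⟩ := hx
      obtain ⟨N', hN', p', hp', e'⟩ := hy
      refine ⟨N * N', Nat.mul_pos hN hN', N' • p + N • p',
        add_mem (nsmul_mem hp _) (nsmul_mem hp' _), ?_⟩
      ext i
      have h1 := congrFun e i
      have h2 := congrFun e' i
      simp [q] at h1 h2 ⊢
      linear_combination (N' : ℚ) * h1 + (N : ℚ) * h2
    | smul c x _ hx =>
      obtain ⟨N, hN, p, hp, e⟩ := hx
      obtain ⟨c, hc⟩ := c
      obtain ⟨k, hk⟩ : ∃ k : ℕ, (k : ℚ) = c * c.den := by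
        refine ⟨c.num.toNat, ?_⟩
        rw [← Int.cast_natCast, Int.toNat_of_nonneg (Rat.num_nonneg.2 hc), Rat.mul_den_eq_num]
      refine ⟨c.den * N, Nat.mul_pos c.den_pos hN, k • p, nsmul_mem hp _, ?_⟩
      ext i
      have h1 := congrFun e i
      change (c.den * N) • (c • x i) = (((-(k • p)) i : ℤ) : ℚ)
      simp [q] at h1 ⊢
      rw [hk]
      linear_combination (c * c.den) * h1
  obtain ⟨u, hu⟩ := exists_dotProduct_eq_zero_iff G
  have hpos : ∀ ρ' ∈ I, 0 < u ⬝ᵥ q (μ ρ') := by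
    intro ρ' hρ'
    have hg : q (μ ρ') ∈ G := Finset.mem_image_of_mem _ hρ'
    refine lt_of_le_of_ne (hu _ hg).1 fun h0 => ?_
    obtain ⟨N, hN, p, hp, e⟩ := hhull _ ((hu _ hg).2 h0.symm)
    obtain ⟨h1, h2⟩ := (hI ρ').1 hρ'
    refine hμP ρ' h1 h2 ?_
    have e' : p = N • μ ρ' := by
      ext i
      have := congrFun e i
      simp [q] at this
      simp
      exact_mod_cast this.symm
    obtain ⟨k, rfl⟩ := Nat.exists_eq_add_of_lt hN
    have : μ ρ' = p + k • (-μ ρ') := by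
      rw [e', zero_add, add_smul, one_smul, smul_neg]
      abel
    rw [this]
    exact add_mem hp (nsmul_mem (hnegP ρ' hρ') _)
  let x : Fin n → ℝ := fun i => -(u i : ℝ)
  have hx : ∀ ρ' ∈ I, pairing (μ ρ') x < 0 := by
    intro ρ' hρ'
    have h1 : pairing (μ ρ') x = -((u ⬝ᵥ q (μ ρ') : ℚ) : ℝ) := by
      simp only [pairing, x, q, dotProduct]
      push_cast
      rw [← Finset.sum_neg_distrib]
      exact Finset.sum_congr rfl fun i _ => by ring
    rw [h1, neg_lt_zero]
    exact_mod_cast hpos ρ' hρ'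
  obtain ⟨G₀, hG₀⟩ := (F.rational ρ₀ hρ₀).exists_finset
  have hmem : ∀ g ∈ G₀, g ∈ ρ₀ := fun g hg => by rw [hG₀]; exact PointedCone.subset_hull hg
  -- A point in the relative interior of `ρ₀`.
  let x₀ : Fin n → ℝ := ∑ g ∈ G₀, g
  have hx₀ : x₀ ∈ ρ₀ := sum_mem hmem
  obtain ⟨ρ', hρ', hfr⟩ : ∃ ρ' ∈ F.cones, ∃ᶠ ε in 𝓝[>] (0 : ℝ), x₀ + ε • x ∈ ρ' := by
    by_contra! h
    have h1 : ∀ᶠ ε in 𝓝[>] (0 : ℝ), ∀ ρ' ∈ F.cones, x₀ + ε • x ∉ ρ' :=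
      (Filter.eventually_all_finite F.finite).2 h
    obtain ⟨ε, hε⟩ := h1.exists
    obtain ⟨ρ', h2, h3⟩ : x₀ + ε • x ∈ F.support := by rw [hF]; trivial
    exact hε ρ' h2 h3
  have hx₀' : x₀ ∈ ρ' := (F.rational ρ' hρ').mem_of_frequently hfr
  have hle : ρ₀ ≤ ρ' := by
    obtain ⟨w, hw, hw'⟩ := (F.inter_face ρ₀ hρ₀ ρ' hρ').1
    have h0 : w ⬝ᵥ x₀ = 0 := ((hw' x₀).1 ⟨hx₀, hx₀'⟩).2
    simp only [x₀, dotProduct_sum] at h0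
    rw [Finset.sum_eq_zero_iff_of_nonneg fun g hg => hw g (hmem g hg)] at h0
    conv_lhs => rw [hG₀]
    exact Submodule.span_le.2 fun g hg => ((hw' g).2 ⟨hmem g hg, h0 g hg⟩).2
  obtain ⟨ε, hε, hε0⟩ := (hfr.and_eventually (self_mem_nhdsWithin :
    Set.Ioi (0 : ℝ) ∈ 𝓝[>] (0 : ℝ))).exists
  have h1 := hμ ρ' hρ' hle _ hε
  have h2 := hx ρ' ((hI ρ').2 ⟨hρ', hle⟩)
  have h3 : pairing (μ ρ') x₀ = 0 := by
    have h4 := hμ ρ' hρ' hle _ hx₀'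
    have h5 := hμ₀ ρ' hρ' hle _ hx₀
    rw [pairing_neg] at h5
    linarith
  rw [pairing_eq, dotProduct_add, dotProduct_smul, ← pairing_eq, ← pairing_eq, h3, zero_add,
    smul_eq_mul] at h1
  have := mul_neg_of_pos_of_neg (Set.mem_Ioi.1 hε0) h2
  linarith

end Fan

/-! ### Monoid algebras of lattice cones -/

/-- The ring `ℝ[M]` of Laurent polynomials in `n` variables, the coordinate ring of the torus. -/
abbrev TorusRing (n : ℕ) : Type := AddMonoidAlgebra ℝ (Fin n → ℤ)

theorem pairing_intCast {n : ℕ} (m v : Fin n → ℤ) : pairing m (intCast v) = ((m ⬝ᵥ v : ℤ) : ℝ) := by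
  simp [pairing, intCast, dotProduct]

/-- `M ∩ A^*` is cut out by finitely many lattice vectors. -/
def HasFiniteDual {n : ℕ} (A : Set (Fin n → ℝ)) : Prop :=
  ∃ G : Finset (Fin n → ℤ), ∀ m, m ∈ latticeDual A ↔ ∀ g ∈ G, 0 ≤ m ⬝ᵥ g

theorem IsRationalCone.hasFiniteDual {n : ℕ} {ρ : PointedCone ℝ (Fin n → ℝ)}
    (h : IsRationalCone ρ) : HasFiniteDual (ρ : Set (Fin n → ℝ)) := by
  obtain ⟨G, rfl⟩ := h
  refine ⟨G, fun m => ⟨fun hm g hg => ?_, fun hm x hx => ?_⟩⟩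
  · have := hm _ (PointedCone.subset_hull ⟨g, hg, rfl⟩)
    rw [pairing_intCast] at this
    exact_mod_cast this
  · refine hull_nonneg (w := intCast m) ?_ hx
    rintro _ ⟨g, hg, rfl⟩
    rw [← pairing_eq, pairing_intCast]
    exact_mod_cast hm g hg

theorem Fan.hasFiniteDual_support {n : ℕ} (F : Fan n) : HasFiniteDual F.support := by
  classical
  choose! G hG using fun ρ (hρ : ρ ∈ F.cones) => (F.rational ρ hρ).hasFiniteDual
  refine ⟨F.finite.toFinset.biUnion G, fun m => ⟨fun hm g hg => ?_, ?_⟩⟩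
  · obtain ⟨ρ, hρ, hg⟩ := Finset.mem_biUnion.1 hg
    have hρ' : ρ ∈ F.cones := by simpa using hρ
    exact (hG ρ hρ' m).1 (fun x hx => hm x ⟨ρ, hρ', hx⟩) g hg
  · rintro hm x ⟨ρ, hρ, hx⟩
    exact (hG ρ hρ m).2 (fun g hg => hm g (Finset.mem_biUnion.2 ⟨ρ, by simpa using hρ, hg⟩)) x hx

/-- **Gordan's lemma**: the monoid is the image of the equalizer of two homomorphisms from a free
commutative monoid of finite rank to a group, and such equalizers are finitely generated. -/
theorem HasFiniteDual.fg {n : ℕ} {A : Set (Fin n → ℝ)} (h : HasFiniteDual A) :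
    (latticeDual A).FG := by
  obtain ⟨G, hG⟩ := h
  -- Pairs of natural vectors `(a, b)` and slacks `c` with `⟨a, g⟩ = ⟨b, g⟩ + c g` for `g ∈ G`.
  let f : ((Fin n → ℕ) × (Fin n → ℕ)) × (G → ℕ) →+ (G → ℤ) :=
    { toFun := fun x g => ∑ i, (x.1.1 i : ℤ) * (g : Fin n → ℤ) i
      map_zero' := by ext; simp
      map_add' := fun x y => by ext; simp [add_mul, Finset.sum_add_distrib] }
  let f' : ((Fin n → ℕ) × (Fin n → ℕ)) × (G → ℕ) →+ (G → ℤ) :=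
    { toFun := fun x g => ∑ i, (x.1.2 i : ℤ) * (g : Fin n → ℤ) i + x.2 g
      map_zero' := by ext; simp
      map_add' := fun x y => by ext; simp [add_mul, Finset.sum_add_distrib]; ring }
  let d : ((Fin n → ℕ) × (Fin n → ℕ)) × (G → ℕ) →+ (Fin n → ℤ) :=
    { toFun := fun x i => (x.1.1 i : ℤ) - x.1.2 i
      map_zero' := by ext; simp
      map_add' := fun x y => by ext; simp; ring }
  have hfg := (AddSubmonoid.fg_eqLocusM f f').map d
  convert hfg using 1
  have hd : ∀ (x : ((Fin n → ℕ) × (Fin n → ℕ)) × (G → ℕ)) (g : Fin n → ℤ),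
      d x ⬝ᵥ g = ∑ i, (x.1.1 i : ℤ) * g i - ∑ i, (x.1.2 i : ℤ) * g i := by
    intro x g
    rw [← Finset.sum_sub_distrib]
    exact Finset.sum_congr rfl fun i _ => sub_mul _ _ _
  ext m
  rw [hG, AddSubmonoid.mem_map]
  constructor
  · intro hm
    have hdm : d (((fun i => (m i).toNat), (fun i => (-m i).toNat)),
        (fun g => (m ⬝ᵥ (g : Fin n → ℤ)).toNat)) = m := by
      ext i
      change ((m i).toNat : ℤ) - ((-m i).toNat : ℤ) = m i
      exact Int.toNat_sub_toNat_neg (m i)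
    refine ⟨_, ?_, hdm⟩
    ext g
    have h1 := hd (((fun i => (m i).toNat), (fun i => (-m i).toNat)),
        (fun g => (m ⬝ᵥ (g : Fin n → ℤ)).toNat)) g
    rw [hdm] at h1
    change (∑ i, ((m i).toNat : ℤ) * (g : Fin n → ℤ) i) =
      ∑ i, ((-m i).toNat : ℤ) * (g : Fin n → ℤ) i + ((m ⬝ᵥ (g : Fin n → ℤ)).toNat : ℤ)
    rw [Int.toNat_of_nonneg (hm g g.2), h1]
    ring
  · rintro ⟨x, hx, rfl⟩ g hg
    have h1 := congrFun (show f x = f' x from hx) ⟨g, hg⟩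
    change ∑ i, (x.1.1 i : ℤ) * g i = ∑ i, (x.1.2 i : ℤ) * g i + (x.2 ⟨g, hg⟩ : ℤ) at h1
    rw [hd, h1]
    simp

theorem HasFiniteDual.finiteType {n : ℕ} {A : Set (Fin n → ℝ)} (h : HasFiniteDual A) :
    Algebra.FiniteType ℝ (CoordRing A) := by
  have : AddMonoid.FG (latticeDual A) := (AddMonoid.fg_iff_addSubmonoid_fg _).2 h.fg
  exact AddMonoidAlgebra.finiteType_of_fg _ _

/-- The inclusion `ℝ[M ∩ A^*] ⊆ ℝ[M]`. -/
noncomputable def CoordRing.toTorus {n : ℕ} (A : Set (Fin n → ℝ)) : CoordRing A →ₐ[ℝ] TorusRing n :=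
  AddMonoidAlgebra.mapDomainAlgHom ℝ ℝ (latticeDual A).subtype

theorem CoordRing.toTorus_single {n : ℕ} {A : Set (Fin n → ℝ)} (m : latticeDual A) (r : ℝ) :
    toTorus A (AddMonoidAlgebra.single m r) = AddMonoidAlgebra.single (m : Fin n → ℤ) r := by
  simp [toTorus]

theorem CoordRing.incl_single {n : ℕ} {A B : Set (Fin n → ℝ)} (h : A ⊆ B) (m : latticeDual B)
    (r : ℝ) : incl h (AddMonoidAlgebra.single m r) =
      AddMonoidAlgebra.single ⟨m, latticeDual_anti h m.2⟩ r := by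
  simp [incl]
  rfl

theorem CoordRing.toTorus_injective {n : ℕ} (A : Set (Fin n → ℝ)) :
    Function.Injective (toTorus A) :=
  AddMonoidAlgebra.mapDomain_injective Subtype.val_injective

theorem CoordRing.toTorus_incl {n : ℕ} {A B : Set (Fin n → ℝ)} (h : A ⊆ B) (f : CoordRing B) :
    toTorus A (incl h f) = toTorus B f := by
  induction f using AddMonoidAlgebra.induction_linear with
  | zero => simp
  | add f g hf hg => rw [map_add, map_add, map_add, hf, hg]
  | single m r => rw [incl_single, toTorus_single, toTorus_single]

/-- A Laurent polynomial is in `ℝ[M ∩ A^*]` if and only if all of its monomials are. -/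
theorem CoordRing.mem_range_toTorus {n : ℕ} {A : Set (Fin n → ℝ)} (f : TorusRing n) :
    (∃ g, toTorus A g = f) ↔ ∀ m, f.coeff m ≠ 0 → m ∈ latticeDual A := by
  constructor
  · rintro ⟨g, rfl⟩ m hm
    by_contra h
    refine hm ?_
    change (AddMonoidAlgebra.mapDomain Subtype.val g).coeff m = 0
    rw [AddMonoidAlgebra.coeff_mapDomain]
    refine Finsupp.mapDomain_of_notMem_range _ _ ?_
    simpa using h
  · intro h
    refine ⟨AddMonoidAlgebra.ofCoeff (f.coeff.subtypeDomain (· ∈ latticeDual A)), ?_⟩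
    apply AddMonoidAlgebra.ext
    change (AddMonoidAlgebra.mapDomain Subtype.val _).coeff = _
    rw [AddMonoidAlgebra.coeff_mapDomain, AddMonoidAlgebra.coeff_ofCoeff]
    ext m
    by_cases hm : m ∈ latticeDual A
    · have := Finsupp.mapDomain_apply (f := (Subtype.val : latticeDual A → Fin n → ℤ))
        Subtype.val_injective (f.coeff.subtypeDomain (· ∈ latticeDual A)) ⟨m, hm⟩
      rw [this]
      rfl
    · rw [Finsupp.mapDomain_of_notMem_range _ _ (by simpa using hm)]
      by_contra h0
      exact hm (h m (Ne.symm h0))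

instance {n : ℕ} (A : Set (Fin n → ℝ)) : IsDomain (CoordRing A) :=
  (CoordRing.toTorus_injective A).isDomain (CoordRing.toTorus A).toRingHom

/-! ### Laurent polynomials: evaluation, one-parameter subgroups and integral closure -/

theorem torusChar_add {n : ℕ} (ξ : Fin n → ℝˣ) (m m' : Fin n → ℤ) :
    torusChar ξ (m + m') = torusChar ξ m * torusChar ξ m' := by
  simp [torusChar, zpow_add, Finset.prod_mul_distrib]

theorem torusChar_zero {n : ℕ} (ξ : Fin n → ℝˣ) : torusChar ξ 0 = 1 := by
  simp [torusChar]

theorem torusChar_cochar_mul {n : ℕ} (v : Fin n → ℤ) (s : ℝˣ) (ξ : Fin n → ℝˣ) (m : Fin n → ℤ) :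
    torusChar (cochar v s * ξ) m = s ^ (m ⬝ᵥ v) * torusChar ξ m := by
  simp only [torusChar, cochar, Pi.mul_apply, mul_zpow, Finset.prod_mul_distrib, dotProduct]
  congr 1
  have hsum : ∀ t : Finset (Fin n), ∏ i ∈ t, (s ^ v i) ^ m i = s ^ ∑ i ∈ t, m i * v i := by
    intro t
    induction t using Finset.cons_induction with
    | empty => simp
    | cons i t hi ih =>
      rw [Finset.prod_cons, Finset.sum_cons, ih, zpow_add, ← zpow_mul, mul_comm (v i)]
  exact hsum _

/-- The character `m ↦ ξ^m` as a monoid homomorphism to `ℝ`. -/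
noncomputable def torusCharHom {n : ℕ} (ξ : Fin n → ℝˣ) : Multiplicative (Fin n → ℤ) →* ℝ where
  toFun m := (torusChar ξ m.toAdd : ℝ)
  map_one' := by simp [torusChar_zero]
  map_mul' a b := by simp [torusChar_add]

/-- Evaluation of Laurent polynomials at `ξ ∈ T(ℝ)`. -/
noncomputable def laurentEval {n : ℕ} (ξ : Fin n → ℝˣ) : TorusRing n →ₐ[ℝ] ℝ :=
  AddMonoidAlgebra.lift ℝ ℝ _ (torusCharHom ξ)

theorem laurentEval_single {n : ℕ} (ξ : Fin n → ℝˣ) (m : Fin n → ℤ) (r : ℝ) :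
    laurentEval ξ (AddMonoidAlgebra.single m r) = r * torusChar ξ m := by
  simp [laurentEval, torusCharHom]

theorem torusEval_single {n : ℕ} {A : Set (Fin n → ℝ)} (ξ : Fin n → ℝˣ) (m : latticeDual A)
    (r : ℝ) : torusEval A ξ (AddMonoidAlgebra.single m r) = r * torusChar ξ m := by
  simp [torusEval]

theorem laurentEval_toTorus {n : ℕ} {A : Set (Fin n → ℝ)} (ξ : Fin n → ℝˣ) (f : CoordRing A) :
    laurentEval ξ (CoordRing.toTorus A f) = torusEval A ξ f := by
  induction f using AddMonoidAlgebra.induction_linear with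
  | zero => simp
  | add f g hf hg => rw [map_add, map_add, map_add, hf, hg]
  | single m r => rw [CoordRing.toTorus_single, laurentEval_single, torusEval_single]

/-- Polynomials are Laurent polynomials. -/
noncomputable def polyToTorus (n : ℕ) : MvPolynomial (Fin n) ℝ →ₐ[ℝ] TorusRing n :=
  AddMonoidAlgebra.mapDomainAlgHom ℝ ℝ
    { toFun := fun m i => (m i : ℤ)
      map_zero' := by ext; simp
      map_add' := fun a b => by ext; simp }

theorem polyToTorus_injective (n : ℕ) : Function.Injective (polyToTorus n) :=
  AddMonoidAlgebra.mapDomain_injective fun a b h => by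
    ext i
    have h1 : (a i : ℤ) = b i := congrFun h i
    exact_mod_cast h1

theorem polyToTorus_monomial {n : ℕ} (m : Fin n →₀ ℕ) (r : ℝ) :
    polyToTorus n (MvPolynomial.monomial m r) =
      AddMonoidAlgebra.single (fun i => (m i : ℤ)) r := by
  simp [polyToTorus, MvPolynomial.monomial]

theorem laurentEval_polyToTorus {n : ℕ} (ξ : Fin n → ℝˣ) (p : MvPolynomial (Fin n) ℝ) :
    laurentEval ξ (polyToTorus n p) = MvPolynomial.eval (fun i => (ξ i : ℝ)) p := by
  induction p using MvPolynomial.induction_on' with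
  | monomial m r =>
    rw [polyToTorus_monomial, laurentEval_single, MvPolynomial.eval_monomial, torusChar,
      Finsupp.prod_fintype _ _ (by simp)]
    push_cast
    simp
  | add p q hp hq => rw [map_add, map_add, map_add, hp, hq]

/-- The product of all variables. -/
noncomputable def allVars (n : ℕ) : MvPolynomial (Fin n) ℝ :=
  MvPolynomial.monomial (Finsupp.equivFunOnFinite.symm fun _ => 1) 1

theorem polyToTorus_allVars_pow (n k : ℕ) :
    polyToTorus n (allVars n ^ k) = AddMonoidAlgebra.single (fun _ => (k : ℤ)) 1 := by
  rw [map_pow, allVars, polyToTorus_monomial, AddMonoidAlgebra.single_pow, one_pow]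
  congr 1
  ext i
  simp

theorem exists_mul_allVars_pow {n : ℕ} (f : TorusRing n) :
    ∃ (k : ℕ) (p : MvPolynomial (Fin n) ℝ),
      f * polyToTorus n (allVars n ^ k) = polyToTorus n p := by
  induction f using AddMonoidAlgebra.induction_linear with
  | zero => exact ⟨0, 0, by simp⟩
  | add f g hf hg =>
    obtain ⟨k, p, hp⟩ := hf
    obtain ⟨l, q, hq⟩ := hg
    refine ⟨k + l, p * allVars n ^ l + q * allVars n ^ k, ?_⟩
    rw [map_add, map_mul, map_mul, ← hp, ← hq, pow_add, map_mul]
    ring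
  | single m r =>
    let k : ℕ := ∑ i, (-m i).toNat
    have hk : ∀ i, 0 ≤ m i + k := by
      intro i
      have h1 : (-m i).toNat ≤ k :=
        Finset.single_le_sum (f := fun i => (-m i).toNat) (fun _ _ => Nat.zero_le _)
          (Finset.mem_univ i)
      have := Int.self_le_toNat (-m i)
      omega
    refine ⟨k, MvPolynomial.monomial (Finsupp.equivFunOnFinite.symm fun i => (m i + k).toNat) r, ?_⟩
    rw [polyToTorus_allVars_pow, polyToTorus_monomial, AddMonoidAlgebra.single_mul_single, mul_one]
    congr 1
    ext i
    simp [Int.toNat_of_nonneg (hk i)]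

/-- `ℝ[M]` is the localization of the polynomial ring at the product of the variables. -/
theorem isLocalization_torusRing (n : ℕ) :
    @IsLocalization.Away _ _ (allVars n) (TorusRing n) _ (polyToTorus n).toRingHom.toAlgebra := by
  let _ := (polyToTorus n).toRingHom.toAlgebra
  have hal : ∀ x, algebraMap (MvPolynomial (Fin n) ℝ) (TorusRing n) x = polyToTorus n x :=
    fun _ => rfl
  refine ⟨?_, ?_, ?_⟩
  · rintro ⟨_, k, rfl⟩
    change IsUnit (polyToTorus n (allVars n ^ k))
    rw [polyToTorus_allVars_pow]
    refine IsUnit.of_mul_eq_one (AddMonoidAlgebra.single (fun _ => -(k : ℤ)) 1) ?_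
    rw [AddMonoidAlgebra.single_mul_single, AddMonoidAlgebra.one_def]
    congr 1
    · ext i; simp
    · simp
  · intro z
    obtain ⟨k, p, h⟩ := exists_mul_allVars_pow z
    exact ⟨⟨p, ⟨_, k, rfl⟩⟩, h⟩
  · intro x y e
    rw [hal, hal] at e
    exact ⟨1, by rw [polyToTorus_injective n e]⟩

instance (n : ℕ) : IsIntegrallyClosed (TorusRing n) := by
  let _ := (polyToTorus n).toRingHom.toAlgebra
  have := isLocalization_torusRing n
  refine isIntegrallyClosed_of_isLocalization (TorusRing n) (Submonoid.powers (allVars n)) ?_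
  refine powers_le_nonZeroDivisors_of_noZeroDivisors ?_
  simp [allVars]

/-- Laurent polynomials are determined by their values on a nonempty open subset of `T(ℝ)`. -/
theorem eq_zero_of_laurentEval_eq_zero {n : ℕ} {U : Set (Fin n → ℝˣ)} (hU : IsOpen U)
    (hne : U.Nonempty) {f : TorusRing n} (hf : ∀ ξ ∈ U, laurentEval ξ f = 0) : f = 0 := by
  obtain ⟨ξ₀, hξ₀⟩ := hne
  obtain ⟨V, hV, hVU⟩ : ∃ V : Fin n → Set ℝˣ, (∀ i, V i ∈ 𝓝 (ξ₀ i)) ∧ Set.univ.pi V ⊆ U := by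
    obtain ⟨I, V, hV, hVU⟩ := isOpen_pi_iff.1 hU ξ₀ hξ₀
    refine ⟨fun i => if i ∈ I then V i else Set.univ, fun i => ?_, fun x hx => hVU fun i hi => ?_⟩
    · by_cases hi : i ∈ I
      · simpa [hi] using (hV i hi).1.mem_nhds (hV i hi).2
      · simp [hi]
    · have := hx i trivial
      simpa [Finset.mem_coe.1 hi] using this
  have hinf : ∀ i, ((fun x : ℝˣ => (x : ℝ)) '' V i).Infinite := by
    intro i
    refine infinite_of_mem_nhds (ξ₀ i : ℝ) ?_
    exact Units.isOpenEmbedding_val.isOpenMap.image_mem_nhds (hV i)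
  obtain ⟨k, p, hp⟩ := exists_mul_allVars_pow f
  have hp0 : p = 0 := by
    refine MvPolynomial.funext_set _ hinf fun x hx => ?_
    choose ξ hξ hξx using fun i => hx i trivial
    have hx' : x = fun i => (ξ i : ℝ) := funext fun i => (hξx i).symm
    rw [map_zero, hx', ← laurentEval_polyToTorus, ← hp, map_mul, hf ξ (hVU fun i _ => hξ i),
      zero_mul]
  rw [hp0, map_zero] at hp
  refine (mul_eq_zero.1 hp).resolve_right ?_
  rw [polyToTorus_allVars_pow]
  simp

/-- The pullback of Laurent polynomials along `s ↦ λ_v(s) ξ`. -/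
noncomputable def cocharPullback {n : ℕ} (v : Fin n → ℤ) (ξ : Fin n → ℝˣ) :
    TorusRing n →ₐ[ℝ] ℝ[T;T⁻¹] :=
  AddMonoidAlgebra.lift ℝ ℝ[T;T⁻¹] _
    { toFun := fun m => AddMonoidAlgebra.single (m.toAdd ⬝ᵥ v) (torusChar ξ m.toAdd : ℝ)
      map_one' := by
        rw [toAdd_one, torusChar_zero, zero_dotProduct, AddMonoidAlgebra.one_def, Units.val_one]
      map_mul' := fun a b => by
        rw [AddMonoidAlgebra.single_mul_single, toAdd_mul, torusChar_add, add_dotProduct,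
          Units.val_mul] }

theorem cocharPullback_single {n : ℕ} (v : Fin n → ℤ) (ξ : Fin n → ℝˣ) (m : Fin n → ℤ) (r : ℝ) :
    cocharPullback v ξ (AddMonoidAlgebra.single m r) =
      AddMonoidAlgebra.single (m ⬝ᵥ v) (r * torusChar ξ m) := by
  rw [cocharPullback, AddMonoidAlgebra.lift_single]
  exact AddMonoidAlgebra.smul_single _ _ _

theorem eval₂_cocharPullback {n : ℕ} (v : Fin n → ℤ) (ξ : Fin n → ℝˣ) (s : ℝˣ) (f : TorusRing n) :
    LaurentPolynomial.eval₂ (RingHom.id ℝ) s (cocharPullback v ξ f) =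
      laurentEval (cochar v s * ξ) f := by
  induction f using AddMonoidAlgebra.induction_linear with
  | zero => simp
  | add f g hf hg => rw [map_add, map_add, map_add, hf, hg]
  | single m r =>
    rw [cocharPullback_single, laurentEval_single, torusChar_cochar_mul,
      LaurentPolynomial.single_eq_C_mul_T, LaurentPolynomial.eval₂_C_mul_T]
    simp
    ring

/-- The coefficients of the pullback collect the monomials with the same pairing with `v`. -/
theorem coeff_cocharPullback {n : ℕ} (v : Fin n → ℤ) (ξ : Fin n → ℝˣ) (k : ℤ) (f : TorusRing n) :
    (cocharPullback v ξ f).coeff k =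
      laurentEval ξ (AddMonoidAlgebra.ofCoeff (f.coeff.filter fun m => m ⬝ᵥ v = k)) := by
  induction f using AddMonoidAlgebra.induction_linear with
  | zero =>
    rw [map_zero, AddMonoidAlgebra.coeff_zero, AddMonoidAlgebra.coeff_zero, Finsupp.filter_zero]
    exact (map_zero (laurentEval ξ)).symm
  | add f g hf hg =>
    rw [map_add, AddMonoidAlgebra.coeff_add, AddMonoidAlgebra.coeff_add, Finsupp.add_apply, hf, hg,
      ← map_add, Finsupp.filter_add]
    rfl
  | single m r =>
    rw [cocharPullback_single, AddMonoidAlgebra.coeff_single, AddMonoidAlgebra.coeff_single]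
    by_cases h : m ⬝ᵥ v = k
    · rw [Finsupp.filter_single_of_pos (fun m : Fin n → ℤ => m ⬝ᵥ v = k) h, h,
        Finsupp.single_eq_same]
      exact (laurentEval_single ξ m r).symm
    · rw [Finsupp.filter_single_of_neg (fun m : Fin n → ℤ => m ⬝ᵥ v = k) h,
        Finsupp.single_eq_of_ne (Ne.symm h)]
      exact (map_zero (laurentEval ξ)).symm

/-- A Laurent polynomial whose pullbacks along `s ↦ λ_v(s) ξ` are polynomials, for `ξ` in a nonempty
open set, has only monomials that are nonnegative on `v`. -/
theorem dotProduct_nonneg_of_cocharPullback {n : ℕ} {U : Set (Fin n → ℝˣ)} (hU : IsOpen U)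
    (hne : U.Nonempty) {v : Fin n → ℤ} {f : TorusRing n}
    (h : ∀ ξ ∈ U, ∃ p : Polynomial ℝ, Polynomial.toLaurent p = cocharPullback v ξ f)
    {m : Fin n → ℤ} (hm : f.coeff m ≠ 0) : 0 ≤ m ⬝ᵥ v := by
  by_contra! hneg
  have h0 : (AddMonoidAlgebra.ofCoeff (f.coeff.filter fun m' => m' ⬝ᵥ v = m ⬝ᵥ v) : TorusRing n) =
      0 := by
    refine eq_zero_of_laurentEval_eq_zero hU hne fun ξ hξ => ?_
    obtain ⟨p, hp⟩ := h ξ hξ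
    rw [← coeff_cocharPullback, ← hp, Polynomial.toLaurent_apply,
      AddMonoidAlgebra.coeff_mapDomain]
    refine Finsupp.mapDomain_of_notMem_range _ _ ?_
    rintro ⟨k, hk⟩
    have : (k : ℤ) = m ⬝ᵥ v := hk
    omega
  have h1 : (f.coeff.filter fun m' => m' ⬝ᵥ v = m ⬝ᵥ v) m = 0 :=
    congrArg (fun g : TorusRing n => g.coeff m) h0
  rw [Finsupp.filter_apply_pos (fun m' : Fin n → ℤ => m' ⬝ᵥ v = m ⬝ᵥ v) _ rfl] at h1
  exact hm h1

/-- `ℝ[T]` is integrally closed in `ℝ[T;T⁻¹]`. -/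
theorem exists_polynomial_of_isIntegral {q : ℝ[T;T⁻¹]} (hq : IsIntegral (Polynomial ℝ) q) :
    ∃ p : Polynomial ℝ, Polynomial.toLaurent p = q := by
  have hu : ∀ y : Submonoid.powers (Polynomial.X : Polynomial ℝ),
      IsUnit (algebraMap (Polynomial ℝ) (FractionRing (Polynomial ℝ)) y) := by
    rintro ⟨_, k, rfl⟩
    refine IsUnit.mk0 _ ?_
    simp
  let φ : ℝ[T;T⁻¹] →+* FractionRing (Polynomial ℝ) := IsLocalization.lift hu
  have hφ : ∀ p : Polynomial ℝ, φ (Polynomial.toLaurent p) = algebraMap _ _ p := fun p =>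
    IsLocalization.lift_eq hu p
  have hinj : Function.Injective φ := by
    refine (IsLocalization.lift_injective_iff hu).2 fun x y => ?_
    rw [(IsFractionRing.injective (Polynomial ℝ) (FractionRing (Polynomial ℝ))).eq_iff]
    exact Polynomial.toLaurent_injective.eq_iff
  have h1 : IsIntegral (Polynomial ℝ) (φ q) := by
    obtain ⟨P, hP, hPq⟩ := hq
    refine ⟨P, hP, ?_⟩
    have h2 := congrArg φ hPq
    rw [map_zero, Polynomial.hom_eval₂] at h2
    rw [← h2]
    congr 1
    exact RingHom.ext fun p => (hφ p).symm
  obtain ⟨p, hp⟩ := IsIntegrallyClosed.isIntegral_iff.1 h1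
  exact ⟨p, hinj (by rw [hφ, hp])⟩

theorem X_pow_dvd_of_bound (k : ℕ) : ∀ (p : Polynomial ℝ) (c : ℝ),
    (∀ᶠ s in 𝓝[>] (0 : ℝ), |p.eval s| ≤ c * s ^ k) → Polynomial.X ^ k ∣ p := by
  induction k with
  | zero => intro p c _; simp
  | succ k ih =>
    intro p c h
    have h0 : p.eval 0 = 0 := by
      have h1 : Tendsto (fun s => |p.eval s|) (𝓝[>] (0 : ℝ)) (𝓝 |p.eval 0|) :=
        ((p.continuous.abs).tendsto 0).mono_left nhdsWithin_le_nhds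
      have h2 : Tendsto (fun s : ℝ => c * s ^ (k + 1)) (𝓝[>] (0 : ℝ)) (𝓝 0) := by
        have : Continuous fun s : ℝ => c * s ^ (k + 1) := by fun_prop
        have := (this.tendsto 0).mono_left (nhdsWithin_le_nhds (s := Set.Ioi 0))
        simpa using this
      exact abs_nonpos_iff.1 (le_of_tendsto_of_tendsto h1 h2 h)
    obtain ⟨q, rfl⟩ : Polynomial.X ∣ p := by
      rwa [Polynomial.X_dvd_iff, Polynomial.coeff_zero_eq_eval_zero]
    rw [pow_succ']
    refine mul_dvd_mul_left _ (ih q c ?_)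
    filter_upwards [h, self_mem_nhdsWithin] with s hs hs0
    have hs0' : 0 < s := hs0
    rw [Polynomial.eval_mul, Polynomial.eval_X, abs_mul, abs_of_pos hs0', pow_succ'] at hs
    refine le_of_mul_le_mul_left ?_ hs0'
    linarith

/-- A Laurent polynomial in one variable that stays bounded near `0` is a polynomial. -/
theorem exists_polynomial_of_bound {q : ℝ[T;T⁻¹]} {c ε : ℝ} (hε : 0 < ε)
    (h : ∀ s : ℝˣ, 0 < (s : ℝ) → (s : ℝ) < ε →
      |LaurentPolynomial.eval₂ (RingHom.id ℝ) s q| ≤ c) :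
    ∃ p : Polynomial ℝ, Polynomial.toLaurent p = q := by
  obtain ⟨k, p, hp⟩ := LaurentPolynomial.exists_T_pow q
  have h1 : Polynomial.X ^ k ∣ p := by
    refine X_pow_dvd_of_bound k p c ?_
    filter_upwards [Ioo_mem_nhdsGT hε] with s hs
    have h2 := congrArg (LaurentPolynomial.eval₂ (RingHom.id ℝ) (Units.mk0 s hs.1.ne')) hp
    rw [map_mul, LaurentPolynomial.eval₂_toLaurent, LaurentPolynomial.eval₂_T_n] at h2
    simp only [Units.val_mk0] at h2
    rw [Polynomial.eval, h2, abs_mul, abs_of_pos (pow_pos hs.1 k)]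
    exact mul_le_mul_of_nonneg_right (h (Units.mk0 s hs.1.ne') hs.1 hs.2) (pow_pos hs.1 k).le
  obtain ⟨p', rfl⟩ := h1
  refine ⟨p', ?_⟩
  rw [map_mul, Polynomial.toLaurent_X_pow, mul_comm] at hp
  exact (LaurentPolynomial.isUnit_T (k : ℤ)).mul_right_cancel hp

/-- Laurent polynomials that are integral over `ℝ[M ∩ A^*]` belong to it: pull back along
one-parameter subgroups, and use that `ℝ[s]` is integrally closed. -/
theorem HasFiniteDual.exists_of_isIntegralElem {n : ℕ} {A : Set (Fin n → ℝ)} (h : HasFiniteDual A)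
    {f : TorusRing n} (hf : (CoordRing.toTorus A).toRingHom.IsIntegralElem f) :
    ∃ g, CoordRing.toTorus A g = f := by
  obtain ⟨G, hG⟩ := h
  rw [CoordRing.mem_range_toTorus]
  intro m hm
  rw [hG]
  intro v hv
  refine dotProduct_nonneg_of_cocharPullback isOpen_univ ⟨1, trivial⟩ (fun ξ _ => ?_) hm
  have hnn : ∀ a : latticeDual A, 0 ≤ (a : Fin n → ℤ) ⬝ᵥ v := fun a => (hG a).1 a.2 v hv
  let ψ : CoordRing A →ₐ[ℝ] Polynomial ℝ := AddMonoidAlgebra.lift ℝ _ _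
    { toFun := fun a => Polynomial.monomial ((a.toAdd : latticeDual A) ⬝ᵥ v).toNat
        (torusChar ξ (a.toAdd : latticeDual A) : ℝ)
      map_one' := by simp [torusChar_zero]
      map_mul' := fun a b => by
        rw [Polynomial.monomial_mul_monomial, ← Int.toNat_add (hnn _) (hnn _)]
        simp [torusChar_add, add_dotProduct] }
  have hψ : ∀ x, Polynomial.toLaurent (ψ x) = cocharPullback v ξ (CoordRing.toTorus A x) := by
    intro x
    induction x using AddMonoidAlgebra.induction_linear with
    | zero => simp
    | add f g hf hg => rw [map_add, map_add, map_add, map_add, hf, hg]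
    | single a r =>
      rw [CoordRing.toTorus_single, cocharPullback_single]
      simp only [ψ, AddMonoidAlgebra.lift_single, MonoidHom.coe_mk, OneHom.coe_mk, toAdd_ofAdd,
        Polynomial.smul_monomial, smul_eq_mul]
      rw [← Polynomial.C_mul_X_pow_eq_monomial, Polynomial.toLaurent_C_mul_X_pow,
        ← LaurentPolynomial.single_eq_C_mul_T, Int.toNat_of_nonneg (hnn a)]
  refine exists_polynomial_of_isIntegral ?_
  obtain ⟨P, hP, hPf⟩ := hf
  refine ⟨P.map ψ.toRingHom, hP.map _, ?_⟩
  have h2 := congrArg (cocharPullback v ξ) hPf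
  rw [map_zero] at h2
  rw [Polynomial.eval₂_map, ← h2]
  refine Eq.trans ?_ (Polynomial.hom_eval₂ P _ (cocharPullback v ξ).toRingHom f).symm
  congr 1
  exact RingHom.ext fun x => hψ x

/-- `U_A` is normal: `ℝ[M]` is integrally closed, and `ℝ[M ∩ A^*]` is integrally closed in it. -/
theorem HasFiniteDual.isIntegrallyClosed {n : ℕ} {A : Set (Fin n → ℝ)} (h : HasFiniteDual A) :
    IsIntegrallyClosed (CoordRing A) := by
  let K := FractionRing (CoordRing A)
  let L := FractionRing (TorusRing n)
  have hι : Function.Injective ((algebraMap (TorusRing n) L).comp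
      (CoordRing.toTorus A).toRingHom) :=
    (IsFractionRing.injective (TorusRing n) L).comp (CoordRing.toTorus_injective A)
  let φ : K →+* L := IsFractionRing.lift hι
  have hφ : ∀ x, φ (algebraMap (CoordRing A) K x) =
      algebraMap (TorusRing n) L (CoordRing.toTorus A x) :=
    fun x => IsFractionRing.lift_algebraMap hι x
  refine (isIntegrallyClosed_iff K).2 fun {x} hx => ?_
  obtain ⟨P, hP, hPx⟩ := hx
  have h1 := congrArg φ hPx
  rw [map_zero, Polynomial.hom_eval₂] at h1
  have h2 : IsIntegral (TorusRing n) (φ x) := by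
    refine ⟨P.map (CoordRing.toTorus A).toRingHom, hP.map _, ?_⟩
    rw [Polynomial.eval₂_map, ← h1]
    congr 1
    exact RingHom.ext fun y => (hφ y).symm
  obtain ⟨f, hf⟩ := IsIntegrallyClosed.isIntegral_iff.1 h2
  obtain ⟨g, hg⟩ := h.exists_of_isIntegralElem (f := f) ⟨P, hP, by
    apply IsFractionRing.injective (TorusRing n) L
    rw [map_zero, ← h1, Polynomial.hom_eval₂, hf]
    congr 1
    exact RingHom.ext fun y => (hφ y).symm⟩
  refine ⟨g, φ.injective ?_⟩
  rw [hφ, hg, hf]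

/-! ### The toric variety: charts, integrality and normality -/

namespace Fan

variable {n : ℕ} (F : Fan n)

instance (σ : F.cones) : IsOpenImmersion (F.ι σ) :=
  inferInstanceAs (IsOpenImmersion (colimit.ι F.diagram σ))

/-- The covering of `X_F` by the affine toric varieties `U_σ`. -/
noncomputable def openCover : F.toricVariety.OpenCover :=
  Scheme.IsLocallyDirected.openCover F.diagram

theorem exists_ι_eq (x : F.toricVariety) :
    ∃ (σ : F.cones) (y : affineToric (σ.1 : Set (Fin n → ℝ))),
    F.ι σ y = x :=
  let ⟨i, y, h⟩ := F.openCover.exists_eq x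
  ⟨i, y, h⟩

theorem map_ι {σ τ : F.cones} (h : (σ.1 : Set (Fin n → ℝ)) ⊆ τ.1) :
    affineToricMap h ≫ F.ι τ = F.ι σ :=
  colimit.w F.diagram (homOfLE h : σ ⟶ τ)

theorem map_ι_apply {σ τ : F.cones} (h : (σ.1 : Set (Fin n → ℝ)) ⊆ τ.1)
    (x : affineToric (σ.1 : Set (Fin n → ℝ))) : F.ι τ (affineToricMap h x) = F.ι σ x := by
  rw [← Scheme.Hom.comp_apply, map_ι]

/-- Points of two charts that are glued come from a point of a smaller chart. -/
theorem exists_of_ι_eq_ι {σ τ : F.cones} {x : affineToric (σ.1 : Set (Fin n → ℝ))}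
    {y : affineToric (τ.1 : Set (Fin n → ℝ))} (h : F.ι σ x = F.ι τ y) :
    ∃ (ρ : F.cones) (h₁ : (ρ.1 : Set (Fin n → ℝ)) ⊆ σ.1) (h₂ : (ρ.1 : Set (Fin n → ℝ)) ⊆ τ.1)
      (z : affineToric (ρ.1 : Set (Fin n → ℝ))),
      affineToricMap h₁ z = x ∧ affineToricMap h₂ z = y := by
  obtain ⟨ρ, f, g, z, h1, h2⟩ := (Scheme.IsLocallyDirected.ι_eq_ι_iff F.diagram).1 h
  exact ⟨ρ, leOfHom f, leOfHom g, z, h1, h2⟩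

/-- The trivial cone of a fan. -/
def zeroCone : F.cones := ⟨⊥, F.bot_mem⟩

theorem zeroCone_subset (σ : F.cones) : ((F.zeroCone).1 : Set (Fin n → ℝ)) ⊆ σ.1 :=
  SetLike.coe_subset_coe.2 bot_le

end Fan

/-- The generic point of `U_A`. -/
noncomputable def affineGenericPoint {n : ℕ} (A : Set (Fin n → ℝ)) : affineToric A :=
  (⟨⊥, Ideal.isPrime_bot⟩ : PrimeSpectrum (CoordRing A))

theorem affineToricMap_genericPoint {n : ℕ} {A B : Set (Fin n → ℝ)} (h : A ⊆ B) :
    affineToricMap h (affineGenericPoint A) = affineGenericPoint B := by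
  refine PrimeSpectrum.ext ?_
  change Ideal.comap (CoordRing.incl h).toRingHom ⊥ = ⊥
  rw [← RingHom.ker_eq_comap_bot]
  exact (RingHom.injective_iff_ker_eq_bot _).1 (CoordRing.incl_injective h)

theorem specializes_of_asIdeal_le {R : Type} [CommRing R] {x y : PrimeSpectrum R}
    (h : x.asIdeal ≤ y.asIdeal) : (x : Spec (CommRingCat.of R)) ⤳ (y : Spec (CommRingCat.of R)) :=
  (PrimeSpectrum.le_iff_specializes x y).1 h

namespace Fan

variable {n : ℕ} (F : Fan n)

/-- The generic point of the torus is the generic point of `X_F`. -/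
theorem specializes_genericPoint (x : F.toricVariety) :
    F.ι F.zeroCone (affineGenericPoint _) ⤳ x := by
  obtain ⟨σ, y, rfl⟩ := F.exists_ι_eq x
  rw [← F.map_ι_apply (F.zeroCone_subset σ), affineToricMap_genericPoint]
  exact (specializes_of_asIdeal_le bot_le).map (F.ι σ).continuous

instance : IsIntegral F.toricVariety := by
  have h1 : IrreducibleSpace F.toricVariety := by
    have h2 : closure {F.ι F.zeroCone (affineGenericPoint _)} =
        (Set.univ : Set F.toricVariety) :=
      Set.eq_univ_of_forall fun x => (F.specializes_genericPoint x).mem_closure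
    have h3 : IsIrreducible (Set.univ : Set F.toricVariety) := h2 ▸ isIrreducible_singleton.closure
    exact (irreducibleSpace_def _).2 h3
  have h2 : IsReduced F.toricVariety := by
    have : ∀ i, IsReduced (F.openCover.X i) := fun i =>
      inferInstanceAs (IsReduced (affineToric (i.1 : Set (Fin n → ℝ))))
    exact @IsReduced.of_openCover _ F.openCover this
  exact isIntegral_of_irreducibleSpace_of_isReduced _

instance (σ : F.cones) : IsDominant (F.ι σ) := by
  refine ⟨fun x => ?_⟩
  refine closure_mono ?_ (F.specializes_genericPoint x).mem_closure
  rw [Set.singleton_subset_iff, ← F.map_ι_apply (F.zeroCone_subset σ)]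
  exact ⟨_, rfl⟩

end Fan

theorem isIntegrallyClosed_stalk_structureSheaf {R : Type} [CommRing R] [IsDomain R]
    [IsIntegrallyClosed R] (x : PrimeSpectrum R) :
    IsIntegrallyClosed ((Spec.structureSheaf R).presheaf.stalk x) :=
  isIntegrallyClosed_of_isLocalization _ x.asIdeal.primeCompl
    (Ideal.primeCompl_le_nonZeroDivisors _)

theorem isIntegrallyClosed_stalk_Spec {R : Type} [CommRing R] [IsDomain R] [IsIntegrallyClosed R]
    (x : Spec (CommRingCat.of R)) :
    IsIntegrallyClosed ((Spec (CommRingCat.of R)).presheaf.stalk x) :=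
  isIntegrallyClosed_stalk_structureSheaf (R := R) x

theorem isIntegrallyClosed_stalk_of_isOpenImmersion {X Y : Scheme.{0}} (f : X ⟶ Y)
    [IsOpenImmersion f] (x : X) [IsIntegrallyClosed (X.presheaf.stalk x)] :
    IsIntegrallyClosed (Y.presheaf.stalk (f x)) :=
  IsIntegrallyClosed.of_equiv (asIso (f.stalkMap x)).symm.commRingCatIsoToRingEquiv

theorem HasFiniteDual.locallyOfFiniteType {n : ℕ} {A : Set (Fin n → ℝ)} (h : HasFiniteDual A) :
    LocallyOfFiniteType (affineToricStr A) := by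
  refine (HasRingHomProperty.Spec_iff (P := @LocallyOfFiniteType)).2 ?_
  exact (RingHom.finiteType_algebraMap (A := ℝ) (B := CoordRing A)).2 h.finiteType

theorem HasFiniteDual.isNormalVariety {n : ℕ} {A : Set (Fin n → ℝ)} (h : HasFiniteDual A) :
    IsNormalVariety (affineToricStr A) where
  integral := inferInstance
  separated := inferInstance
  finiteType := h.locallyOfFiniteType
  quasiCompact := inferInstance
  normal x := by
    have := h.isIntegrallyClosed
    exact isIntegrallyClosed_stalk_Spec x

namespace Fan

variable {n : ℕ} (F : Fan n)

theorem isIntegrallyClosed_stalk (x : F.toricVariety) :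
    IsIntegrallyClosed (F.toricVariety.presheaf.stalk x) := by
  obtain ⟨σ, y, rfl⟩ := F.exists_ι_eq x
  have := (F.rational _ σ.2).hasFiniteDual.isNormalVariety.normal y
  exact isIntegrallyClosed_stalk_of_isOpenImmersion (F.ι σ) y

instance : LocallyOfFiniteType F.str := by
  have : IsZariskiLocalAtSource (@LocallyOfFiniteType.{0}) :=
    HasRingHomProperty.instIsZariskiLocalAtSource
  refine IsZariskiLocalAtSource.of_openCover (P := @LocallyOfFiniteType.{0}) F.openCover fun σ => ?_
  have h := (F.rational _ σ.2).hasFiniteDual.locallyOfFiniteType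
  rw [← F.ι_str σ] at h
  exact h

instance : IsLocallyNoetherian F.toricVariety := LocallyOfFiniteType.isLocallyNoetherian F.str

instance : CompactSpace F.toricVariety := by
  have : Finite F.cones := F.finite
  refine ⟨?_⟩
  have h : (Set.univ : Set F.toricVariety) = ⋃ σ : F.cones, Set.range (F.ι σ) :=
    (Set.eq_univ_of_forall fun x => by
      obtain ⟨σ, y, rfl⟩ := F.exists_ι_eq x
      exact Set.mem_iUnion.2 ⟨σ, y, rfl⟩).symm
  rw [h]
  exact isCompact_iUnion fun σ => isCompact_range (F.ι σ).continuous

instance : QuasiCompact F.str := inferInstance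

instance : QuasiSeparated F.str := inferInstance

end Fan

/-- A morphism from the spectrum of a local ring factors through any affine chart that contains the
image of the closed point. -/
theorem exists_factor_of_closedPoint {X : Scheme.{0}} {A R : Type} [CommRing A] [CommRing R]
    [IsLocalRing R] (j : Spec (CommRingCat.of A) ⟶ X) [IsOpenImmersion j]
    (l : Spec (CommRingCat.of R) ⟶ X) (h : l (IsLocalRing.closedPoint R) ∈ Set.range j) :
    ∃ ψ : A →+* R, Spec.map (CommRingCat.ofHom ψ) ≫ j = l := by
  have hr : Set.range l ⊆ Set.range j := by
    rintro _ ⟨x, rfl⟩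
    exact ((IsLocalRing.specializes_closedPoint x).map l.continuous).mem_open
      j.isOpenEmbedding.isOpen_range h
  obtain ⟨ψ, hψ⟩ := Spec.map_surjective (IsOpenImmersion.lift j l hr)
  refine ⟨ψ.hom, ?_⟩
  rw [CommRingCat.ofHom_hom, hψ, IsOpenImmersion.lift_fac]

theorem Spec_map_ofHom_injective {A B : Type} [CommRing A] [CommRing B] {f g : A →+* B}
    (h : Spec.map (CommRingCat.ofHom f) = Spec.map (CommRingCat.ofHom g)) : f = g :=
  congrArg CommRingCat.Hom.hom (Spec.map_injective h)

/-- A homomorphism from `ℝ[M ∩ A^*]` takes values in a subring once characters and constants do. -/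
theorem CoordRing.exists_lift {n : ℕ} {A : Set (Fin n → ℝ)} {R K : Type*} [CommRing R] [CommRing K]
    {i : R →+* K} (hi : Function.Injective i) (φ : CoordRing A →+* K)
    (hc : ∀ m : latticeDual A, φ (AddMonoidAlgebra.single m 1) ∈ Set.range i)
    (hr : ∀ r : ℝ, φ (algebraMap ℝ _ r) ∈ Set.range i) :
    ∃ ψ : CoordRing A →+* R, i.comp ψ = φ := by
  have h : ∀ f, φ f ∈ i.range := by
    intro f
    induction f using AddMonoidAlgebra.induction_linear with
    | zero => rw [map_zero]; exact zero_mem _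
    | add f g hf hg => rw [map_add]; exact add_mem hf hg
    | single m r =>
      have e : (AddMonoidAlgebra.single m r : CoordRing A) =
          algebraMap ℝ _ r * AddMonoidAlgebra.single m 1 := by
        rw [← Algebra.smul_def, AddMonoidAlgebra.smul_single, smul_eq_mul, mul_one]
      rw [e, map_mul]
      exact mul_mem (hr r) (hc m)
  let e := RingEquiv.ofBijective i.rangeRestrict
    ⟨fun a b hab => hi (congrArg Subtype.val hab), i.rangeRestrict_surjective⟩
  refine ⟨e.symm.toRingHom.comp (φ.codRestrict i.range h), RingHom.ext fun f => ?_⟩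
  have : i.rangeRestrict (e.symm (φ.codRestrict i.range h f)) = φ.codRestrict i.range h f :=
    e.apply_symm_apply _
  exact congrArg Subtype.val this

theorem CoordRing.single_mul {n : ℕ} {A : Set (Fin n → ℝ)} (m m' : latticeDual A) :
    (AddMonoidAlgebra.single (m + m') 1 : CoordRing A) =
      AddMonoidAlgebra.single m 1 * AddMonoidAlgebra.single m' 1 := by
  rw [AddMonoidAlgebra.single_mul_single, one_mul]

/-! ### Separatedness and properness -/

/-- The closed point of the spectrum of a local ring, as a point of a scheme. -/
noncomputable def specClosedPoint (R : Type) [CommRing R] [IsLocalRing R] :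
    Spec (CommRingCat.of R) :=
  IsLocalRing.closedPoint R

namespace Fan

variable {n : ℕ} (F : Fan n)

theorem exists_chart {R : Type} [CommRing R] [IsLocalRing R]
    (l : Spec (CommRingCat.of R) ⟶ F.toricVariety) :
    ∃ (σ : F.cones) (ψ : CoordRing (σ.1 : Set (Fin n → ℝ)) →+* R),
      Spec.map (CommRingCat.ofHom ψ) ≫ F.ι σ = l := by
  obtain ⟨σ, y, hy⟩ := F.exists_ι_eq (l (specClosedPoint R))
  obtain ⟨ψ, hψ⟩ := exists_factor_of_closedPoint (F.ι σ) l ⟨y, hy⟩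
  exact ⟨σ, ψ, hψ⟩

theorem map_incl_ι {R : Type} [CommRing R] {σ τ : F.cones} (h : (σ.1 : Set (Fin n → ℝ)) ⊆ τ.1)
    (ψ : CoordRing (σ.1 : Set (Fin n → ℝ)) →+* R) :
    Spec.map (CommRingCat.ofHom (ψ.comp (CoordRing.incl h).toRingHom)) ≫ F.ι τ =
      Spec.map (CommRingCat.ofHom ψ) ≫ F.ι σ := by
  rw [CommRingCat.ofHom_comp, Spec.map_comp, Category.assoc]
  congr 1
  exact F.map_ι h

/-- A point with values in a field lies in the orbit of some cone: all characters of the cone that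
are not invertible vanish at it. -/
theorem exists_orbit_chart {K : Type} [Field K] (i : Spec (CommRingCat.of K) ⟶ F.toricVariety) :
    ∃ (σ : F.cones) (φ : CoordRing (σ.1 : Set (Fin n → ℝ)) →+* K),
      Spec.map (CommRingCat.ofHom φ) ≫ F.ι σ = i ∧
      ∀ m : latticeDual (σ.1 : Set (Fin n → ℝ)),
        -(m : Fin n → ℤ) ∉ latticeDual (σ.1 : Set (Fin n → ℝ)) →
        φ (AddMonoidAlgebra.single m 1) = 0 := by
  have : Finite F.cones := F.finite
  -- Take a minimal chart that contains the point.
  obtain ⟨σ, hσ⟩ := exists_minimal_of_wellFoundedLT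
    (fun σ : F.cones => i (specClosedPoint K) ∈ Set.range (F.ι σ))
    (let ⟨σ, y, hy⟩ := F.exists_ι_eq (i (specClosedPoint K)); ⟨σ, y, hy⟩)
  obtain ⟨φ, hφ⟩ := exists_factor_of_closedPoint (F.ι σ) i hσ.1
  refine ⟨σ, φ, hφ, fun m hm => ?_⟩
  by_contra hne
  obtain ⟨τ, hτ⟩ := exists_cone_of_pairing_eq_zero σ.1 (m : Fin n → ℤ)
  have hface : IsFace τ σ.1 := ⟨intCast m, fun x hx => m.2 x hx, hτ⟩
  have hle : (τ : Set (Fin n → ℝ)) ⊆ σ.1 := hface.le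
  let τ' : F.cones := ⟨τ, F.face_mem _ σ.2 τ hface⟩
  obtain ⟨y, hy⟩ := (affineToricMap_range (F.rational _ σ.2) m.2 hτ hle
    (Spec.map (CommRingCat.ofHom φ) (specClosedPoint K))).2 (by
      change ¬ (φ _ ∈ (IsLocalRing.maximalIdeal K))
      rwa [IsLocalRing.maximalIdeal_eq_bot, Ideal.mem_bot])
  have h1 : F.ι τ' y = i (specClosedPoint K) := by
    rw [← F.map_ι_apply (σ := τ') (τ := σ) hle, hy, ← Scheme.Hom.comp_apply, hφ]
  have h2 : σ.1 ≤ τ := hσ.2 (y := τ') ⟨y, h1⟩ hle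
  refine hm fun x hx => ?_
  rw [pairing_neg, ((hτ x).1 (h2 hx)).2, neg_zero]

/-- Two integral extensions of a `K`-valued point, in the charts of `σ₁` and `σ₂`, agree: by the
separation lemma, the coordinate ring of `σ₁ ∩ σ₂` is generated by those of `σ₁` and `σ₂`, so that
both factor through the chart of `σ₁ ∩ σ₂`. -/
theorem valuativeCriterion_uniqueness : ValuativeCriterion.Uniqueness F.str := by
  rintro ⟨R, K, i₁, i₂, hsq⟩
  refine ⟨?_⟩
  rintro ⟨l₁, h₁, -⟩ ⟨l₂, h₂, -⟩
  ext : 1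
  dsimp at *
  obtain ⟨σ₁, ψ₁, rfl⟩ := F.exists_chart l₁
  obtain ⟨σ₂, ψ₂, rfl⟩ := F.exists_chart l₂
  have hinj : Function.Injective (algebraMap R K) := IsFractionRing.injective R K
  have e₁ : Spec.map (CommRingCat.ofHom ((algebraMap R K).comp ψ₁)) ≫ F.ι σ₁ = i₁ := by
    rw [CommRingCat.ofHom_comp, Spec.map_comp, Category.assoc, h₁]
  have e₂ : Spec.map (CommRingCat.ofHom ((algebraMap R K).comp ψ₂)) ≫ F.ι σ₂ = i₁ := by
    rw [CommRingCat.ofHom_comp, Spec.map_comp, Category.assoc, h₂]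
  -- The generic point lies in the chart of the common face.
  obtain ⟨ρ, hρ₁, hρ₂, z, hz, -⟩ := F.exists_of_ι_eq_ι (σ := σ₁) (τ := σ₂)
    (x := Spec.map (CommRingCat.ofHom ((algebraMap R K).comp ψ₁)) (specClosedPoint K))
    (y := Spec.map (CommRingCat.ofHom ((algebraMap R K).comp ψ₂)) (specClosedPoint K)) (by
      rw [← Scheme.Hom.comp_apply, ← Scheme.Hom.comp_apply, e₁, e₂])
  obtain ⟨hf₁, hf₂⟩ := F.inter_face _ σ₁.2 _ σ₂.2
  let τ : F.cones := ⟨σ₁.1 ⊓ σ₂.1, F.face_mem _ σ₁.2 _ hf₁⟩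
  have hτ₁ : (τ.1 : Set (Fin n → ℝ)) ⊆ σ₁.1 := hf₁.le
  have hτ₂ : (τ.1 : Set (Fin n → ℝ)) ⊆ σ₂.1 := hf₂.le
  have hρτ : (ρ.1 : Set (Fin n → ℝ)) ⊆ τ.1 := fun x hx => ⟨hρ₁ hx, hρ₂ hx⟩
  obtain ⟨χ, hχ⟩ := exists_factor_of_closedPoint (F.ι τ) i₁ ⟨affineToricMap hρτ z, by
    rw [F.map_ι_apply, ← F.map_ι_apply hρ₁, hz, ← Scheme.Hom.comp_apply, e₁]
    rfl⟩
  have c₁ : χ.comp (CoordRing.incl hτ₁).toRingHom = (algebraMap R K).comp ψ₁ :=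
    Spec_map_ofHom_injective ((cancel_mono (F.ι σ₁)).1 (by rw [F.map_incl_ι, hχ, e₁]))
  have c₂ : χ.comp (CoordRing.incl hτ₂).toRingHom = (algebraMap R K).comp ψ₂ :=
    Spec_map_ofHom_injective ((cancel_mono (F.ι σ₂)).1 (by rw [F.map_incl_ι, hχ, e₂]))
  have d₁ : ∀ f, χ (CoordRing.incl hτ₁ f) = algebraMap R K (ψ₁ f) := fun f => RingHom.congr_fun c₁ f
  have d₂ : ∀ f, χ (CoordRing.incl hτ₂ f) = algebraMap R K (ψ₂ f) := fun f => RingHom.congr_fun c₂ f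
  obtain ⟨m, hm₁, hm₂, hmτ⟩ :=
    exists_separating_character (F.rational _ σ₁.2) (F.rational _ σ₂.2) hf₁
  obtain ⟨-, hw⟩ := latticeDual_face (τ := τ.1) (F.rational _ σ₁.2) hm₁ hmτ
  obtain ⟨χ', hχ'⟩ := CoordRing.exists_lift hinj χ (fun w => by
      obtain ⟨k, hk⟩ := hw w w.2
      refine ⟨ψ₁ (AddMonoidAlgebra.single ⟨_, hk⟩ 1) *
        ψ₂ (AddMonoidAlgebra.single ⟨-m, hm₂⟩ 1) ^ k, ?_⟩
      rw [map_mul, map_pow, ← d₁, ← d₂, ← map_pow, ← map_mul, CoordRing.incl_single,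
        CoordRing.incl_single, AddMonoidAlgebra.single_pow, AddMonoidAlgebra.single_mul_single]
      congr 2
      · ext i
        simp
      · simp) (fun r => ⟨ψ₁ (algebraMap ℝ _ r), by
        rw [← d₁, AlgHom.commutes]⟩)
  have g₁ : χ'.comp (CoordRing.incl hτ₁).toRingHom = ψ₁ := by
    refine RingHom.ext fun f => hinj ?_
    rw [← d₁, ← hχ']
    rfl
  have g₂ : χ'.comp (CoordRing.incl hτ₂).toRingHom = ψ₂ := by
    refine RingHom.ext fun f => hinj ?_
    rw [← d₂, ← hχ']
    rfl
  rw [← g₁, ← g₂, F.map_incl_ι, F.map_incl_ι]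

/-- The key step of the valuative criterion for properness: a homomorphism from `ℝ[H_ρ₀]` to the
fraction field of a valuation ring `R` that kills the noninvertible characters restricts, on the
coordinate ring of a suitable larger cone, to one with values in `R`. -/
theorem exists_integral_extension (hF : F.IsComplete) {R K : Type} [CommRing R] [IsDomain R]
    [ValuationRing R] [Field K] [Algebra R K] [IsFractionRing R K] (ρ₀ : F.cones)
    (φ : CoordRing (ρ₀.1 : Set (Fin n → ℝ)) →+* K) (r : ℝ →+* R)
    (hr : ∀ s, φ (algebraMap ℝ _ s) = algebraMap R K (r s))
    (hφ0 : ∀ m : latticeDual (ρ₀.1 : Set (Fin n → ℝ)),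
        -(m : Fin n → ℤ) ∉ latticeDual (ρ₀.1 : Set (Fin n → ℝ)) →
        φ (AddMonoidAlgebra.single m 1) = 0) :
    ∃ (ρ : F.cones) (hsub : (ρ₀.1 : Set (Fin n → ℝ)) ⊆ ρ.1)
      (ψ : CoordRing (ρ.1 : Set (Fin n → ℝ)) →+* R),
      (algebraMap R K).comp ψ = φ.comp (CoordRing.incl hsub).toRingHom ∧
      ψ.comp (algebraMap ℝ _) = r := by
  have hinj : Function.Injective (algebraMap R K) := IsFractionRing.injective R K
  -- `P` is total on the characters vanishing on `ρ₀`, because `R` is a valuation ring.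
  let P : AddSubmonoid (Fin n → ℤ) :=
    { carrier := {m | ∃ hm : m ∈ latticeDual (ρ₀.1 : Set (Fin n → ℝ)),
        φ (AddMonoidAlgebra.single ⟨m, hm⟩ 1) ∈ Set.range (algebraMap R K)}
      zero_mem' := ⟨zero_mem _, 1, by
        rw [map_one]
        exact (map_one φ).symm⟩
      add_mem' := by
        rintro a b ⟨ha, x, hx⟩ ⟨hb, y, hy⟩
        refine ⟨add_mem ha hb, x * y, ?_⟩
        rw [map_mul, hx, hy, ← map_mul, ← CoordRing.single_mul]
        rfl }
  obtain ⟨ρ', hρ', hle, hP⟩ := F.exists_cone_of_total hF ρ₀.2 P (by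
    intro m hm hm'
    have h1 : φ (AddMonoidAlgebra.single ⟨m, hm⟩ 1) *
        φ (AddMonoidAlgebra.single ⟨-m, hm'⟩ 1) = 1 := by
      rw [← map_mul, ← CoordRing.single_mul]
      convert map_one φ
      rw [AddMonoidAlgebra.one_def]
      congr 1
      ext i
      simp
    rcases ValuationRing.isInteger_or_isInteger R (φ (AddMonoidAlgebra.single ⟨m, hm⟩ 1)) with h | h
    · exact Or.inl ⟨hm, h⟩
    · refine Or.inr ⟨hm', ?_⟩
      rw [← eq_inv_of_mul_eq_one_right h1] at h
      exact h)
  have hsub : (ρ₀.1 : Set (Fin n → ℝ)) ⊆ ρ' := hle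
  have e : ∀ s, (CoordRing.incl hsub).toRingHom (algebraMap ℝ _ s) = algebraMap ℝ _ s :=
    fun s => (CoordRing.incl hsub).commutes s
  obtain ⟨ψ, hψ⟩ := CoordRing.exists_lift hinj (φ.comp (CoordRing.incl hsub).toRingHom) (fun m => by
      have e : (CoordRing.incl hsub).toRingHom (AddMonoidAlgebra.single m 1) =
        AddMonoidAlgebra.single ⟨m, latticeDual_anti hsub m.2⟩ 1 := CoordRing.incl_single hsub m 1
      rw [RingHom.comp_apply, e]
      by_cases hm : -(m : Fin n → ℤ) ∈ latticeDual (ρ₀.1 : Set (Fin n → ℝ))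
      · obtain ⟨_, h⟩ := hP m m.2 hm
        exact h
      · exact ⟨0, by rw [map_zero, hφ0 ⟨m, latticeDual_anti hsub m.2⟩ hm]⟩) (fun s =>
      ⟨r s, by rw [RingHom.comp_apply, e, hr]⟩)
  have hψr : ψ.comp (algebraMap ℝ (CoordRing (ρ' : Set (Fin n → ℝ)))) = r := by
    refine RingHom.ext fun s => hinj ?_
    have h1 := RingHom.congr_fun hψ (algebraMap ℝ (CoordRing (ρ' : Set (Fin n → ℝ))) s)
    rw [RingHom.comp_apply, RingHom.comp_apply, e, hr] at h1
    exact h1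
  exact ⟨⟨ρ', hρ'⟩, hsub, ψ, hψ, hψr⟩

theorem valuativeCriterion_existence (hF : F.IsComplete) : ValuativeCriterion.Existence F.str := by
  rintro ⟨R, K, i₁, i₂, hsq⟩
  dsimp at *
  obtain ⟨ρ₀, φ, rfl, hφ0⟩ := F.exists_orbit_chart i₁
  obtain ⟨r, rfl⟩ := Spec.map_surjective i₂
  have hr : φ.comp (algebraMap ℝ _) = (algebraMap R K).comp r.hom := by
    apply Spec_map_ofHom_injective
    have h := hsq.w
    rw [Category.assoc, F.ι_str] at h
    refine (Eq.trans ?_ h).trans ?_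
    · exact Spec.map_comp (CommRingCat.ofHom (algebraMap ℝ _)) (CommRingCat.ofHom φ)
    · exact (Spec.map_comp r (CommRingCat.ofHom (algebraMap R K))).symm
  obtain ⟨ρ, hsub, ψ, hψ, hψr⟩ := F.exists_integral_extension hF ρ₀ φ r.hom
    (fun s => RingHom.congr_fun hr s) hφ0
  have e₁ : Spec.map (CommRingCat.ofHom (algebraMap R K)) ≫ Spec.map (CommRingCat.ofHom ψ) ≫ F.ι ρ =
      Spec.map (CommRingCat.ofHom φ) ≫ F.ι ρ₀ := by
    rw [← Category.assoc, ← Spec.map_comp, ← CommRingCat.ofHom_comp, hψ, F.map_incl_ι]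
  have e₂ : (Spec.map (CommRingCat.ofHom ψ) ≫ F.ι ρ) ≫ F.str = Spec.map r := by
    rw [Category.assoc, F.ι_str, ← Spec.map_comp]
    exact congrArg (fun f => Spec.map (CommRingCat.ofHom f)) hψr
  exact ⟨⟨⟨Spec.map (CommRingCat.ofHom ψ) ≫ F.ι ρ, e₁, e₂⟩⟩⟩

theorem isSeparated : IsSeparated F.str :=
  IsSeparated.of_valuativeCriterion _ F.valuativeCriterion_uniqueness

theorem isProper (hF : F.IsComplete) : IsProper F.str := by
  have := F.isSeparated
  have := UniversallyClosed.of_valuativeCriterion F.str (F.valuativeCriterion_existence hF)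
  exact { }

theorem isNormalVariety : IsNormalVariety F.str where
  integral := inferInstance
  separated := F.isSeparated
  finiteType := inferInstance
  quasiCompact := inferInstance
  normal := F.isIntegrallyClosed_stalk

end Fan

/-! ### The Euclidean topology on real points -/

theorem eq_specClosedPoint (x : SpecR) : x = specClosedPoint ℝ :=
  Subsingleton.elim (α := PrimeSpectrum ℝ) _ _

/-- A real point factors through the open `U` if and only if its underlying point is in `U`. -/
theorem RealPoint.top_le_iff {X : Scheme.{0}} {f : X ⟶ SpecR} (p : RealPoint f) (U : X.Opens) :
    ⊤ ≤ p.1 ⁻¹ᵁ U ↔ p.pt ∈ U := by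
  refine ⟨fun h => h (x := specClosedPoint ℝ) trivial, fun h x _ => ?_⟩
  rw [eq_specClosedPoint x]
  exact h

/-- The value at a real point as a ring homomorphism. -/
noncomputable def RealPoint.valueHom {X : Scheme.{0}} {f : X ⟶ SpecR} (p : RealPoint f)
    (U : X.Opens) (hU : ⊤ ≤ p.1 ⁻¹ᵁ U) : Γ(X, U) →+* ℝ :=
  (Scheme.ΓSpecIso (CommRingCat.of ℝ)).hom.hom.comp (p.1.appLE U ⊤ hU).hom

theorem RealPoint.value_map {X Y : Scheme.{0}} {f : X ⟶ SpecR} {g : Y ⟶ SpecR} (φ : X ⟶ Y)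
    (hφ : φ ≫ g = f) (p : RealPoint f) (U : Y.Opens) (hU : ⊤ ≤ (p.map φ hφ).1 ⁻¹ᵁ U)
    (h : Γ(Y, U)) : (p.map φ hφ).value U hU h = p.value (φ ⁻¹ᵁ U) hU (φ.app U h) := by
  have e : (p.map φ hφ).1.appLE U ⊤ hU = φ.app U ≫ p.1.appLE _ ⊤ hU :=
    Scheme.Hom.comp_appLE p.1 φ U ⊤ hU
  rw [RealPoint.value, e]
  rfl

theorem RealPoint.value_restrict {X : Scheme.{0}} {f : X ⟶ SpecR} (p : RealPoint f)
    {U V : X.Opens} (hVU : V ≤ U) (hV : ⊤ ≤ p.1 ⁻¹ᵁ V) (hU : ⊤ ≤ p.1 ⁻¹ᵁ U) (h : Γ(X, U)) :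
    p.value V hV (X.presheaf.map (homOfLE hVU).op h) = p.value U hU h := by
  have e := p.1.map_appLE hV (homOfLE hVU).op
  rw [RealPoint.value, RealPoint.value, ← e]
  rfl

theorem RealPoint.continuous_map {X Y : Scheme.{0}} {f : X ⟶ SpecR} {g : Y ⟶ SpecR} (φ : X ⟶ Y)
    (hφ : φ ≫ g = f) : Continuous (RealPoint.map φ hφ) := by
  refine continuous_generateFrom_iff.2 ?_
  rintro _ ⟨U, h, W, hW, rfl⟩
  refine TopologicalSpace.isOpen_generateFrom_of_mem ⟨φ ⁻¹ᵁ U, φ.app U h, W, hW, ?_⟩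
  ext p
  refine exists_congr fun hU => ?_
  rw [← p.value_map φ hφ U hU h]

section Affine

variable {A : Type} [CommRing A] [Algebra ℝ A]

/-- The real point of an affine scheme given by a homomorphism to `ℝ`. -/
noncomputable def affinePoint (φ : A →ₐ[ℝ] ℝ) :
    RealPoint (Spec.map (CommRingCat.ofHom (algebraMap ℝ A))) :=
  ⟨Spec.map (CommRingCat.ofHom φ.toRingHom), by
    rw [← Spec.map_comp, ← CommRingCat.ofHom_comp]
    have h : φ.toRingHom.comp (algebraMap ℝ A) = RingHom.id ℝ := φ.comp_algebraMap
    rw [h]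
    exact Spec.map_id _⟩

theorem affinePoint_pt_mem (φ : A →ₐ[ℝ] ℝ) (a : A) :
    a ∈ ((affinePoint φ).pt : PrimeSpectrum A).asIdeal ↔ φ a = 0 := by
  change φ a ∈ IsLocalRing.maximalIdeal ℝ ↔ _
  rw [IsLocalRing.maximalIdeal_eq_bot, Ideal.mem_bot]

/-- Restriction of global functions on an affine scheme to an open subset. -/
noncomputable def globalRestrict (U : (Spec (CommRingCat.of A)).Opens) :
    A →+* Γ(Spec (CommRingCat.of A), U) :=
  ((Scheme.ΓSpecIso (CommRingCat.of A)).inv ≫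
    (Spec (CommRingCat.of A)).presheaf.map (homOfLE le_top).op).hom

theorem value_globalRestrict (φ : A →ₐ[ℝ] ℝ) (U : (Spec (CommRingCat.of A)).Opens)
    (hU : ⊤ ≤ (affinePoint φ).1 ⁻¹ᵁ U) (a : A) :
    (affinePoint φ).value U hU (globalRestrict U a) = φ a := by
  change (affinePoint φ).value U hU ((Spec (CommRingCat.of A)).presheaf.map (homOfLE le_top).op
      ((Scheme.ΓSpecIso (CommRingCat.of A)).inv a)) = φ a
  rw [RealPoint.value_restrict _ le_top hU le_top]
  have h := Scheme.ΓSpecIso_inv_naturality (CommRingCat.ofHom φ.toRingHom)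
  have h1 : (CommRingCat.ofHom φ.toRingHom) = (Scheme.ΓSpecIso (CommRingCat.of A)).inv ≫
      (affinePoint φ).1.appLE ⊤ ⊤ le_top ≫ (Scheme.ΓSpecIso (CommRingCat.of ℝ)).hom := by
    have e : (affinePoint φ).1.appLE ⊤ ⊤ le_top =
        (Spec.map (CommRingCat.ofHom φ.toRingHom)).appTop :=
      Scheme.Hom.appLE_eq_app _
    rw [e, ← Category.assoc, ← h, Category.assoc, Iso.inv_hom_id, Category.comp_id]
  exact (congrArg (fun f : CommRingCat.of A ⟶ CommRingCat.of ℝ => f.hom a) h1).symm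

theorem exists_mul_algebraMap_pow_eq {R : CommRingCat.{0}} (f : R) (U : (Spec R).Opens)
    (hU : U = PrimeSpectrum.basicOpen f) (h : Γ(Spec R, U)) :
    ∃ (g : R) (k : ℕ), h * algebraMap R Γ(Spec R, U) f ^ k = algebraMap R Γ(Spec R, U) g := by
  have : IsLocalization.Away f Γ(Spec R, U) := by
    rw [hU]
    exact IsAffineOpen.instAwayCarrierObjOppositeOpensCarrierCarrierCommRingCatSpecPresheafOpOpensBasicOpen
  obtain ⟨k, g, e⟩ := IsLocalization.Away.surj f h
  exact ⟨g, k, e⟩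

theorem map_eq_div_of_mul_pow_eq {B : Type*} [CommRing B] (v : B →+* ℝ) {x y z : B} {k : ℕ}
    (h : x * y ^ k = z) (hy : v y ≠ 0) : v x = v z / v y ^ k := by
  rw [eq_div_iff (pow_ne_zero _ hy), ← h, map_mul, map_pow]

/-- Sections over a basic open set are fractions of global functions. -/
theorem exists_mul_pow_eq {A : Type} [CommRing A] (f : A)
    (h : Γ(Spec (CommRingCat.of A), PrimeSpectrum.basicOpen f)) :
    ∃ (g : A) (k : ℕ), h * globalRestrict _ f ^ k = globalRestrict _ g := by
  obtain ⟨g, k, e⟩ := exists_mul_algebraMap_pow_eq (R := CommRingCat.of A) f _ rfl h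
  exact ⟨g, k, e⟩

/-- Pointwise convergence of homomorphisms implies convergence of real points in the Euclidean
topology. -/
theorem tendsto_affinePoint {ι : Type*} {l : Filter ι} (φ : ι → A →ₐ[ℝ] ℝ) (φ₀ : A →ₐ[ℝ] ℝ)
    (h : ∀ a, Tendsto (fun i => φ i a) l (𝓝 (φ₀ a))) :
    Tendsto (fun i => affinePoint (φ i)) l (𝓝 (affinePoint φ₀)) := by
  refine TopologicalSpace.tendsto_nhds_generateFrom_iff.2 ?_
  rintro _ ⟨U, s, W, hW, rfl⟩ ⟨hU, hsW⟩
  have hpt : ∀ (ψ : A →ₐ[ℝ] ℝ) (f : A),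
      ⊤ ≤ (affinePoint ψ).1 ⁻¹ᵁ PrimeSpectrum.basicOpen f ↔ ψ f ≠ 0 := fun ψ f =>
    ((affinePoint ψ).top_le_iff _).trans (affinePoint_pt_mem ψ f).not
  obtain ⟨_, ⟨f, rfl⟩, hf, hfU⟩ :=
    PrimeSpectrum.isTopologicalBasis_basic_opens.exists_subset_of_mem_open
    (((affinePoint φ₀).top_le_iff U).1 hU) U.2
  have hfU' : (PrimeSpectrum.basicOpen f : (Spec (CommRingCat.of A)).Opens) ≤ U := hfU
  obtain ⟨g, k, hg⟩ := exists_mul_pow_eq (A := A) f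
    ((Spec (CommRingCat.of A)).presheaf.map (homOfLE hfU').op s)
  have hf₀ : φ₀ f ≠ 0 := (affinePoint_pt_mem φ₀ f).not.1 hf
  have key : ∀ ψ : A →ₐ[ℝ] ℝ, ψ f ≠ 0 → ∃ hU : ⊤ ≤ (affinePoint ψ).1 ⁻¹ᵁ U,
      (affinePoint ψ).value U hU s = ψ g / ψ f ^ k := by
    intro ψ hψ
    have hD := (hpt ψ f).2 hψ
    refine ⟨hD.trans fun x hx => hfU' hx, ?_⟩
    have hf' : (affinePoint ψ).valueHom _ hD (globalRestrict _ f) = ψ f :=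
      value_globalRestrict ψ _ hD f
    have hg' : (affinePoint ψ).valueHom _ hD (globalRestrict _ g) = ψ g :=
      value_globalRestrict ψ _ hD g
    rw [← RealPoint.value_restrict _ hfU' hD, ← hf', ← hg']
    exact map_eq_div_of_mul_pow_eq ((affinePoint ψ).valueHom _ hD) hg (by rwa [hf'])
  obtain ⟨_, hv⟩ := key φ₀ hf₀
  rw [hv] at hsW
  have h1 : Tendsto (fun i => φ i g / φ i f ^ k) l (𝓝 (φ₀ g / φ₀ f ^ k)) :=
    (h g).div ((h f).pow k) (pow_ne_zero _ hf₀)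
  filter_upwards [(h f).eventually_ne hf₀, h1 (hW.mem_nhds hsW)] with i hi hi'
  obtain ⟨hUi, e⟩ := key (φ i) hi
  refine ⟨hUi, ?_⟩
  rw [e]
  exact hi'

end Affine

/-! ### Orbits and the complement of a chart -/

section OrbitHom

variable {n : ℕ}

open Classical in
/-- The restriction of functions on `U_A` to its closed orbit: the characters that are not
invertible go to `0`. -/
noncomputable def orbitHom (A : Set (Fin n → ℝ)) : CoordRing A →ₐ[ℝ] TorusRing n :=
  AddMonoidAlgebra.lift ℝ (TorusRing n) (latticeDual A)
    { toFun := fun m => if -(m.toAdd : Fin n → ℤ) ∈ latticeDual A then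
        AddMonoidAlgebra.single (m.toAdd : Fin n → ℤ) 1 else 0
      map_one' := by
        have h : -((Multiplicative.toAdd (1 : Multiplicative (latticeDual A)) : latticeDual A) :
            Fin n → ℤ) ∈ latticeDual A := by simp
        rw [if_pos h]
        rfl
      map_mul' := fun a b => by
        have h : -((Multiplicative.toAdd (a * b) : latticeDual A) : Fin n → ℤ) ∈ latticeDual A ↔
            -(a.toAdd : Fin n → ℤ) ∈ latticeDual A ∧ -(b.toAdd : Fin n → ℤ) ∈ latticeDual A := by
          rw [toAdd_mul, AddSubmonoid.coe_add]
          refine ⟨fun h => ⟨?_, ?_⟩, fun h => ?_⟩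
          · have := add_mem h b.toAdd.2
            simpa using this
          · have := add_mem h a.toAdd.2
            simpa using this
          · rw [neg_add]
            exact add_mem h.1 h.2
        by_cases ha : -(a.toAdd : Fin n → ℤ) ∈ latticeDual A
        · by_cases hb : -(b.toAdd : Fin n → ℤ) ∈ latticeDual A
          · rw [if_pos (h.2 ⟨ha, hb⟩), if_pos ha, if_pos hb, AddMonoidAlgebra.single_mul_single,
              one_mul]
            rfl
          · rw [if_neg (fun h' => hb (h.1 h').2), if_neg hb, mul_zero]
        · rw [if_neg (fun h' => ha (h.1 h').1), if_neg ha, zero_mul] }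

theorem orbitHom_single_of_mem {A : Set (Fin n → ℝ)} (m : latticeDual A)
    (h : -(m : Fin n → ℤ) ∈ latticeDual A) (r : ℝ) :
    orbitHom A (AddMonoidAlgebra.single m r) = AddMonoidAlgebra.single (m : Fin n → ℤ) r := by
  have h' : -((Multiplicative.toAdd (Multiplicative.ofAdd m) : latticeDual A) : Fin n → ℤ) ∈
    latticeDual A := h
  rw [orbitHom, AddMonoidAlgebra.lift_single]
  refine (congrArg (r • ·) (if_pos h')).trans ?_
  change r • (AddMonoidAlgebra.single (m : Fin n → ℤ) 1 : TorusRing n) = _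
  rw [AddMonoidAlgebra.smul_single, smul_eq_mul, mul_one]

theorem orbitHom_single_of_notMem {A : Set (Fin n → ℝ)} (m : latticeDual A)
    (h : -(m : Fin n → ℤ) ∉ latticeDual A) (r : ℝ) :
    orbitHom A (AddMonoidAlgebra.single m r) = 0 := by
  have h' : -((Multiplicative.toAdd (Multiplicative.ofAdd m) : latticeDual A) : Fin n → ℤ) ∉
    latticeDual A := h
  rw [orbitHom, AddMonoidAlgebra.lift_single]
  exact (congrArg (r • ·) (if_neg h')).trans (smul_zero r)

theorem coeff_orbitHom_incl {A B : Set (Fin n → ℝ)} (h : A ⊆ B) (f : CoordRing B)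
    (m : latticeDual B) (hm : -(m : Fin n → ℤ) ∈ latticeDual A) :
    (orbitHom A (CoordRing.incl h f)).coeff m = f.coeff m := by
  induction f using AddMonoidAlgebra.induction_linear with
  | zero => simp
  | add f g hf hg =>
    rw [map_add, map_add, AddMonoidAlgebra.coeff_add, AddMonoidAlgebra.coeff_add,
      Finsupp.add_apply, Finsupp.add_apply, hf, hg]
  | single m' r =>
    rw [CoordRing.incl_single]
    by_cases hm' : -(m' : Fin n → ℤ) ∈ latticeDual A
    · rw [orbitHom_single_of_mem (A := A) ⟨m', latticeDual_anti h m'.2⟩ hm',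
        AddMonoidAlgebra.coeff_single, AddMonoidAlgebra.coeff_single]
      classical
      rw [Finsupp.single_apply, Finsupp.single_apply]
      exact if_congr ⟨fun e => Subtype.ext e, fun e => congrArg Subtype.val e⟩ rfl rfl
    · have hne : m' ≠ m := fun e => hm' (e ▸ hm)
      rw [orbitHom_single_of_notMem (A := A) ⟨m', latticeDual_anti h m'.2⟩ hm',
        AddMonoidAlgebra.coeff_single, Finsupp.single_eq_of_ne hne.symm]
      rfl

/-- An ideal that contains the characters vanishing on the orbit contains all functions vanishing
on the orbit. -/
theorem mem_of_orbitHom_eq_zero {A B : Set (Fin n → ℝ)} (h : A ⊆ B) (I : Ideal (CoordRing B))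
    (hI : ∀ m : latticeDual B, -(m : Fin n → ℤ) ∉ latticeDual A →
      (AddMonoidAlgebra.single m 1 : CoordRing B) ∈ I) {f : CoordRing B}
    (hf : orbitHom A (CoordRing.incl h f) = 0) : f ∈ I := by
  have e : f = ∑ m ∈ f.coeff.support, AddMonoidAlgebra.single m (f.coeff m) :=
    (AddMonoidAlgebra.sum_coeff_single f).symm
  rw [e]
  refine sum_mem fun m hm => ?_
  have hmA : -(m : Fin n → ℤ) ∉ latticeDual A := fun h' => by
    refine Finsupp.mem_support_iff.1 hm ?_
    rw [← coeff_orbitHom_incl h f m h', hf]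
    rfl
  have e : (AddMonoidAlgebra.single m (f.coeff m) : CoordRing B) =
      algebraMap ℝ _ (f.coeff m) * AddMonoidAlgebra.single m 1 := by
    rw [← Algebra.smul_def, AddMonoidAlgebra.smul_single, smul_eq_mul, mul_one]
  rw [e]
  exact I.mul_mem_left _ (hI m hmA)

/-- The generic point of the orbit `O_τ`: the image of the zero ideal of `ℝ[M]` under the morphism
given by `orbitHom`. Its ideal is the kernel of `orbitHom`. -/
noncomputable def orbitGenericPoint (τ : PointedCone ℝ (Fin n → ℝ)) :
    affineToric (τ : Set (Fin n → ℝ)) :=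
  Spec.map (CommRingCat.ofHom (orbitHom (τ : Set (Fin n → ℝ))).toRingHom)
    (⟨⊥, Ideal.isPrime_bot⟩ : PrimeSpectrum (TorusRing n))

theorem mem_orbitGenericPoint (τ : PointedCone ℝ (Fin n → ℝ))
    (f : CoordRing (τ : Set (Fin n → ℝ))) :
    f ∈ (orbitGenericPoint τ : PrimeSpectrum _).asIdeal ↔ orbitHom (τ : Set (Fin n → ℝ)) f = 0 :=
  Iff.rfl

theorem orbitGenericPoint_mem (τ : PointedCone ℝ (Fin n → ℝ)) : orbitGenericPoint τ ∈ orbit τ :=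
  fun m hm => (mem_orbitGenericPoint τ _).2 (orbitHom_single_of_notMem m hm 1)

/-- A point of `U_ρ` at which all characters that do not vanish identically on `τ` are zero is a
specialization of the generic point of `O_τ`. -/
theorem orbitGenericPoint_specializes {τ ρ : PointedCone ℝ (Fin n → ℝ)}
    (h : (τ : Set (Fin n → ℝ)) ⊆ ρ) (x : affineToric (ρ : Set (Fin n → ℝ)))
    (hx : ∀ m : latticeDual (ρ : Set (Fin n → ℝ)),
      -(m : Fin n → ℤ) ∉ latticeDual (τ : Set (Fin n → ℝ)) →
      (AddMonoidAlgebra.single m 1 : CoordRing (ρ : Set (Fin n → ℝ))) ∈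
        (x : PrimeSpectrum (CoordRing (ρ : Set (Fin n → ℝ)))).asIdeal) :
    affineToricMap h (orbitGenericPoint τ) ⤳ x :=
  specializes_of_asIdeal_le (R := CoordRing (ρ : Set (Fin n → ℝ))) fun _ hf =>
    mem_of_orbitHom_eq_zero h _ hx hf

end OrbitHom

namespace Fan

variable {n : ℕ} (F : Fan n)

theorem orbitClosure_eq (τ : F.cones) :
    F.orbitClosure τ = closure {F.ι τ (orbitGenericPoint τ.1)} := by
  refine subset_antisymm ?_ (closure_mono (Set.singleton_subset_iff.2
    ⟨_, orbitGenericPoint_mem τ.1, rfl⟩))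
  refine closure_minimal ?_ isClosed_closure
  rintro _ ⟨x, hx, rfl⟩
  have h := orbitGenericPoint_specializes (le_refl (τ.1 : Set (Fin n → ℝ))) x hx
  rw [affineToricMap_refl] at h
  exact (h.map (F.ι τ).continuous).mem_closure

theorem mem_orbitClosure {τ ρ : F.cones} (h : (τ.1 : Set (Fin n → ℝ)) ⊆ ρ.1)
    (x : affineToric (ρ.1 : Set (Fin n → ℝ)))
    (hx : ∀ m : latticeDual (ρ.1 : Set (Fin n → ℝ)),
      -(m : Fin n → ℤ) ∉ latticeDual (τ.1 : Set (Fin n → ℝ)) →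
      (AddMonoidAlgebra.single m 1 : CoordRing (ρ.1 : Set (Fin n → ℝ))) ∈
        (x : PrimeSpectrum (CoordRing (ρ.1 : Set (Fin n → ℝ)))).asIdeal) :
    F.ι ρ x ∈ F.orbitClosure τ := by
  rw [orbitClosure_eq, ← F.map_ι_apply h]
  exact ((orbitGenericPoint_specializes h x hx).map (F.ι ρ).continuous).mem_closure

theorem isIrreducible_orbitClosure (τ : F.cones) : IsIrreducible (F.orbitClosure τ) := by
  rw [orbitClosure_eq]
  exact isIrreducible_singleton.closure

/-- A point `y` of `U_ρ` lies on the divisor of a bad ray, or in the chart of a face of `ρ` without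
bad rays; this chart is the locus where a suitable character `m` of `ρ` does not vanish. -/
theorem exists_face_or_mem_orbitClosure (ρ : F.cones) (y : affineToric (ρ.1 : Set (Fin n → ℝ)))
    (bad : PointedCone ℝ (Fin n → ℝ) → Prop) :
    (∃ τ : F.cones, coneDim τ.1 = 1 ∧ bad τ.1 ∧ F.ι ρ y ∈ F.orbitClosure τ) ∨
    ∃ (m : Fin n → ℤ) (hm : m ∈ latticeDual (ρ.1 : Set (Fin n → ℝ))) (ρ' : F.cones),
      (AddMonoidAlgebra.single ⟨m, hm⟩ 1 : CoordRing (ρ.1 : Set (Fin n → ℝ))) ∉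
        (y : PrimeSpectrum (CoordRing (ρ.1 : Set (Fin n → ℝ)))).asIdeal ∧
      (∀ x, x ∈ ρ'.1 ↔ x ∈ ρ.1 ∧ pairing m x = 0) ∧
      ∀ τ ∈ F.cones, τ ≤ ρ'.1 → coneDim τ = 1 → ¬ bad τ := by
  by_cases hτ : ∃ τ : F.cones, coneDim τ.1 = 1 ∧ bad τ.1 ∧ F.ι ρ y ∈ F.orbitClosure τ
  · exact Or.inl hτ
  refine Or.inr ?_
  let y' : PrimeSpectrum (CoordRing (ρ.1 : Set (Fin n → ℝ))) := y
  let Q : AddSubmonoid (Fin n → ℤ) :=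
    { carrier := {m | ∃ hm : m ∈ latticeDual (ρ.1 : Set (Fin n → ℝ)),
        (AddMonoidAlgebra.single ⟨m, hm⟩ 1 : CoordRing (ρ.1 : Set (Fin n → ℝ))) ∉ y'.asIdeal}
      zero_mem' := ⟨zero_mem _, fun h => y'.2.ne_top ((Ideal.eq_top_iff_one _).2 h)⟩
      add_mem' := by
        rintro a b ⟨ha, ha'⟩ ⟨hb, hb'⟩
        refine ⟨add_mem ha hb, fun h => ?_⟩
        have e := CoordRing.single_mul (A := (ρ.1 : Set (Fin n → ℝ))) ⟨a, ha⟩ ⟨b, hb⟩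
        exact (y'.2.mem_or_mem (e ▸ h)).elim ha' hb' }
  obtain ⟨m, ⟨hm, hmy⟩, ρ', hρ', hρρ', hbad⟩ :=
    F.exists_face_of_rays ρ.2 Q (fun m hm => hm.1) bad (by
    intro τ hτF hτρ hd hb
    by_contra! hcon
    refine hτ ⟨⟨τ, hτF⟩, hd, hb, F.mem_orbitClosure hτρ y fun m hm => ?_⟩
    by_contra h
    exact hm (hcon m ⟨m.2, h⟩))
  exact ⟨m, hm, ⟨ρ', hρ'⟩, hmy, hρρ', hbad⟩

/-- The chart of the face of `ρ` cut out by `m` is the locus in `U_ρ` where `m` does not vanish. -/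
theorem ι_mem_range_of_single_notMem {ρ ρ' : F.cones} {m : Fin n → ℤ}
    (hm : m ∈ latticeDual (ρ.1 : Set (Fin n → ℝ)))
    (h : ∀ x, x ∈ ρ'.1 ↔ x ∈ ρ.1 ∧ pairing m x = 0) (y : affineToric (ρ.1 : Set (Fin n → ℝ)))
    (hy : (AddMonoidAlgebra.single ⟨m, hm⟩ 1 : CoordRing (ρ.1 : Set (Fin n → ℝ))) ∉
        (y : PrimeSpectrum (CoordRing (ρ.1 : Set (Fin n → ℝ)))).asIdeal) :
    F.ι ρ y ∈ Set.range (F.ι ρ') := by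
  have hle : (ρ'.1 : Set (Fin n → ℝ)) ⊆ ρ.1 := fun x hx => ((h x).1 hx).1
  obtain ⟨z, hz⟩ := (affineToricMap_range (F.rational _ ρ.2) hm h hle y).2 hy
  exact ⟨z, by rw [← F.map_ι_apply hle, hz]⟩

theorem range_ι_mono {ρ σ : F.cones} (h : (ρ.1 : Set (Fin n → ℝ)) ⊆ σ.1) :
    Set.range (F.ι ρ) ⊆ Set.range (F.ι σ) := by
  rintro _ ⟨z, rfl⟩
  exact ⟨_, F.map_ι_apply h z⟩

/-- The complement of `U_σ` is covered by the divisors of the rays outside `σ`. -/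
theorem exists_mem_orbitClosure_of_notMem_range (σ : F.cones) {x : F.toricVariety}
    (hx : x ∉ Set.range (F.ι σ)) :
    ∃ τ : F.cones, coneDim τ.1 = 1 ∧ ¬ τ.1 ≤ σ.1 ∧ x ∈ F.orbitClosure τ := by
  obtain ⟨ρ, y, rfl⟩ := F.exists_ι_eq x
  refine (F.exists_face_or_mem_orbitClosure ρ y fun τ => ¬ τ ≤ σ.1).resolve_right ?_
  rintro ⟨m, hm, ρ', hmy, hρ', hbad⟩
  refine hx (F.range_ι_mono (ρ := ρ') ?_ (F.ι_mem_range_of_single_notMem hm hρ' y hmy))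
  exact F.le_of_rays ρ'.2 fun τ hτ hle hd => not_not.1 (hbad τ hτ hle hd)

/-- If `τ ⊄ σ`, the chart `U_σ` does not contain the generic point of `O_τ`, and so it does not meet
`Y_τ`. -/
theorem orbitClosure_subset_compl_range {σ τ : F.cones} (h : ¬ τ.1 ≤ σ.1) :
    F.orbitClosure τ ⊆ (Set.range (F.ι σ))ᶜ := by
  rw [orbitClosure_eq]
  refine closure_minimal (Set.singleton_subset_iff.2 ?_)
    (F.ι σ).isOpenEmbedding.isOpen_range.isClosed_compl
  rintro ⟨y, hy⟩
  obtain ⟨ρ, h₁, h₂, z, hz, -⟩ := F.exists_of_ι_eq_ι hy.symm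
  obtain ⟨m, hm, hρ⟩ := (F.isFace_of_le τ.2 ρ.2 h₁).exists_int (F.rational _ τ.2)
  have h3 := (affineToricMap_range (F.rational _ τ.2) hm hρ h₁ (orbitGenericPoint τ.1)).1 ⟨z, hz⟩
  have h4 : -m ∈ latticeDual (τ.1 : Set (Fin n → ℝ)) := by
    by_contra h4
    exact h3 ((mem_orbitGenericPoint τ.1 _).2 (orbitHom_single_of_notMem ⟨m, hm⟩ h4 1))
  refine h fun x hx => h₂ ((hρ x).2 ⟨hx, le_antisymm ?_ (hm x hx)⟩)
  have := h4 x hx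
  rw [pairing_neg] at this
  linarith

/-- The irreducible components of the complement of `U_σ` are the divisors of rays outside `σ`. -/
theorem exists_eq_orbitClosure_of_maximal (σ : F.cones) {Z : Set F.toricVariety}
    (hZ : Maximal (fun Z => IsIrreducible Z ∧ Z ⊆ (Set.range (F.ι σ))ᶜ) Z) :
    ∃ τ : F.cones, coneDim τ.1 = 1 ∧ ¬ τ.1 ≤ σ.1 ∧ Z = F.orbitClosure τ := by
  have : Finite F.cones := F.finite
  have h := isIrreducible_iff_sUnion_isClosed.1 hZ.1.1
    (Set.toFinite (F.orbitClosure '' {τ | coneDim τ.1 = 1 ∧ ¬ τ.1 ≤ σ.1})).toFinset (by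
      intro z hz
      obtain ⟨τ, -, rfl⟩ := (Set.Finite.mem_toFinset _).1 hz
      exact isClosed_closure) (fun x hx => by
      obtain ⟨τ, hd, hτ, hxτ⟩ := F.exists_mem_orbitClosure_of_notMem_range σ (hZ.1.2 hx)
      exact ⟨_, (Set.Finite.coe_toFinset _).symm ▸ ⟨τ, ⟨hd, hτ⟩, rfl⟩, hxτ⟩)
  obtain ⟨_, hz, hZz⟩ := h
  obtain ⟨τ, ⟨hd, hτ⟩, rfl⟩ := (Set.Finite.mem_toFinset _).1 hz
  exact ⟨τ, hd, hτ, subset_antisymm hZz (hZ.2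
    ⟨F.isIrreducible_orbitClosure τ, F.orbitClosure_subset_compl_range hτ⟩ hZz)⟩

end Fan

/-! ### Limits of one-parameter subgroups and the compatible completion -/

theorem torusEval_incl {n : ℕ} {A B : Set (Fin n → ℝ)} (h : A ⊆ B) (ξ : Fin n → ℝˣ)
    (f : CoordRing B) : torusEval A ξ (CoordRing.incl h f) = torusEval B ξ f := by
  rw [← laurentEval_toTorus, ← laurentEval_toTorus, CoordRing.toTorus_incl]

theorem tendsto_torusEval {n : ℕ} {A : Set (Fin n → ℝ)} {ι : Type*} {l : Filter ι}
    {u : ι → Fin n → ℝˣ} {φ : CoordRing A →ₐ[ℝ] ℝ}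
    (h : ∀ m : latticeDual A, Tendsto (fun i => (torusChar (u i) m : ℝ)) l
      (𝓝 (φ (AddMonoidAlgebra.single m 1)))) (f : CoordRing A) :
    Tendsto (fun i => torusEval A (u i) f) l (𝓝 (φ f)) := by
  induction f using AddMonoidAlgebra.induction_linear with
  | zero => simpa using tendsto_const_nhds
  | add f g hf hg =>
    simp only [map_add]
    exact hf.add hg
  | single m r =>
    have e : (AddMonoidAlgebra.single m r : CoordRing A) = r • AddMonoidAlgebra.single m 1 := by
      rw [AddMonoidAlgebra.smul_single, smul_eq_mul, mul_one]
    simp only [torusEval_single]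
    rw [e, map_smul, smul_eq_mul]
    exact (h m).const_mul r

namespace Fan

variable {n : ℕ} (F : Fan n)

/-- The real point of `X_F` given by a real point of the chart `U_τ`. -/
noncomputable def toricPoint (τ : F.cones) (φ : CoordRing (τ.1 : Set (Fin n → ℝ)) →ₐ[ℝ] ℝ) :
    RealPoint F.str :=
  RealPoint.map (F.ι τ) (F.ι_str τ) (affinePoint φ)

theorem toricPoint_incl {σ τ : F.cones} (h : (σ.1 : Set (Fin n → ℝ)) ⊆ τ.1) (ξ : Fin n → ℝˣ) :
    F.toricPoint τ (torusEval _ ξ) = F.toricPoint σ (torusEval _ ξ) := by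
  refine Subtype.ext ?_
  have e : (torusEval (τ.1 : Set (Fin n → ℝ)) ξ).toRingHom =
      (torusEval (σ.1 : Set (Fin n → ℝ)) ξ).toRingHom.comp (CoordRing.incl h).toRingHom :=
    RingHom.ext fun f => (torusEval_incl h ξ f).symm
  change Spec.map (CommRingCat.ofHom (torusEval (τ.1 : Set (Fin n → ℝ)) ξ).toRingHom) ≫ F.ι τ = _
  rw [e, F.map_incl_ι]
  rfl

/-- The embeddings of `T(ℝ)` into `X_F(ℝ)` through different charts agree. -/
theorem toricPoint_torusEval (σ τ : F.cones) (ξ : Fin n → ℝˣ) :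
    F.toricPoint τ (torusEval _ ξ) = F.toricPoint σ (torusEval _ ξ) := by
  rw [F.toricPoint_incl (F.zeroCone_subset σ), F.toricPoint_incl (F.zeroCone_subset τ)]

/-- If all characters in `H_τ` converge along a filter that contains `S`, then the limit point of
the chart `U_τ` is in the Euclidean closure of `S`. -/
theorem toricPoint_mem_closure (σ τ : F.cones) {S : Set (Fin n → ℝˣ)} {ι : Type*} {l : Filter ι}
    [l.NeBot] {u : ι → Fin n → ℝˣ} (hu : ∀ᶠ i in l, u i ∈ S)
    {φ : CoordRing (τ.1 : Set (Fin n → ℝ)) →ₐ[ℝ] ℝ}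
    (h : ∀ m : latticeDual (τ.1 : Set (Fin n → ℝ)), Tendsto (fun i => (torusChar (u i) m : ℝ)) l
      (𝓝 (φ (AddMonoidAlgebra.single m 1)))) :
    F.toricPoint τ φ ∈ closure (F.torusSubset σ S) := by
  have h1 : Tendsto (fun i => F.toricPoint τ (torusEval _ (u i))) l (𝓝 (F.toricPoint τ φ)) :=
    ((RealPoint.continuous_map (F.ι τ) (F.ι_str τ)).tendsto _).comp
      (tendsto_affinePoint _ _ (tendsto_torusEval h))
  refine mem_closure_of_tendsto h1 (hu.mono fun i hi => ?_)
  rw [F.toricPoint_torusEval σ]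
  exact ⟨_, ⟨u i, hi, rfl⟩, rfl⟩

end Fan

/-- The real point of the orbit of `U_A` that is obtained from `ξ ∈ T(ℝ)`. -/
noncomputable def orbitPoint {n : ℕ} (A : Set (Fin n → ℝ)) (ξ : Fin n → ℝˣ) :
    CoordRing A →ₐ[ℝ] ℝ :=
  (laurentEval ξ).comp (orbitHom A)

/-- The characters of a ray that are invertible are those orthogonal to its generator. -/
theorem neg_mem_latticeDual_iff {n : ℕ} {τ : PointedCone ℝ (Fin n → ℝ)} {v : Fin n → ℤ}
    (hv : intCast v ∈ τ) (hgen : ∀ x ∈ τ, ∃ c : ℝ, 0 ≤ c ∧ x = c • intCast v) {m : Fin n → ℤ}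
    (hm : m ∈ latticeDual (τ : Set (Fin n → ℝ))) :
    -m ∈ latticeDual (τ : Set (Fin n → ℝ)) ↔ m ⬝ᵥ v = 0 := by
  constructor
  · intro h
    have h1 := h _ hv
    have h2 := hm _ hv
    rw [pairing_neg, pairing_intCast] at h1
    rw [pairing_intCast] at h2
    have h3 : ((m ⬝ᵥ v : ℤ) : ℝ) = 0 := by linarith
    exact_mod_cast h3
  · intro h x hx
    obtain ⟨c, -, rfl⟩ := hgen x hx
    rw [pairing_neg, pairing_eq, dotProduct_smul, ← pairing_eq, pairing_intCast, h]
    simp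

/-- The sequence `1, 1/2, 1/3, …` of positive units tending to zero. -/
noncomputable def invSucc (k : ℕ) : ℝˣ := Units.mk0 (1 / ((k : ℝ) + 1)) (by positivity)

theorem tendsto_invSucc : Tendsto (fun k => (invSucc k : ℝ)) atTop (𝓝 0) :=
  tendsto_one_div_add_atTop_nhds_zero_nat

/-- Along a one-parameter subgroup in the relative interior of a ray, points of the torus converge
to the open orbit of the corresponding divisor. -/
theorem tendsto_torusChar_cochar {n : ℕ} {τ : PointedCone ℝ (Fin n → ℝ)} {v : Fin n → ℤ}
    (hv : intCast v ∈ τ) (hgen : ∀ x ∈ τ, ∃ c : ℝ, 0 ≤ c ∧ x = c • intCast v) (ξ : Fin n → ℝˣ)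
    (m : latticeDual (τ : Set (Fin n → ℝ))) :
    Tendsto (fun k => (torusChar (cochar v (invSucc k) * ξ) m : ℝ)) atTop
      (𝓝 (orbitPoint (τ : Set (Fin n → ℝ)) ξ (AddMonoidAlgebra.single m 1))) := by
  simp only [torusChar_cochar_mul, Units.val_mul, Units.val_zpow_eq_zpow_val]
  rw [orbitPoint, AlgHom.comp_apply]
  by_cases h : -(m : Fin n → ℤ) ∈ latticeDual (τ : Set (Fin n → ℝ))
  · rw [orbitHom_single_of_mem _ h, laurentEval_single, (neg_mem_latticeDual_iff hv hgen m.2).1 h]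
    simp
  · rw [orbitHom_single_of_notMem _ h, map_zero]
    have h0 : (m : Fin n → ℤ) ⬝ᵥ v ≠ 0 := fun h0 => h ((neg_mem_latticeDual_iff hv hgen m.2).2 h0)
    have h1 : 0 ≤ (m : Fin n → ℤ) ⬝ᵥ v := by
      have := m.2 _ hv
      rw [pairing_intCast] at this
      exact_mod_cast this
    obtain ⟨j, hj⟩ := Int.eq_ofNat_of_zero_le h1
    rw [hj] at h0 ⊢
    have hj0 : j ≠ 0 := by exact_mod_cast h0
    have h2 := (tendsto_invSucc.pow j).mul_const (torusChar ξ m : ℝ)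
    rw [zero_pow hj0, zero_mul] at h2
    simpa using h2

theorem eventually_cochar_mem {n : ℕ} {S : Set (Fin n → ℝˣ)} {v : Fin n → ℤ} {ξ : Fin n → ℝˣ}
    (h : ξ ∈ limitSet S v) : ∀ᶠ k in atTop, cochar v (invSucc k) * ξ ∈ S := by
  obtain ⟨ε, hε, h⟩ := h
  filter_upwards [tendsto_invSucc.eventually_lt_const hε] with k hk
  refine h _ ?_ hk
  change (0 : ℝ) < 1 / ((k : ℝ) + 1)
  positivity

namespace Fan

variable {n : ℕ} (F : Fan n)

/-- If `K₀(S)` meets the relative interior of the ray `τ`, the real points of the divisor `Y_τ` in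
the closure of `S` are Zariski dense: they contain the limits of the points of an open subset of
the torus under a one-parameter subgroup. -/
theorem orbitClosure_subset_closure (σ τ : F.cones) {S : Set (Fin n → ℝˣ)} (hd : coneDim τ.1 = 1)
    (h : MeetsRelint S τ.1) :
    F.orbitClosure τ ⊆
      closure (RealPoint.pt '' {p ∈ closure (F.torusSubset σ S) | p.pt ∈ F.orbitClosure τ}) := by
  obtain ⟨v, hvK, hv, hgen⟩ := h.exists_generator (F.salient _ τ.2) hd
  have hmem : ∀ ξ ∈ limitSet S v, F.toricPoint τ (orbitPoint _ ξ) ∈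
      {p ∈ closure (F.torusSubset σ S) | p.pt ∈ F.orbitClosure τ} := by
    intro ξ hξ
    refine ⟨F.toricPoint_mem_closure σ τ (eventually_cochar_mem hξ)
      (tendsto_torusChar_cochar hv hgen ξ), ?_⟩
    refine subset_closure ⟨_, fun m hm => ?_, rfl⟩
    refine (affinePoint_pt_mem _ _).2 ?_
    rw [orbitPoint, AlgHom.comp_apply, orbitHom_single_of_notMem m hm, map_zero]
  nth_rewrite 1 [orbitClosure_eq]
  refine closure_minimal (Set.singleton_subset_iff.2 (mem_closure_iff.2 ?_)) isClosed_closure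
  intro V hV hηV
  obtain ⟨_, ⟨f, rfl⟩, hf, hfV⟩ :=
    PrimeSpectrum.isTopologicalBasis_basic_opens.exists_subset_of_mem_open
    (a := (orbitGenericPoint τ.1 : PrimeSpectrum (CoordRing (τ.1 : Set (Fin n → ℝ)))))
    (u := F.ι τ ⁻¹' V) hηV (hV.preimage (F.ι τ).continuous)
  obtain ⟨ξ, hξ, hne⟩ : ∃ ξ ∈ interior (limitSet S v),
      laurentEval ξ (orbitHom (τ.1 : Set (Fin n → ℝ)) f) ≠ 0 := by
    by_contra! h0
    exact hf ((mem_orbitGenericPoint _ _).2 (eq_zero_of_laurentEval_eq_zero isOpen_interior hvK h0))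
  refine ⟨_, ?_, ⟨_, hmem ξ (interior_subset hξ), rfl⟩⟩
  exact hfV ((affinePoint_pt_mem (orbitPoint _ ξ) f).not.2 hne)

/-- `X_F` is an `S`-compatible completion of `U_σ`. -/
theorem isCompatibleCompletion (hF : F.IsComplete) (σ : F.cones) {S : Set (Fin n → ℝˣ)}
    (hTC : F.ToricCompatible σ S) :
    IsCompatibleCompletion (affineToricStr (σ.1 : Set (Fin n → ℝ))) F.str (F.ι σ)
      (torusPoint (σ.1 : Set (Fin n → ℝ)) '' S) where
  affine := inferInstance
  normal_source := (F.rational _ σ.2).hasFiniteDual.isNormalVariety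
  comm := F.ι_str σ
  isOpenImmersion := inferInstance
  isDominant := inferInstance
  normal_target := F.isNormalVariety
  proper := F.isProper hF
  compatible Z hZ := by
    obtain ⟨τ, hd, hτ, rfl⟩ := F.exists_eq_orbitClosure_of_maximal σ hZ
    exact (hTC τ hd hτ).imp_right (F.orbitClosure_subset_closure σ τ hd)

end Fan

/-! ### Regular functions and bounded functions -/

section RegularFunctions

variable {n : ℕ}

theorem eval_coordEquiv {A : Set (Fin n → ℝ)} (f : CoordRing A) (φ : CoordRing A →ₐ[ℝ] ℝ) :
    (coordEquiv A f).eval (affinePoint φ) = φ f := by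
  rw [← value_globalRestrict φ ⊤ le_top f]
  exact (RealPoint.value_restrict (affinePoint φ) le_top le_top le_top _).symm

theorem appTop_affineToricMap {A B : Set (Fin n → ℝ)} (h : A ⊆ B) (f : CoordRing B) :
    (affineToricMap h).appTop.hom (coordEquiv B f) = coordEquiv A (CoordRing.incl h f) := by
  have e := Scheme.ΓSpecIso_inv_naturality (CommRingCat.ofHom (CoordRing.incl h).toRingHom)
  exact (congrArg (fun φ => φ.hom f) e).symm

namespace Fan

variable (F : Fan n)

/-- The morphism from `X_F` to the spectrum of `ℝ[M ∩ |F|^*]`. -/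
noncomputable def toAffine : F.toricVariety ⟶ affineToric F.support :=
  colimit.desc F.diagram
    { pt := affineToric F.support
      ι :=
        { app := fun σ => affineToricMap (F.subset_support σ)
          naturality := fun σ τ f => by
            refine Eq.trans ?_ (Category.comp_id _).symm
            exact (affineToricMap_trans (leOfHom f) (F.subset_support τ)).symm } }

theorem ι_toAffine (σ : F.cones) : F.ι σ ≫ F.toAffine = affineToricMap (F.subset_support σ) :=
  colimit.ι_desc _ _

theorem pullback_injective (σ : F.cones) :
    Function.Injective (RegularFunctions.pullback (F.ι σ) (F.ι_str σ)) := by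
  have := IsSchemeTheoreticallyDominant.of_isDominant (F.ι σ)
  have h : QuasiCompact (F.ι σ ≫ F.str) :=
    (F.ι_str σ).symm ▸ (F.rational _ σ.2).hasFiniteDual.isNormalVariety.quasiCompact
  have : QuasiCompact (F.ι σ) := QuasiCompact.of_comp (F.ι σ) F.str
  exact (F.ι σ).app_injective ⊤

/-- The restriction of a global function on `X_F` to the chart `U_σ`. -/
noncomputable def chartFunction (s : RegularFunctions F.str) (σ : F.cones) :
    CoordRing (σ.1 : Set (Fin n → ℝ)) :=
  (coordEquiv _).symm (RegularFunctions.pullback (F.ι σ) (F.ι_str σ) s)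

theorem coordEquiv_chartFunction (s : RegularFunctions F.str) (σ : F.cones) :
    coordEquiv _ (F.chartFunction s σ) = RegularFunctions.pullback (F.ι σ) (F.ι_str σ) s :=
  AlgEquiv.apply_symm_apply _ _

theorem incl_chartFunction (s : RegularFunctions F.str) {σ τ : F.cones}
    (h : (σ.1 : Set (Fin n → ℝ)) ⊆ τ.1) :
    CoordRing.incl h (F.chartFunction s τ) = F.chartFunction s σ := by
  refine (coordEquiv _).injective ?_
  rw [← appTop_affineToricMap, coordEquiv_chartFunction, coordEquiv_chartFunction]
  change (affineToricMap h).appTop.hom ((F.ι τ).appTop.hom s) = (F.ι σ).appTop.hom s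
  rw [← F.map_ι h, Scheme.Hom.comp_appTop]
  rfl

/-- `𝒪(X_F) = ℝ[M ∩ |F|^*]`, as subrings of `ℝ[U_σ]`. -/
theorem range_pullback (σ : F.cones) :
    (RegularFunctions.pullback (F.ι σ) (F.ι_str σ)).range =
      ((coordEquiv (σ.1 : Set (Fin n → ℝ))).toAlgHom.comp
        (CoordRing.incl (F.subset_support σ))).range := by
  refine le_antisymm ?_ ?_
  · rintro _ ⟨s, rfl⟩
    have hs : ∀ τ : F.cones, CoordRing.toTorus _ (F.chartFunction s τ) =
        CoordRing.toTorus _ (F.chartFunction s σ) := by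
      intro τ
      rw [← CoordRing.toTorus_incl (F.zeroCone_subset τ),
        ← CoordRing.toTorus_incl (F.zeroCone_subset σ), incl_chartFunction, incl_chartFunction]
    obtain ⟨g, hg⟩ := (CoordRing.mem_range_toTorus (A := F.support) _).2
      (fun m (hm : (CoordRing.toTorus _ (F.chartFunction s σ)).coeff m ≠ 0) => by
        rintro x ⟨τ, hτ, hx⟩
        exact (CoordRing.mem_range_toTorus _).1 ⟨_, hs ⟨τ, hτ⟩⟩ m hm x hx)
    refine ⟨g, ?_⟩
    have e : CoordRing.incl (F.subset_support σ) g = F.chartFunction s σ :=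
      CoordRing.toTorus_injective _ (by rw [CoordRing.toTorus_incl, hg])
    change coordEquiv _ (CoordRing.incl (F.subset_support σ) g) = _
    rw [e, coordEquiv_chartFunction]
    rfl
  · rintro _ ⟨f, rfl⟩
    refine ⟨F.toAffine.appTop.hom (coordEquiv _ f), ?_⟩
    change (F.ι σ).appTop.hom (F.toAffine.appTop.hom (coordEquiv _ f)) =
      coordEquiv _ (CoordRing.incl (F.subset_support σ) f)
    rw [← appTop_affineToricMap, ← F.ι_toAffine, Scheme.Hom.comp_appTop]
    rfl

end Fan

end RegularFunctions

/-- If all characters in `M ∩ A^*` are bounded along an ultrafilter on the torus, then they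
converge, and the limits define a real point of `U_A`. -/
theorem exists_limit_hom {n : ℕ} {A : Set (Fin n → ℝ)} (𝒰 : Ultrafilter (Fin n → ℝˣ))
    (h : ∀ m ∈ latticeDual A, ∃ C : ℝ, ∀ᶠ ξ in 𝒰, |(torusChar ξ m : ℝ)| ≤ C) :
    ∃ φ : CoordRing A →ₐ[ℝ] ℝ, ∀ m : latticeDual A,
      Tendsto (fun ξ : Fin n → ℝˣ => (torusChar ξ m : ℝ)) 𝒰
        (𝓝 (φ (AddMonoidAlgebra.single m 1))) := by
  have hL : ∀ m : latticeDual A, ∃ L : ℝ,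
      Tendsto (fun ξ : Fin n → ℝˣ => (torusChar ξ m : ℝ)) 𝒰 (𝓝 L) := by
    intro m
    obtain ⟨C, hC⟩ := h m m.2
    obtain ⟨L, -, hL⟩ := (isCompact_Icc (a := -C) (b := C)).ultrafilter_le_nhds
      (𝒰.map fun ξ => (torusChar ξ m : ℝ)) (le_principal_iff.2 (hC.mono fun ξ hξ => abs_le.1 hξ))
    exact ⟨L, hL⟩
  choose L hL using hL
  refine ⟨AddMonoidAlgebra.lift ℝ ℝ (latticeDual A)
    { toFun := fun m => L m.toAdd
      map_one' := tendsto_nhds_unique (hL 0) (by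
        simp only [AddSubmonoid.coe_zero, torusChar_zero, Units.val_one]
        exact tendsto_const_nhds)
      map_mul' := fun a b => tendsto_nhds_unique (hL (a.toAdd + b.toAdd)) (by
        simp only [AddSubmonoid.coe_add, torusChar_add, Units.val_mul]
        exact (hL _).mul (hL _)) }, fun m => ?_⟩
  rw [AddMonoidAlgebra.lift_single, one_smul]
  exact hL m

namespace Fan

variable {n : ℕ} (F : Fan n)

/-- Characters in `M ∩ |F_S|^*` are bounded on `S`. Otherwise such a character `m` is unbounded
along an ultrafilter on `S`. By completeness the ultrafilter converges to a real point of a chart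
`U_ρ`, in the closure of `S`. By the compatibility condition, this point lies in a chart of `F_S`,
on which `m` is regular, so that `m` has a finite limit. -/
theorem bounded_torusChar (hF : F.IsComplete) (σ : F.cones) {S : Set (Fin n → ℝˣ)}
    (hTC : F.ToricCompatible σ S) {m : Fin n → ℤ} (hm : m ∈ latticeDual (F.subfan σ S).support) :
    ∃ c : ℝ, ∀ ξ ∈ S, |(torusChar ξ m : ℝ)| ≤ c := by
  by_contra! hcon
  let l : Filter (Fin n → ℝˣ) := comap (fun ξ => |(torusChar ξ m : ℝ)|) atTop ⊓ 𝓟 S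
  have hl : l.NeBot := by
    refine frequently_mem_iff_neBot.1 ?_
    refine ((atTop_basis.comap fun ξ => |(torusChar ξ m : ℝ)|).frequently_iff).2 fun c _ => ?_
    obtain ⟨ξ, hξ, hc⟩ := hcon c
    exact ⟨ξ, hc.le, hξ⟩
  let 𝒰 := Ultrafilter.of l
  have hS : ∀ᶠ ξ in (𝒰 : Filter _), ξ ∈ S :=
    le_principal_iff.1 ((Ultrafilter.of_le l).trans inf_le_right)
  have htop : Tendsto (fun ξ => |(torusChar ξ m : ℝ)|) 𝒰 atTop :=
    tendsto_comap.mono_left ((Ultrafilter.of_le l).trans inf_le_left)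
  let P : AddSubmonoid (Fin n → ℤ) :=
    { carrier := {a | ∃ C : ℝ, ∀ᶠ ξ in (𝒰 : Filter _), |(torusChar ξ a : ℝ)| ≤ C}
      zero_mem' := ⟨1, Eventually.of_forall fun ξ => by simp [torusChar_zero]⟩
      add_mem' := by
        rintro a b ⟨C, hC⟩ ⟨D, hD⟩
        refine ⟨C * D, ?_⟩
        filter_upwards [hC, hD] with ξ h1 h2
        rw [torusChar_add, Units.val_mul, abs_mul]
        exact mul_le_mul h1 h2 (abs_nonneg _) ((abs_nonneg _).trans h1) }
  have hbot : ∀ a : Fin n → ℤ, a ∈ latticeDual ((⊥ : PointedCone ℝ (Fin n → ℝ)) : Set _) := by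
    intro a x hx
    rw [show x = 0 from hx]
    simp [pairing]
  obtain ⟨ρ', hρ', -, hP⟩ := F.exists_cone_of_total hF F.bot_mem P (by
    intro a _ _
    rcases (Ultrafilter.eventually_or (f := 𝒰)).1 (Eventually.of_forall fun ξ : Fin n → ℝˣ =>
      le_total |(torusChar ξ a : ℝ)| 1) with h | h
    · exact Or.inl ⟨1, h⟩
    · refine Or.inr ⟨1, h.mono fun ξ hξ => ?_⟩
      have e : |(torusChar ξ (-a) : ℝ)| * |(torusChar ξ a : ℝ)| = 1 := by
        rw [← abs_mul, ← Units.val_mul, ← torusChar_add, neg_add_cancel, torusChar_zero,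
          Units.val_one, abs_one]
      calc |(torusChar ξ (-a) : ℝ)| = |(torusChar ξ (-a) : ℝ)| * 1 := (mul_one _).symm
        _ ≤ |(torusChar ξ (-a) : ℝ)| * |(torusChar ξ a : ℝ)| := by gcongr
        _ = 1 := e)
  let ρ : F.cones := ⟨ρ', hρ'⟩
  obtain ⟨φ, hφ⟩ := exists_limit_hom (A := (ρ.1 : Set (Fin n → ℝ))) 𝒰
    (fun a ha => hP a ha (hbot _))
  have hcl : F.toricPoint ρ φ ∈ closure (F.torusSubset σ S) :=
    F.toricPoint_mem_closure σ ρ (u := id) hS hφ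
  rcases F.exists_face_or_mem_orbitClosure ρ (affinePoint φ).pt
    (fun τ => ¬ τ ≤ σ.1 ∧ ¬ MeetsRelint S τ) with ⟨τ, hd, hbad, hτ⟩ | ⟨a, ha, ρ'', hap, hρ'', hgood⟩
  · have h := (hTC τ hd hbad.1).resolve_right hbad.2
    exact (Set.eq_empty_iff_forall_notMem.1 h) (F.toricPoint ρ φ) ⟨hcl, hτ⟩
  -- The limit point lies in the chart of `ρ''`, which is in `F_S`. Up to a power of the character
  -- `a`, whose limit is not zero, `m` is regular on `U_ρ`.
  have hS' : ρ''.1 ∈ (F.subfan σ S).cones := ⟨ρ''.2, fun τ hτ hd => by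
    by_contra! h
    exact hgood τ (F.face_mem _ ρ''.2 τ hτ) hτ.le hd h⟩
  obtain ⟨-, hw⟩ := latticeDual_face (τ := ρ''.1) (F.rational _ ρ.2) ha hρ''
  obtain ⟨k, hk⟩ := hw m (fun x hx => hm x ⟨_, hS', hx⟩)
  have ha0 : φ (AddMonoidAlgebra.single ⟨a, ha⟩ 1) ≠ 0 := (affinePoint_pt_mem φ _).not.1 hap
  have h1 := (hφ ⟨_, hk⟩).div ((hφ ⟨a, ha⟩).pow k) (pow_ne_zero k ha0)
  have h2 : ∀ ξ : Fin n → ℝˣ, (torusChar ξ (m + k • a) : ℝ) / (torusChar ξ a : ℝ) ^ k =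
      torusChar ξ m := by
    intro ξ
    have e : ∀ j : ℕ, torusChar ξ (j • a) = torusChar ξ a ^ j := by
      intro j
      induction j with
      | zero => rw [zero_smul, torusChar_zero, pow_zero]
      | succ j ih => rw [succ_nsmul, torusChar_add, ih, pow_succ]
    rw [torusChar_add, e, Units.val_mul, Units.val_pow_eq_pow_val,
      mul_div_cancel_right₀ _ (pow_ne_zero k (Units.ne_zero _))]
  exact not_tendsto_nhds_of_tendsto_atTop htop _ ((h1.congr h2).abs)

/-- Laurent polynomials that are regular on `U_σ` and bounded on `S` only involve characters in
`M ∩ |F_S|^*`. It suffices to test this on the rays of `F_S`. On those outside `σ`, the pullbacks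
along one-parameter subgroups that end in `S` are bounded near `0`, so they are polynomials. -/
theorem mem_latticeDual_of_bounded (σ : F.cones) {S : Set (Fin n → ℝˣ)}
    (f : CoordRing (σ.1 : Set (Fin n → ℝ))) {c : ℝ} (hc : ∀ ξ ∈ S, |torusEval _ ξ f| ≤ c)
    {m : Fin n → ℤ} (hm : (CoordRing.toTorus _ f).coeff m ≠ 0) :
    m ∈ latticeDual (F.subfan σ S).support := by
  rintro x ⟨ρ, hρ, hx⟩
  let K : PointedCone ℝ (Fin n → ℝ) :=
    { carrier := {x | 0 ≤ pairing m x}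
      zero_mem' := by simp [pairing]
      add_mem' := fun {a b} ha hb => by
        change 0 ≤ pairing m (a + b)
        rw [pairing_eq, dotProduct_add]
        exact add_nonneg ha hb
      smul_mem' := fun r a ha => by
        change 0 ≤ pairing m ((r : ℝ) • a)
        rw [pairing_eq, dotProduct_smul]
        exact mul_nonneg r.2 ha }
  have hmσ : m ∈ latticeDual (σ.1 : Set (Fin n → ℝ)) :=
    (CoordRing.mem_range_toTorus _).1 ⟨f, rfl⟩ m hm
  refine F.le_of_rays (K := K) hρ.1 (fun τ hτ hτρ hd => ?_) hx
  rcases hρ.2 τ (F.isFace_of_le hρ.1 hτ hτρ) hd with h | h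
  · exact fun y hy => hmσ y (h hy)
  · obtain ⟨v, hvK, hv, hgen⟩ := h.exists_generator (F.salient _ hτ) hd
    have h1 : 0 ≤ m ⬝ᵥ v := by
      refine dotProduct_nonneg_of_cocharPullback isOpen_interior hvK (fun ξ hξ => ?_) hm
      obtain ⟨ε, hε, hξ⟩ := interior_subset hξ
      refine exists_polynomial_of_bound (c := c) hε fun s hs hsε => ?_
      rw [eval₂_cocharPullback, laurentEval_toTorus]
      exact hc _ (hξ s hs hsε)
    intro y hy
    obtain ⟨r, hr, rfl⟩ := hgen y hy
    change 0 ≤ pairing m (r • intCast v)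
    rw [pairing_eq, dotProduct_smul, ← pairing_eq, pairing_intCast]
    exact mul_nonneg hr (by exact_mod_cast h1)

/-- `B_{U_σ}(S) = ℝ[M ∩ |F_S|^*]`. -/
theorem boundedFunctions_eq (hF : F.IsComplete) (σ : F.cones) {S : Set (Fin n → ℝˣ)}
    (hTC : F.ToricCompatible σ S) :
    boundedFunctions (affineToricStr (σ.1 : Set (Fin n → ℝ)))
        (torusPoint (σ.1 : Set (Fin n → ℝ)) '' S) =
      ((coordEquiv (σ.1 : Set (Fin n → ℝ))).toAlgHom.comp
        (CoordRing.incl ((F.subfan σ S).subset_support (F.subfanCone σ S)))).range := by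
  refine le_antisymm ?_ ?_
  · rintro h ⟨c, hc⟩
    obtain ⟨f, rfl⟩ := (coordEquiv (σ.1 : Set (Fin n → ℝ))).surjective h
    have hc' : ∀ ξ ∈ S, |torusEval _ ξ f| ≤ c := fun ξ hξ => by
      rw [← eval_coordEquiv]
      exact hc _ ⟨ξ, hξ, rfl⟩
    obtain ⟨g, hg⟩ := (CoordRing.mem_range_toTorus _).2
      (fun m hm => F.mem_latticeDual_of_bounded σ f hc' (m := m) hm)
    refine ⟨g, congrArg (coordEquiv (σ.1 : Set (Fin n → ℝ))) ?_⟩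
    refine CoordRing.toTorus_injective _ ?_
    exact (CoordRing.toTorus_incl ((F.subfan σ S).subset_support (F.subfanCone σ S)) g).trans hg
  · rintro _ ⟨f, rfl⟩
    induction f using AddMonoidAlgebra.induction_linear with
    | zero =>
      rw [map_zero]
      exact zero_mem _
    | add f g hf hg =>
      rw [map_add]
      exact add_mem hf hg
    | single m r =>
      obtain ⟨c, hc⟩ := F.bounded_torusChar hF σ hTC m.2
      refine ⟨|r| * c, ?_⟩
      rintro _ ⟨ξ, hξ, rfl⟩
      change |(coordEquiv _ (CoordRing.incl ((F.subfan σ S).subset_support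
        (F.subfanCone σ S)) (AddMonoidAlgebra.single m r))).eval
        (affinePoint (torusEval _ ξ))| ≤ _
      rw [eval_coordEquiv, torusEval_incl, torusEval_single, abs_mul]
      exact mul_le_mul_of_nonneg_left (hc ξ hξ) (abs_nonneg _)

end Fan

end ToricCompletion

theorem proposition2p8 {n : ℕ} (F : Fan n) (hF : F.IsComplete) (σ : F.cones)
    (S : Set (Fin n → ℝˣ)) (hSo : IsOpen S) (hSa : IsSemialgebraic S)
    (hTC : F.ToricCompatible σ S) :
    -- `X_F` is an `S`-compatible completion of `U_σ`
    IsCompatibleCompletion (affineToricStr (σ.1 : Set (Fin n → ℝ))) F.str (F.ι σ)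
      (torusPoint (σ.1 : Set (Fin n → ℝ)) '' S) ∧
    -- restriction to `U_σ` identifies `𝒪(X_{F_S})` with `B_{U_σ}(S)`
    Function.Injective (RegularFunctions.pullback ((F.subfan σ S).ι (F.subfanCone σ S))
      ((F.subfan σ S).ι_str (F.subfanCone σ S))) ∧
    boundedFunctions (affineToricStr (σ.1 : Set (Fin n → ℝ)))
        (torusPoint (σ.1 : Set (Fin n → ℝ)) '' S) =
      (RegularFunctions.pullback ((F.subfan σ S).ι (F.subfanCone σ S))
        ((F.subfan σ S).ι_str (F.subfanCone σ S))).range ∧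
    -- and `B_{U_σ}(S) = ℝ[M ∩ |F_S|^*]` inside `ℝ[U_σ] = ℝ[H_σ]`
    boundedFunctions (affineToricStr (σ.1 : Set (Fin n → ℝ)))
        (torusPoint (σ.1 : Set (Fin n → ℝ)) '' S) =
      ((coordEquiv (σ.1 : Set (Fin n → ℝ))).toAlgHom.comp
        (CoordRing.incl ((F.subfan σ S).subset_support (F.subfanCone σ S)))).range ∧
    Algebra.FiniteType ℝ (boundedFunctions (affineToricStr (σ.1 : Set (Fin n → ℝ)))
        (torusPoint (σ.1 : Set (Fin n → ℝ)) '' S)) := by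
  have hB := F.boundedFunctions_eq hF σ hTC
  refine ⟨F.isCompatibleCompletion hF σ hTC, (F.subfan σ S).pullback_injective _,
    hB.trans ((F.subfan σ S).range_pullback (F.subfanCone σ S)).symm, hB, ?_⟩
  rw [hB]
  have := (F.subfan σ S).hasFiniteDual_support.finiteType
  exact Algebra.FiniteType.of_surjective (AlgHom.rangeRestrict _)
    (AlgHom.rangeRestrict_surjective _)
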